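/- Let $\mathfrak{sl}_3=\mathfrak{sl}_3(\mathbb C)$ be the complexification of $\mathfrak{su}_3$, with generators $e_{pq}$ ($1\le p,q\le 3$), $[e_{pq},e_{rs}]=\delta_{qr}e_{ps}-\delta_{sp}e_{rq}$, $\sum_i e_{ii}=0$, and $h_1=e_{11}-e_{22}$, $h_2=e_{22}-e_{33}$. A highest-weight vector of weight $(a,b)$ is a vector $v$ with $h_1v=(a-1)v$, $h_2v=(b-1)v$ and $e_{pq}v=0$ for $p<q$; for positive integers $a,b$ let $[a,b]$ be the finite-dimensional irreducible representation that contains a non-zero such vector. In $U(\mathfrak{sl}_3)\otimes U(\mathfrak{sl}_3)$ put $e^{(1)}_{pq}=e_{pq}\otimes 1$, $e^{(2)}_{pq}=1\otimes e_{pq}$ and, for $a_1,\dots,a_\mu\in\{1,2\}$ (sums over repeated indices from $1$ to $3$), $$T^{(a_1,\dots,a_\mu)}=e^{(a_1)}_{i_2i_1}e^{(a_2)}_{i_3i_2}\cdots e^{(a_\mu)}_{i_1i_\mu},\qquad \overline T^{(a_1,\dots,a_\mu)}=e^{(a_1)}_{i_1i_2}e^{(a_2)}_{i_2i_3}\cdots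 e^{(a_\mu)}_{i_\mu i_1},$$ $L=\frac12(e_{i_1i_2}e_{i_2i_3}e_{i_3i_1}+e_{i_2i_1}e_{i_3i_2}e_{i_1i_3})$, and $$X=\tfrac12\bigl(T^{(1,1,2)}-T^{(1,2,2)}\bigr)+\tfrac13(L\otimes1-1\otimes L),$$ $$Y=\tfrac12\bigl(T^{(1,1,2,2)}+\overline T^{(1,1,2,2)}\bigr)-\tfrac1{12}\bigl(T^{(1,2)}\bigr)^2-\tfrac5{12}T^{(1,1)}T^{(2,2)}-2T^{(1,2)}.$$ Let $\mathbf m=(m_1,m_2,m_1',m_2',m_1'',m_2'')$ be positive integers, let $M_{\mathbf m}$ be the space of highest-weight vectors of weight $(m_1'',m_2'')$ in $[m_1,m_2]\otimes[m_1',m_2']$ (zero included), and assume that $d=d_{\mathbf m}=\dim M_{\mathbf m}$ is positive. Put $$\ell=\tfrac13(m_1+2m_2+m_1'+2m_2'-m_1''-2m_2''),\qquad n=\tfrac13(2m_1+m_2+2m_1'+m_2'-2m_1''-m_2''),$$ $(\xi_1,\xi_2,\xi_3)=(\ell,\,m_2,\,m_1'+\ell-n)$ if $\ell\le n$ and $(\xi_1,\xi_2,\xi_3)=(n,\,m_1',\,m_2+n-\ell)$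 otherwise, $(\xi_4,\xi_5,\xi_6)=(\ell-m_2',\,n-m_1,\,0)$, $\xi_a=\min\{\xi_1,\xi_2,\xi_3\}$, $\xi_b=\max\{\xi_4,\xi_5,\xi_6\}$, $$\Lambda=\sum_{i=1}^3\xi_i-\sum_{i=4}^6\xi_i+2|\ell-n|,\qquad \lambda_\pm=\pm\tfrac12\Lambda+\tfrac16\sum_{i=1}^6\xi_i,\qquad E_{j,k}=\sum_{i=1}^6\bigl(\xi_i-j-\xi_b+\tfrac12\bigr)^k .$$ Then: 1. $X$ and $Y$ commute with all $e^{(1)}_{pq}+e^{(2)}_{pq}$, hence preserve $M_{\mathbf m}$, and $d=\xi_a-\xi_b$. 2. There is a basis of $M_{\mathbf m}$ in which the actions $X_{\mathbf m}$ and $Y_{\mathbf m}$ of $X$ and $Y$ are simultaneously given by tridiagonal $d\times d$ matrices $(a_{ij})$ and $(b_{ij})$ with off-diagonal entries, for $1\le j\le d-1$, $$a_{j,j+1}=\prod_{i=1}^3(j+\xi_b-\xi_i),\quad b_{j,j+1}=a_{j,j+1}(j+\xi_b-\lambda_-),\quad a_{j+1,j}=\prod_{i=4}^6(j+\xi_b-\xi_i),\quad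 b_{j+1,j}=a_{j+1,j}(j+\xi_b-\lambda_+),$$ and diagonal entries, for $1\le j\le d$, $$a_{jj}=-\tfrac1{108}\Bigl(\tfrac72E_{j,1}^3-18E_{j,1}E_{j,2}+18E_{j,3}\Bigr)-\tfrac1{24}E_{j,1}(\Lambda^2+2),$$ $$b_{jj}=\tfrac1{288}\Bigl(\tfrac52E_{j,1}^4+32E_{j,1}E_{j,3}+6\bigl(E_{j,2}^2-3E_{j,1}^2E_{j,2}-4E_{j,4}\bigr)+6E_{j,2}(\Lambda^2+2)-3E_{j,1}^2(\Lambda^2-2)-\tfrac32\Lambda^4+6\Lambda^2-36\Bigr).$$ 3. The entries $a_{j,j+1},a_{j+1,j},b_{j,j+1},b_{j+1,j}$ ($1\le j\le d-1$) are all non-zero. 4. Each of $X_{\mathbf m}$ and $Y_{\mathbf m}$ is diagonalisable with $d$ pairwise distinct eigenvalues, and these are missing labels. That is, for $Z\in\{X,Y\}$, the $d$ eigenvectors of $Z_{\mathbf m}$ (up to scalars) generate $d$ subrepresentations of $[m_1,m_2]\otimes[m_1',m_2']$ isomorphic to $[m_1'',m_2'']$, on which $Z$ acts by the $d$ distinct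 eigenvalues; these are in direct sum, their sum contains every subrepresentation isomorphic to $[m_1'',m_2'']$, and any such subrepresentation on which $Z$ acts as a number is one of them, determined by that number. -/

import Mathlib

open scoped TensorProduct

noncomputable section

namespace MissingLabel

/-! ### The Lie algebra and its irreducible representations -/

/-- The complexification of `su₃`: traceless complex `3 × 3` matrices. -/
abbrev Sl3 : Type := LieAlgebra.SpecialLinear.sl (Fin 3) ℂ

/-- The generators `e_{pq}`: the traceless part of the elementary matrix `E_{pq}`, that is `E_{pq}`
for `p ≠ q` and `E_{pp} - 1/3` for `p = q`. The indices `1, 2, 3` are written `0, 1, 2`. -/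
def e (p q : Fin 3) : Sl3 :=
  ⟨Matrix.single p q 1 - (if p = q then (1 / 3 : ℂ) else 0) • (1 : Matrix (Fin 3) (Fin 3) ℂ), by
    change Matrix.traceLinearMap (Fin 3) ℂ ℂ _ = 0
    by_cases h : p = q
    · subst h; simp [Matrix.trace_single_eq_same]
    · simp [h, Matrix.trace_single_eq_of_ne]⟩

theorem sum_e : ∑ i, e i i = 0 := by
  apply Subtype.ext
  ext i j
  fin_cases i <;> fin_cases j <;> simp [e, Fin.sum_univ_three, Matrix.single] <;> norm_num

/-- The relations `[e_{pq}, e_{rs}] = δ_{qr} e_{ps} - δ_{sp} e_{rq}`. -/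
theorem lie_e (p q r s : Fin 3) :
    ⁅e p q, e r s⁆ = (if q = r then e p s else 0) - (if s = p then e r q else 0) := by
  apply Subtype.ext
  have hb : (⁅e p q, e r s⁆ : Sl3).val = Matrix.single p q (1 : ℂ) * Matrix.single r s 1
      - Matrix.single r s 1 * Matrix.single p q 1 := by
    rw [LieAlgebra.SpecialLinear.sl_bracket]
    simp only [e, sub_mul, mul_sub, smul_mul_assoc, mul_smul_comm, one_mul, mul_one]
    module
  rw [hb]
  by_cases h : q = r <;> by_cases h' : s = p
  · subst h; subst h'
    simp only [Matrix.single_mul_single_same, mul_one, if_true]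
    change _ = (e s s).val - (e q q).val
    simp [e]
  · subst h
    simp [h', Ne.symm h', e, Matrix.single_mul_single_of_ne]
  · subst h'
    simp [h, Ne.symm h, e, Matrix.single_mul_single_of_ne]
  · simp [h, h', Matrix.single_mul_single_of_ne]

/-- The Cartan generator `h₁ = e₁₁ - e₂₂`. -/
def h₁ : Sl3 := e 0 0 - e 1 1

/-- The Cartan generator `h₂ = e₂₂ - e₃₃`. -/
def h₂ : Sl3 := e 1 1 - e 2 2

section Modules

variable (M : Type*) [AddCommGroup M] [Module ℂ M] [LieRingModule Sl3 M] [LieModule ℂ Sl3 M]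

/-- The space of highest-weight vectors of weight `(a, b)` of a representation (with zero), in the
shifted convention: `h₁ v = (a - 1) v`, `h₂ v = (b - 1) v` and `e_{pq} v = 0` for `p < q`. -/
def highestWeightSpace (a b : ℕ) : Submodule ℂ M where
  carrier := {v | ⁅h₁, v⁆ = ((a : ℂ) - 1) • v ∧ ⁅h₂, v⁆ = ((b : ℂ) - 1) • v ∧
    ∀ p q : Fin 3, p < q → ⁅e p q, v⁆ = 0}
  add_mem' := by
    rintro v w ⟨h1, h2, h3⟩ ⟨k1, k2, k3⟩
    refine ⟨?_, ?_, fun p q hpq => ?_⟩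
    · rw [lie_add, h1, k1, smul_add]
    · rw [lie_add, h2, k2, smul_add]
    · rw [lie_add, h3 p q hpq, k3 p q hpq, add_zero]
  zero_mem' := by simp
  smul_mem' := by
    rintro c v ⟨h1, h2, h3⟩
    refine ⟨?_, ?_, fun p q hpq => ?_⟩
    · rw [lie_smul, h1, smul_comm]
    · rw [lie_smul, h2, smul_comm]
    · rw [lie_smul, h3 p q hpq, smul_zero]

/-- `M` is (a copy of) the finite-dimensional irreducible representation `[a, b]`. -/
structure IsIrrep (a b : ℕ) : Prop where
  finiteDimensional : FiniteDimensional ℂ M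
  irreducible : LieModule.IsIrreducible ℂ Sl3 M
  exists_highestWeight : ∃ v ∈ highestWeightSpace M a b, v ≠ 0

end Modules

/-! ### The algebra `U(su₃) ⊗ U(su₃)` and the elements `X`, `Y` -/

/-- The universal enveloping algebra. -/
abbrev U : Type := UniversalEnvelopingAlgebra ℂ Sl3

/-- The two embeddings of `U` into `U ⊗ U`. The labels `1, 2` of the tensor factors are written
`0, 1`. -/
def leg (a : Fin 2) : U →ₐ[ℂ] U ⊗[ℂ] U :=
  if a = 0 then Algebra.TensorProduct.includeLeft else Algebra.TensorProduct.includeRight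

/-- The generator `e_{pq}` in `U`. -/
def eU (p q : Fin 3) : U := UniversalEnvelopingAlgebra.ι ℂ (e p q)

/-- `e_{pq}^{(a)}`. -/
def eLeg (a : Fin 2) (p q : Fin 3) : U ⊗[ℂ] U := leg a (eU p q)

/-- The polarised trace `T^{(a₁,…,a_μ)} = ∑ e_{i₂i₁}^{(a₁)} e_{i₃i₂}^{(a₂)} ⋯ e_{i₁i_μ}^{(a_μ)}`
(the index `s + 1` is cyclic). -/
def T {μ : ℕ} [NeZero μ] (a : Fin μ → Fin 2) : U ⊗[ℂ] U :=
  ∑ i : Fin μ → Fin 3, (List.ofFn fun s => eLeg (a s) (i (s + 1)) (i s)).prod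

/-- The polarised trace
`T̄^{(a₁,…,a_μ)} = ∑ e_{i₁i₂}^{(a₁)} e_{i₂i₃}^{(a₂)} ⋯ e_{i_μ i₁}^{(a_μ)}`. -/
def Tbar {μ : ℕ} [NeZero μ] (a : Fin μ → Fin 2) : U ⊗[ℂ] U :=
  ∑ i : Fin μ → Fin 3, (List.ofFn fun s => eLeg (a s) (i s) (i (s + 1))).prod

/-- The cubic Casimir element `L = ½ ∑ (e_{ij} e_{jk} e_{ki} + e_{ji} e_{kj} e_{ik})`. -/
def casimirL : U :=
  (1 / 2 : ℂ) • ∑ i : Fin 3, ∑ j : Fin 3, ∑ k : Fin 3,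
    (eU i j * eU j k * eU k i + eU j i * eU k j * eU i k)

/-- `X = ½ (T^{(1,1,2)} - T^{(1,2,2)}) + ⅓ (L ⊗ 1 - 1 ⊗ L)`. -/
def X : U ⊗[ℂ] U :=
  (1 / 2 : ℂ) • (T ![0, 0, 1] - T ![0, 1, 1]) + (1 / 3 : ℂ) • (leg 0 casimirL - leg 1 casimirL)

/-- `Y = ½ (T^{(1,1,2,2)} + T̄^{(1,1,2,2)}) - 1/12 (T^{(1,2)})² - 5/12 T^{(1,1)} T^{(2,2)}
- 2 T^{(1,2)}`. -/
def Y : U ⊗[ℂ] U :=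
  (1 / 2 : ℂ) • (T ![0, 0, 1, 1] + Tbar ![0, 0, 1, 1]) - (1 / 12 : ℂ) • (T ![0, 1]) ^ 2
    - (5 / 12 : ℂ) • (T ![0, 0] * T ![1, 1]) - (2 : ℂ) • T ![0, 1]

/-- The centraliser in `U ⊗ U` of the diagonal embedding of `su₃`: the elements which commute with
all `e_{pq}^{(1)} + e_{pq}^{(2)}`. -/
def centraliser : Subalgebra ℂ (U ⊗[ℂ] U) :=
  Subalgebra.centralizer ℂ (Set.range fun pq : Fin 3 × Fin 3 =>
    eLeg 0 pq.1 pq.2 + eLeg 1 pq.1 pq.2)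

section Action

variable (V W : Type*) [AddCommGroup V] [Module ℂ V] [LieRingModule Sl3 V] [LieModule ℂ Sl3 V]
  [AddCommGroup W] [Module ℂ W] [LieRingModule Sl3 W] [LieModule ℂ Sl3 W]

/-- The action of `U ⊗ U` on the tensor product of two representations. -/
def act : U ⊗[ℂ] U →ₐ[ℂ] Module.End ℂ (V ⊗[ℂ] W) :=
  (Module.endTensorEndAlgHom (R := ℂ) (S := ℂ) (A := ℂ) (M := V) (N := W)).comp
    (Algebra.TensorProduct.map
      (UniversalEnvelopingAlgebra.lift ℂ (LieModule.toEnd ℂ Sl3 V))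
      (UniversalEnvelopingAlgebra.lift ℂ (LieModule.toEnd ℂ Sl3 W)))

theorem act_eLeg_tmul (a : Fin 2) (p q : Fin 3) (v : V) (w : W) :
    act V W (eLeg a p q) (v ⊗ₜ w) = if a = 0 then ⁅e p q, v⁆ ⊗ₜ w else v ⊗ₜ ⁅e p q, w⁆ := by
  by_cases h : a = 0 <;>
    simp [h, act, eLeg, eU, leg, -UniversalEnvelopingAlgebra.ι_apply,
      UniversalEnvelopingAlgebra.lift_ι_apply, Module.endTensorEndAlgHom_apply]

end Action

/-! ### The parameters and the explicit matrices -/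

/-- The three highest weights `m = (m₁, m₂, m'₁, m'₂, m''₁, m''₂)`, in positive integers. -/
structure Labels where
  m₁ : ℕ
  m₂ : ℕ
  m₁' : ℕ
  m₂' : ℕ
  m₁'' : ℕ
  m₂'' : ℕ
  pos_m₁ : 0 < m₁
  pos_m₂ : 0 < m₂
  pos_m₁' : 0 < m₁'
  pos_m₂' : 0 < m₂'
  pos_m₁'' : 0 < m₁''
  pos_m₂'' : 0 < m₂''

namespace Labels

variable (m : Labels)

def ell : ℚ := (m.m₁ + 2 * m.m₂ + m.m₁' + 2 * m.m₂' - m.m₁'' - 2 * m.m₂'') / 3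

def n : ℚ := (2 * m.m₁ + m.m₂ + 2 * m.m₁' + m.m₂' - 2 * m.m₁'' - m.m₂'') / 3

/-- The parameters `ξ₁, …, ξ₆` (at the indices `0, …, 5`). -/
def ξ : Fin 6 → ℚ :=
  if m.ell ≤ m.n then
    ![m.ell, m.m₂, m.m₁' + m.ell - m.n, m.ell - m.m₂', m.n - m.m₁, 0]
  else
    ![m.n, m.m₁', m.m₂ + m.n - m.ell, m.ell - m.m₂', m.n - m.m₁, 0]

/-- `ξ_a = min {ξ₁, ξ₂, ξ₃}`. -/
def ξa : ℚ := min (m.ξ 0) (min (m.ξ 1) (m.ξ 2))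

/-- `ξ_b = max {ξ₄, ξ₅, ξ₆}`. -/
def ξb : ℚ := max (m.ξ 3) (max (m.ξ 4) (m.ξ 5))

def Lam : ℚ := (m.ξ 0 + m.ξ 1 + m.ξ 2) - (m.ξ 3 + m.ξ 4 + m.ξ 5) + 2 * |m.ell - m.n|

/-- `λ₊`. -/
def lamPlus : ℚ := m.Lam / 2 + (∑ i, m.ξ i) / 6

/-- `λ₋`. -/
def lamMinus : ℚ := -m.Lam / 2 + (∑ i, m.ξ i) / 6

/-- `E_{j,k} = ∑ᵢ xᵢ(j)ᵏ` with `xᵢ(j) = ξᵢ - j - ξ_b + 1/2`. -/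
def E (j k : ℕ) : ℚ := ∑ i, (m.ξ i - j - m.ξb + 1 / 2) ^ k

/-- `a_{j,j+1}`. -/
def aUp (j : ℕ) : ℚ := (j + m.ξb - m.ξ 0) * (j + m.ξb - m.ξ 1) * (j + m.ξb - m.ξ 2)

/-- `a_{j+1,j}`. -/
def aLow (j : ℕ) : ℚ := (j + m.ξb - m.ξ 3) * (j + m.ξb - m.ξ 4) * (j + m.ξb - m.ξ 5)

/-- `b_{j,j+1}`. -/
def bUp (j : ℕ) : ℚ := m.aUp j * (j + m.ξb - m.lamMinus)

/-- `b_{j+1,j}`. -/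
def bLow (j : ℕ) : ℚ := m.aLow j * (j + m.ξb - m.lamPlus)

/-- `a_{j,j}`. -/
def aDiag (j : ℕ) : ℚ :=
  -(1 / 108) * (7 / 2 * m.E j 1 ^ 3 - 18 * m.E j 1 * m.E j 2 + 18 * m.E j 3)
    - 1 / 24 * m.E j 1 * (m.Lam ^ 2 + 2)

/-- `b_{j,j}`. -/
def bDiag (j : ℕ) : ℚ :=
  1 / 288 * (5 / 2 * m.E j 1 ^ 4 + 32 * m.E j 1 * m.E j 3
    + 6 * (m.E j 2 ^ 2 - 3 * m.E j 1 ^ 2 * m.E j 2 - 4 * m.E j 4)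
    + 6 * m.E j 2 * (m.Lam ^ 2 + 2) - 3 * m.E j 1 ^ 2 * (m.Lam ^ 2 - 2)
    - 3 / 2 * m.Lam ^ 4 + 6 * m.Lam ^ 2 - 36)

end Labels

/-- The tridiagonal `d × d` matrix with entries `diag j` at `(j, j)`, `up j` at `(j, j+1)` and
`low j` at `(j+1, j)`; here `j` is counted from `1`, whereas `Fin d` starts at `0`. -/
def tridiagonal (d : ℕ) (diag up low : ℕ → ℚ) : Matrix (Fin d) (Fin d) ℂ :=
  Matrix.of fun i j =>
    if (i : ℕ) = j then (diag (i + 1) : ℂ)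
    else if (j : ℕ) = i + 1 then (up (i + 1) : ℂ)
    else if (i : ℕ) = j + 1 then (low (j + 1) : ℂ)
    else 0

section Multiplicity

variable (m : Labels)
  (V W : Type*) [AddCommGroup V] [Module ℂ V] [LieRingModule Sl3 V] [LieModule ℂ Sl3 V]
  [AddCommGroup W] [Module ℂ W] [LieRingModule Sl3 W] [LieModule ℂ Sl3 W]

/-- The multiplicity space `M_m`: the highest-weight vectors of weight `(m''₁, m''₂)` in `V ⊗ W`. -/
abbrev multSpace : Submodule ℂ (V ⊗[ℂ] W) := highestWeightSpace (V ⊗[ℂ] W) m.m₁'' m.m₂''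

/-- The multiplicity `d_m`. -/
def mult : ℕ := Module.finrank ℂ (multSpace m V W)

/-- The eigenvalues of `Z` on the multiplicity space are simple (there are `d_m` pairwise distinct
eigenvalues `μ i`, with eigenvectors `c i` forming a basis) and label the copies of `[m''₁, m''₂]`
in `V ⊗ W`: each `c i` generates such a copy, `Z` acts on it as the number `μ i`, these copies are
in direct sum, their sum contains every copy of `[m''₁, m''₂]`, and a copy on which `Z` acts as a
number is one of them and is determined by that number. -/
def IsMissingLabel (Z : U ⊗[ℂ] U) : Prop :=
  ∃ (μ : Fin (mult m V W) → ℂ) (c : Module.Basis (Fin (mult m V W)) ℂ (multSpace m V W))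
    (S : Fin (mult m V W) → LieSubmodule ℂ Sl3 (V ⊗[ℂ] W)),
    Function.Injective μ ∧
    (∀ i, act V W Z (c i : V ⊗[ℂ] W) = μ i • (c i : V ⊗[ℂ] W)) ∧
    (∀ i, S i = LieSubmodule.lieSpan ℂ Sl3 {(c i : V ⊗[ℂ] W)}) ∧
    (∀ i, IsIrrep (S i) m.m₁'' m.m₂'') ∧
    (∀ i, ∀ x ∈ S i, act V W Z x = μ i • x) ∧
    iSupIndep S ∧
    (∀ N : LieSubmodule ℂ Sl3 (V ⊗[ℂ] W), IsIrrep N m.m₁'' m.m₂'' → N ≤ ⨆ i, S i) ∧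
    (∀ N : LieSubmodule ℂ Sl3 (V ⊗[ℂ] W), IsIrrep N m.m₁'' m.m₂'' →
      ∀ z : ℂ, (∀ x ∈ N, act V W Z x = z • x) → ∃ i, z = μ i ∧ N = S i)

end Multiplicity

end MissingLabel

end

/-! The representation `[p+1, q+1]` is realised inside the polynomials in a vector `y` and a
covector `η`, generated by `y₀^p η₂^q` (`exists_embedding`). The Fischer form makes `e_{pq}` adjoint
to `e_{qp}`, so every irreducible representation gets an invariant inner product (`exists_core`).
Restriction to the cone `y₀η₀ + y₁η₁ + y₂η₂ = 0` is injective on the irreducible representation and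
kills its orthogonal complement in bidegree `(p, q)` (`Model.J_injective`, `Model.chart_eq_zero`).
Where `η₁ ≠ 0` the coordinate `y₁` can be eliminated, so vectors become Laurent polynomials in `y₀,
y₂, η₀, η₂, η₁` and the generators become explicit derivations.

A highest-weight vector `u` of `V ⊗ W` is determined by its leading component, the contraction of
`u` with the highest-weight vector `v` of `V` (`Model.eq_zero_of_lead`). On this component the first
tensor factor can be eliminated: `e_{ij}^{(1)}` acts as `-e_{ij}^{(2)}` for `i < j` because `u` is
killed by raising operators, as a weight for `i = j`, and as zero for `i > j` because its adjoint
raises `v`. Thus `X` and `Y` turn into differential operators in the chart.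

Bidegree and weight fix all exponents of a leading monomial except the exponent `b` of `y₂`.
Polynomiality in `y₀, y₂, η₀, η₂` and the relations `e₂₁^{p+1} v = 0`, `e₃₂^{q+1} v = 0` bound `b`
by six inequalities (`Model.exponent_of_lead`): three lower bounds `ξ₄, ξ₅, ξ₆` and three strict
upper bounds `ξ₁, ξ₂, ξ₃`. When `ℓ ≥ n`, products of elementary highest-weight tensors realise every
monomial allowed by these bounds (`Model.exists_lead_eq_mon`), so the vectors with monomial leading
component form a basis and `d = ξ_a - ξ_b`. On monomials `X` and `Y` are three-term operators
(`IsChart.opX_apply`, `IsChart.opY_apply`). Their matrices are the transposes of the required ones;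
as `X` and `Y` are self-adjoint and the entries real, the dual basis for the inner product corrects
this (`exists_dual_basis`).

When `ℓ < n`, the diagram automorphism exchanges `ℓ` and `n`, fixes `Y` and changes the sign of `X`.
On the matrices it amounts to the reflection `x ↦ ℓ - x` of the parameters together with reversal of
the basis, which compensates that sign (`IsReflection.triX`, `IsReflection.triY`).

The off-diagonal entries are non-zero because `j + ξ_b` lies strictly between `ξ_b` and `ξ_a`, hence
also between `λ₋` and `λ₊`. Self-adjointness gives an eigenbasis, and an unreduced tridiagonal
matrix has one-dimensional eigenspaces, so the spectrum is simple. Finally, each highest-weight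
vector generates an irreducible subrepresentation on which an element of the centraliser acts as it
does on that vector (`isMissingLabel`). -/

set_option linter.unusedSectionVars false
set_option linter.unnecessarySeqFocus false
set_option linter.unusedSimpArgs false

noncomputable section

namespace MissingLabel

/-! ### The reduced operators in a chart -/

section Chart

variable {R : Type*} [AddCommGroup R] [Module ℂ R] (D : Fin 3 → Fin 3 → Module.End ℂ R)
  (l : Fin 3 → ℂ)

/-- The effect of `e_{pq}^{(1)}` on a highest-weight vector, seen on its leading component. -/
def opA (p q : Fin 3) : Module.End ℂ R :=
  if p < q then - D p q else if p = q then l p • 1 else 0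

/-- The effect of `e_{ji}^{(1)} e_{kj}^{(1)}` on the leading component. -/
def opAA (k j i : Fin 3) : Module.End ℂ R :=
  if j < i then - (D j i * opA D l k j) - opA D l k i + (if i = k then l j • 1 else 0)
    else if j = i then l i • opA D l k i else 0

/-- The effect of `e_{ij}^{(1)} e_{jk}^{(1)}` on the leading component. -/
def opAAbar (i j k : Fin 3) : Module.End ℂ R :=
  if i < j then - (D i j * opA D l j k) + opA D l i k - (if i = k then l j • 1 else 0)
    else if i = j then l i • opA D l i k else 0

/-- The effect of `T^{(1,2)}` on the leading component. -/
def opT12 : Module.End ℂ R := ∑ i, ∑ j, D i j * opA D l j i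

/-- The effect of `T^{(1,1,2)}` on the leading component. -/
def opT112 : Module.End ℂ R := ∑ i, ∑ j, ∑ k, D i k * opAA D l k j i

/-- The effect of `T^{(1,2,2)}` on the leading component. -/
def opT122 : Module.End ℂ R := ∑ i, ∑ j, ∑ k, D k j * (D i k * opA D l j i)

/-- The effect of `T^{(1,1,2,2)}` on the leading component. -/
def opT1122 : Module.End ℂ R := ∑ i, ∑ j, ∑ k, ∑ s, D s k * (D i s * opAA D l k j i)

/-- The effect of `T̄^{(1,1,2,2)}` on the leading component. -/
def opTbar1122 : Module.End ℂ R := ∑ i, ∑ j, ∑ k, ∑ s, D k s * (D s i * opAAbar D l i j k)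

/-- The eigenvalue of the cubic Casimir element on `[a, b]`. -/
def casimirLValue (a b : ℂ) : ℂ := (a - b) * (2 * a + b) * (a + 2 * b) / 9

/-- The eigenvalue of the quadratic Casimir element on `[a, b]`. -/
def casimirValue (a b : ℂ) : ℂ := 2 / 3 * (a ^ 2 + a * b + b ^ 2 - 3)

/-- The effect of `X` on the leading component. -/
def opX (m₁ m₂ m₁' m₂' : ℂ) : Module.End ℂ R :=
  (1 / 2 : ℂ) • (opT112 D l - opT122 D l)
    + (1 / 3 : ℂ) • ((casimirLValue m₁ m₂ - casimirLValue m₁' m₂') • 1)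

/-- The effect of `Y` on the leading component. -/
def opY (m₁ m₂ m₁' m₂' : ℂ) : Module.End ℂ R :=
  (1 / 2 : ℂ) • (opT1122 D l + opTbar1122 D l) - (1 / 12 : ℂ) • (opT12 D l * opT12 D l)
    - (5 / 12 : ℂ) • ((casimirValue m₁ m₂ * casimirValue m₁' m₂') • 1) - (2 : ℂ) • opT12 D l

/-- A family of vectors on which the operators `D p q` act as the derivations
`y_p ∂/∂y_q - η_q ∂/∂η_p` act on the Laurent monomials in `y₀, y₂, η₀, η₁, η₂` when
`y₁ = -(y₀ η₀ + y₂ η₂) / η₁`. -/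
structure IsChart (sh : ℤ → ℤ → ℤ → R) (a b c d k : ℂ) : Prop where
  -- The index `(x, y, z)` stands for `y₀^(a-x) y₂^(b+x) η₀^(c+y) η₂^(d-y-z) η₁^(k+z)`, so the
  -- bidegree `(a+b, c+d+k)` never changes. The terms divided by `3` come from the traceless
  -- normalisation of `e_{pp}`.
  d00 : ∀ x y z : ℤ, D 0 0 (sh x y z) = ((a - x) - (c + y) - (a + b - c - d - k) / 3) • sh x y z
  d11 : ∀ x y z : ℤ, D 1 1 (sh x y z) = (- (k + z) - (a + b - c - d - k) / 3) • sh x y z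
  d22 : ∀ x y z : ℤ, D 2 2 (sh x y z) =
    ((b + x) - (d - y - z) - (a + b - c - d - k) / 3) • sh x y z
  d01 : ∀ x y z : ℤ, D 0 1 (sh x y z) = (-(c + y)) • sh x (y - 1) (z + 1)
  d02 : ∀ x y z : ℤ, D 0 2 (sh x y z) = (b + x) • sh (x - 1) y z + (-(c + y)) • sh x (y - 1) z
  d12 : ∀ x y z : ℤ, D 1 2 (sh x y z) = (-(b + x)) • sh (x - 1) (y + 1) (z - 1)
    + (-(b + x) - (k + z)) • sh x y (z - 1)
  d10 : ∀ x y z : ℤ, D 1 0 (sh x y z) = (-(a - x)) • sh (x + 1) y (z - 1)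
    + (-(a - x) - (k + z)) • sh x (y + 1) (z - 1)
  d20 : ∀ x y z : ℤ, D 2 0 (sh x y z) =
    (a - x) • sh (x + 1) y z + (-(d - y - z)) • sh x (y + 1) z
  d21 : ∀ x y z : ℤ, D 2 1 (sh x y z) = (-(d - y - z)) • sh x y (z + 1)

variable {D} {sh : ℤ → ℤ → ℤ → R} {a b c d k : ℂ}

/-- The diagonal weight `λ_p` of a highest-weight vector of weight `(m₁, m₂)`. -/
def wt (m₁ m₂ : ℂ) (p : Fin 3) : ℂ :=
  (2 * (m₁ - 1) + (m₂ - 1)) / 3 - (if p = 0 then 0 else m₁ - 1) - (if p = 2 then m₂ - 1 else 0)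

/-- The sequence `ξ` in terms of the exponents of a monomial. -/
def chartξ (m₁ m₂ a b c d k : ℂ) : Fin 6 → ℂ :=
  ![b + c + 1, a + b + 1, m₂ - k, b - d, b + c + 1 - m₁, 0]

/-- `E_{j,k}` as a function of `j + ξ_b`. -/
def powerSum (ξ : Fin 6 → ℂ) (B : ℂ) (k : ℕ) : ℂ := ∑ i, (ξ i - B + 1 / 2) ^ k

/-- `a_{jj}` in terms of `E_{j,1}, E_{j,2}, E_{j,3}` and `Λ`. -/
def diagX (E : ℕ → ℂ) (Lam : ℂ) : ℂ :=
  -(1 / 108) * (7 / 2 * E 1 ^ 3 - 18 * E 1 * E 2 + 18 * E 3) - 1 / 24 * E 1 * (Lam ^ 2 + 2)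

/-- `b_{jj}` in terms of `E_{j,1}, …, E_{j,4}` and `Λ`. -/
def diagY (E : ℕ → ℂ) (Lam : ℂ) : ℂ :=
  1 / 288 * (5 / 2 * E 1 ^ 4 + 32 * E 1 * E 3
    + 6 * (E 2 ^ 2 - 3 * E 1 ^ 2 * E 2 - 4 * E 4)
    + 6 * E 2 * (Lam ^ 2 + 2) - 3 * E 1 ^ 2 * (Lam ^ 2 - 2)
    - 3 / 2 * Lam ^ 4 + 6 * Lam ^ 2 - 36)

/-- The eigenvalue of `T^{(1,2)}` in terms of the exponents of a monomial. -/
def chartT12 (m₁ m₂ a b c d k : ℂ) : ℂ :=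
  m₁ * (2 * a - 2 * c - b + d + k) / 3 + m₂ * (a - c - 2 * b + 2 * d - k) / 3
    - a - b - c - d - k - a * c - a * b - c * d - c * k - b * d - d * k

/-- Behind this lies the fact that `T^{(1,2)}` is half the difference between the diagonal quadratic
Casimir element and those of the two factors, hence a scalar on highest-weight vectors of a fixed
weight. The square of `T^{(1,2)}` in `Y` therefore contributes only to the diagonal. -/
theorem IsChart.opT12_apply (h : IsChart D sh a b c d k) (m₁ m₂ : ℂ) :
    opT12 D (wt m₁ m₂) (sh 0 0 0) = chartT12 m₁ m₂ a b c d k • sh 0 0 0 := by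
  simp only [opT12, Fin.sum_univ_three, opA, wt, Fin.isValue, LinearMap.add_apply,
    Module.End.mul_apply]
  simp [h.d00, h.d01, h.d02, h.d10, h.d11, h.d12, h.d20, h.d21, h.d22]
  match_scalars <;> (try simp only [chartT12]) <;> ring

-- Weight and bidegree are preserved, so only shifts with `z = 0` and `y = -x` are possible; that
-- `|x| ≤ 1` and the values of the coefficients are a direct expansion. With `m₁ = p + 1` and `m₂ =
-- q + 1`, the factors `d`, `p - c`, `b` and `a`, `c`, `b + k - q` vanish exactly on the six walls
-- of the range of admissible exponents.
set_option maxHeartbeats 4000000 in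
theorem IsChart.opX_apply (h : IsChart D sh a b c d k) (m₁ m₂ : ℂ) :
    opX D (wt m₁ m₂) m₁ m₂ (a + b + 1) (c + d + k + 1) (sh 0 0 0) =
      (d * (m₁ - c - 1) * b) • sh (-1) 1 0
        + diagX (powerSum (chartξ m₁ m₂ a b c d k) (b + 1)) (a + d + 1 + m₁ + m₂ + k) • sh 0 0 0
        + (a * c * (b + k + 1 - m₂)) • sh 1 (-1) 0 := by
  simp only [opX, opT112, opT122, Fin.sum_univ_three, opAA, opA, wt, Fin.isValue,
    LinearMap.add_apply, LinearMap.smul_apply, LinearMap.sub_apply, Module.End.mul_apply]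
  simp [h.d00, h.d01, h.d02, h.d10, h.d11, h.d12, h.d20, h.d21, h.d22]
  match_scalars
  · simp only [diagX, powerSum, chartξ, casimirLValue, Fin.sum_univ_six]
    simp
    ring
  all_goals ring

set_option maxHeartbeats 4000000 in
theorem IsChart.opY_apply (h : IsChart D sh a b c d k) (m₁ m₂ : ℂ) :
    opY D (wt m₁ m₂) m₁ m₂ (a + b + 1) (c + d + k + 1) (sh 0 0 0) =
      (d * (m₁ - c - 1) * b * (b - ((a + d + 1 + m₁ + m₂ + k) / 2
          + (∑ i, chartξ m₁ m₂ a b c d k i) / 6))) • sh (-1) 1 0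
        + diagY (powerSum (chartξ m₁ m₂ a b c d k) (b + 1)) (a + d + 1 + m₁ + m₂ + k) • sh 0 0 0
        + (a * c * (b + k + 1 - m₂) * (b + 1 - (-(a + d + 1 + m₁ + m₂ + k) / 2
          + (∑ i, chartξ m₁ m₂ a b c d k i) / 6))) • sh 1 (-1) 0 := by
  -- The square of `T^{(1,2)}` is reduced to a scalar before the quartic terms are expanded.
  have h12 := h.opT12_apply m₁ m₂
  simp only [opY, LinearMap.add_apply, LinearMap.smul_apply, LinearMap.sub_apply,
    Module.End.mul_apply, h12, map_smul]
  simp only [opT1122, opTbar1122, Fin.sum_univ_three, opAA, opAAbar, opA, wt, Fin.isValue,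
    LinearMap.add_apply, Module.End.mul_apply]
  simp [h.d00, h.d01, h.d02, h.d10, h.d11, h.d12, h.d20, h.d21, h.d22]
  match_scalars
  · simp only [diagY, powerSum, chartξ, casimirValue, chartT12, Fin.sum_univ_six]
    simp
    ring
  all_goals
    simp only [chartξ, Fin.sum_univ_six]
    simp
    ring

end Chart
end MissingLabel
end

noncomputable section

namespace MissingLabel

/-! ### Highest-weight vectors -/

theorem eq_sum_e (x : Sl3) : x = ∑ p, ∑ q, x.1 p q • e p q := by
  have ht : x.1 0 0 + x.1 1 1 + x.1 2 2 = 0 := by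
    have h : Matrix.trace x.1 = 0 := x.2
    simpa [Matrix.trace, Fin.sum_univ_three] using h
  have h2 : x.1 2 2 = - x.1 0 0 - x.1 1 1 := by linear_combination ht
  apply Subtype.ext
  simp only [Fin.sum_univ_three]
  ext i j
  fin_cases i <;> fin_cases j <;> simp [e, Matrix.single, h2] <;> ring

/-- The grading element `h₁ + h₂`. -/
def grad : Sl3 := e 0 0 - e 2 2

theorem lie_grad_e (p q : Fin 3) : ⁅grad, e p q⁆ = ((q : ℕ) - (p : ℕ) : ℂ) • e p q := by
  fin_cases p <;> fin_cases q <;> simp [grad, sub_lie, lie_e] <;> module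

section

variable {M : Type*} [AddCommGroup M] [Module ℂ M] [LieRingModule Sl3 M] [LieModule ℂ Sl3 M]

theorem lie_mem_of_forall_e {S : Submodule ℂ M} {x : M} (h : ∀ p q, ⁅e p q, x⁆ ∈ S) (y : Sl3) :
    ⁅y, x⁆ ∈ S := by
  rw [eq_sum_e y]
  simp only [sum_lie, smul_lie]
  exact Submodule.sum_mem _ fun p _ => Submodule.sum_mem _ fun q _ => S.smul_mem _ (h p q)

/-- The relation `∑ e_{ii} = 0` recovers the three diagonal weights from the eigenvalues of `h₁` and
`h₂`. -/
theorem mem_highestWeightSpace_iff {a b : ℕ} {v : M} :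
    v ∈ highestWeightSpace M a b ↔
      (∀ p, ⁅e p p, v⁆ = wt a b p • v) ∧ ∀ p q : Fin 3, p < q → ⁅e p q, v⁆ = 0 := by
  have hs : ⁅e 0 0, v⁆ + ⁅e 1 1, v⁆ + ⁅e 2 2, v⁆ = 0 := by
    rw [← add_lie, ← add_lie, ← Fin.sum_univ_three (fun i => e i i), sum_e, zero_lie]
  constructor
  · rintro ⟨h1, h2, h3⟩
    refine ⟨fun p => ?_, h3⟩
    rw [h₁, sub_lie] at h1
    rw [h₂, sub_lie] at h2
    have e0 : ⁅e 0 0, v⁆ = (1 / 3 : ℂ) • (⁅e 0 0, v⁆ + ⁅e 1 1, v⁆ + ⁅e 2 2, v⁆)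
      + (2 / 3 : ℂ) • (⁅e 0 0, v⁆ - ⁅e 1 1, v⁆) + (1 / 3 : ℂ) • (⁅e 1 1, v⁆ - ⁅e 2 2, v⁆) := by
      module
    have e1 : ⁅e 1 1, v⁆ = ⁅e 0 0, v⁆ - (⁅e 0 0, v⁆ - ⁅e 1 1, v⁆) := by module
    have e2 : ⁅e 2 2, v⁆ = ⁅e 1 1, v⁆ - (⁅e 1 1, v⁆ - ⁅e 2 2, v⁆) := by module
    rw [hs, h1, h2] at e0
    rw [h1, e0] at e1
    rw [h2, e1] at e2
    fin_cases p
    · simp only [Fin.zero_eta, wt, e0]; simp only [if_true, Fin.isValue, Fin.reduceEq, if_false]; module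
    · simp only [Fin.mk_one, wt, e1]; simp only [Fin.isValue, Fin.reduceEq, if_false]; module
    · simp only [Fin.reduceFinMk, wt, e2]; simp only [Fin.isValue, if_true, Fin.reduceEq, if_false]; module
  · rintro ⟨h1, h3⟩
    refine ⟨?_, ?_, h3⟩
    · rw [h₁, sub_lie, h1, h1]; simp only [wt, Fin.isValue, if_true, Fin.reduceEq, if_false]; module
    · rw [h₂, sub_lie, h1, h1]; simp only [wt, Fin.isValue, if_true, Fin.reduceEq, if_false]; module

theorem lie_grad_of_mem {a b : ℕ} {v : M} (hv : v ∈ highestWeightSpace M a b) :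
    ⁅grad, v⁆ = ((a : ℂ) + b - 2) • v := by
  have h := (mem_highestWeightSpace_iff.1 hv).1
  rw [grad, sub_lie, h, h]; simp only [wt, Fin.isValue, if_true, Fin.reduceEq, if_false]; module

/-- A subspace which contains a highest-weight vector and is stable under the lowering operators
contains the subrepresentation generated by that vector. -/
theorem lieSpan_le_of_lowering {v : M} {l : Fin 3 → ℂ} (h1 : ∀ p, ⁅e p p, v⁆ = l p • v)
    (h2 : ∀ p q : Fin 3, p < q → ⁅e p q, v⁆ = 0) {S : Submodule ℂ M} (hvS : v ∈ S)
    (hS : ∀ p q : Fin 3, q < p → ∀ x ∈ S, ⁅e p q, x⁆ ∈ S) :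
    (LieSubmodule.lieSpan ℂ Sl3 {v} : Submodule ℂ M) ≤ S := by
  -- The smallest subspace containing `v` and stable under lowering operators turns out to be stable
  -- under the whole Lie algebra.
  set F : Set (Submodule ℂ M) :=
    {T | v ∈ T ∧ ∀ p q : Fin 3, q < p → ∀ x ∈ T, ⁅e p q, x⁆ ∈ T} with hF
  have hT : sInf F ∈ F := by
    refine ⟨Submodule.mem_sInf.2 fun T hT => hT.1, fun p q hpq x hx => ?_⟩
    rw [Submodule.mem_sInf] at hx ⊢
    exact fun T hT => hT.2 p q hpq x (hx T hT)
  -- `B` collects the vectors of the smallest subspace that every generator sends back into it.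
  -- Commuting a generator past a lowering operator shows that `B` is again a member of `F`, so
  -- minimality gives equality.
  let B : Submodule ℂ M :=
    { carrier := {x | x ∈ sInf F ∧ ∀ p q, ⁅e p q, x⁆ ∈ sInf F}
      add_mem' := fun {x y} hx hy => ⟨add_mem hx.1 hy.1, fun p q => by
        rw [lie_add]; exact add_mem (hx.2 p q) (hy.2 p q)⟩
      zero_mem' := ⟨zero_mem _, fun p q => by rw [lie_zero]; exact zero_mem _⟩
      smul_mem' := fun c x hx => ⟨Submodule.smul_mem _ _ hx.1, fun p q => by
        rw [lie_smul]; exact Submodule.smul_mem _ _ (hx.2 p q)⟩ }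
  have hB : B ∈ F := by
    refine ⟨⟨hT.1, fun p q => ?_⟩, fun p q hpq x hx => ⟨hT.2 p q hpq x hx.1, fun r s => ?_⟩⟩
    · rcases lt_trichotomy p q with h | h | h
      · rw [h2 p q h]; exact zero_mem _
      · subst h; rw [h1]; exact Submodule.smul_mem _ _ hT.1
      · exact hT.2 p q h v hT.1
    · rw [leibniz_lie]
      refine add_mem ?_ (hT.2 p q hpq _ (hx.2 r s))
      rw [lie_e, sub_lie]
      refine sub_mem ?_ ?_ <;> split_ifs
      · exact hx.2 _ _
      · rw [zero_lie]; exact zero_mem _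
      · exact hx.2 _ _
      · rw [zero_lie]; exact zero_mem _
  let N : LieSubmodule ℂ Sl3 M :=
    { sInf F with
      lie_mem := fun {y x} hx => lie_mem_of_forall_e (S := sInf F)
        (fun p q => ((sInf_le hB : sInf F ≤ B) hx).2 p q) y }
  have hN : LieSubmodule.lieSpan ℂ Sl3 {v} ≤ N :=
    LieSubmodule.lieSpan_le.2 (Set.singleton_subset_iff.2 hT.1)
  intro x hx
  exact (sInf_le (show S ∈ F from ⟨hvS, hS⟩) : sInf F ≤ S) (hN hx)

/-- The part of a representation of degree less than `c` by a positive integer. -/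
def below (M : Type*) [AddCommGroup M] [Module ℂ M] [LieRingModule Sl3 M] [LieModule ℂ Sl3 M]
    (c : ℂ) : Submodule ℂ M :=
  ⨆ n : ℕ, (LieModule.toEnd ℂ Sl3 M grad).eigenspace (c - (n + 1))

theorem lie_grad_lie_e {p q : Fin 3} {c : ℂ} {x : M} (hx : ⁅grad, x⁆ = c • x) :
    ⁅grad, ⁅e p q, x⁆⁆ = (c + ((q : ℕ) - (p : ℕ))) • ⁅e p q, x⁆ := by
  rw [leibniz_lie, lie_grad_e, hx, smul_lie, lie_smul, ← add_smul, add_comm]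

theorem lie_e_mem_below {p q : Fin 3} (hpq : q < p) {c : ℂ} {x : M} (hx : ⁅grad, x⁆ = c • x) :
    ⁅e p q, x⁆ ∈ below M c := by
  obtain ⟨n, hn⟩ : ∃ n : ℕ, (p : ℕ) = q + (n + 1) := ⟨p - q - 1, by omega⟩
  refine Submodule.mem_iSup_of_mem n ?_
  rw [Module.End.mem_eigenspace_iff, LieModule.toEnd_apply_apply, lie_grad_lie_e hx, hn]
  push_cast
  congr 1
  ring

theorem lie_e_below {p q : Fin 3} (hpq : q < p) {c : ℂ} {x : M} (hx : x ∈ below M c) :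
    ⁅e p q, x⁆ ∈ below M c := by
  induction hx using Submodule.iSup_induction' with
  | mem n x hx =>
    rw [Module.End.mem_eigenspace_iff, LieModule.toEnd_apply_apply] at hx
    obtain ⟨k, hk⟩ : ∃ k : ℕ, (p : ℕ) = q + (k + 1) := ⟨p - q - 1, by omega⟩
    refine Submodule.mem_iSup_of_mem (n + k + 1) ?_
    rw [Module.End.mem_eigenspace_iff, LieModule.toEnd_apply_apply, lie_grad_lie_e hx, hk]
    push_cast
    congr 1
    ring
  | zero => rw [lie_zero]; exact zero_mem _
  | add x y _ _ hx hy => rw [lie_add]; exact add_mem hx hy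

theorem eq_zero_of_mem_below {c : ℂ} {x : M} (hx : ⁅grad, x⁆ = c • x) (hx' : x ∈ below M c) :
    x = 0 := by
  have hi := (LieModule.toEnd ℂ Sl3 M grad).eigenspaces_iSupIndep
  have hd := hi c
  have h1 : x ∈ (LieModule.toEnd ℂ Sl3 M grad).eigenspace c := by
    rw [Module.End.mem_eigenspace_iff, LieModule.toEnd_apply_apply, hx]
  refine (Submodule.disjoint_def.1 hd) x h1 ?_
  refine (iSup_le fun n => ?_ : below M c ≤ _) hx'
  refine le_iSup₂_of_le (c - (n + 1)) ?_ le_rfl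
  intro h
  have : (n : ℂ) + 1 = 0 := by linear_combination -h
  exact Nat.cast_add_one_ne_zero n this

/-- Lowering operators strictly decrease the degree, so the top degree of the generated
subrepresentation is the line through `v`. -/
theorem lieSpan_le_sup_below {a b : ℕ} {v : M} (hv : v ∈ highestWeightSpace M a b) :
    (LieSubmodule.lieSpan ℂ Sl3 {v} : Submodule ℂ M) ≤ ℂ ∙ v ⊔ below M ((a : ℂ) + b - 2) := by
  obtain ⟨h1, h2⟩ := mem_highestWeightSpace_iff.1 hv
  refine lieSpan_le_of_lowering h1 h2
    (Submodule.mem_sup_left (Submodule.mem_span_singleton_self v)) fun p q hpq x hx => ?_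
  obtain ⟨y, hy, z, hz, rfl⟩ := Submodule.mem_sup.1 hx
  obtain ⟨c, rfl⟩ := Submodule.mem_span_singleton.1 hy
  rw [lie_add, lie_smul]
  exact Submodule.mem_sup_right (add_mem
    (Submodule.smul_mem _ _ (lie_e_mem_below hpq (lie_grad_of_mem hv))) (lie_e_below hpq hz))

/-- A non-zero finite-dimensional representation contains a non-zero vector killed by the raising
operators. -/
theorem exists_raising_eq_zero (M : Type*) [AddCommGroup M] [Module ℂ M] [LieRingModule Sl3 M]
    [LieModule ℂ Sl3 M] [FiniteDimensional ℂ M] [Nontrivial M] :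
    ∃ x : M, x ≠ 0 ∧ ∀ p q : Fin 3, p < q → ⁅e p q, x⁆ = 0 := by
  set f := LieModule.toEnd ℂ Sl3 M grad with hf
  have hfin : Set.Finite {μ : ℂ | f.HasEigenvalue μ} := f.finite_hasEigenvalue
  obtain ⟨μ₀, hμ₀⟩ := Module.End.exists_eigenvalue f
  -- A raising operator increases the eigenvalue of `grad` by a positive integer, so it must kill an
  -- eigenvector whose eigenvalue has the largest real part.
  obtain ⟨μ, hμ, hmax⟩ := hfin.exists_maximalFor Complex.re _ ⟨μ₀, hμ₀⟩
  obtain ⟨x, hx⟩ := Module.End.HasEigenvalue.exists_hasEigenvector hμ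
  have hx' : ⁅grad, x⁆ = μ • x := hx.apply_eq_smul
  refine ⟨x, hx.2, fun p q hpq => ?_⟩
  by_contra hne
  have hev : f.HasEigenvalue (μ + ((q : ℕ) - (p : ℕ))) :=
    Module.End.hasEigenvalue_of_hasEigenvector (x := ⁅e p q, x⁆)
      ⟨Module.End.mem_eigenspace_iff.2 (lie_grad_lie_e hx'), hne⟩
  have h1 := hmax hev (by simp [hpq.le])
  simp only [Complex.add_re, Complex.sub_re, Complex.natCast_re, add_le_iff_nonpos_right,
    sub_nonpos, Nat.cast_le, Fin.val_fin_le] at h1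
  exact absurd hpq (not_lt.2 h1)

end
end MissingLabel
end

noncomputable section

namespace MissingLabel

/-! ### The Fischer form -/

section Fischer

open MvPolynomial ComplexConjugate

variable {σ : Type*} [Fintype σ]

/-- The product of the factorials of the exponents. -/
def multiFactorial (α : σ →₀ ℕ) : ℂ := ∏ i, ((α i).factorial : ℂ)

/-- The Fischer form: the monomials are orthogonal, with squared norms the products of the
factorials of the exponents. -/
def fischer (f g : MvPolynomial σ ℂ) : ℂ :=
  ∑ α ∈ f.support, conj (coeff α f) * multiFactorial α * coeff α g

theorem fischer_eq_sum {f g : MvPolynomial σ ℂ} {s : Finset (σ →₀ ℕ)} (hs : f.support ⊆ s) :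
    fischer f g = ∑ α ∈ s, conj (coeff α f) * multiFactorial α * coeff α g := by
  refine Finset.sum_subset hs fun α _ hα => ?_
  rw [notMem_support_iff.1 hα]; simp

theorem fischer_add_left (f f' g : MvPolynomial σ ℂ) :
    fischer (f + f') g = fischer f g + fischer f' g := by
  classical
  rw [fischer_eq_sum (s := f.support ∪ f'.support) support_add,
    fischer_eq_sum (f := f) Finset.subset_union_left,
    fischer_eq_sum (f := f') Finset.subset_union_right, ← Finset.sum_add_distrib]
  exact Finset.sum_congr rfl fun α _ => by simp only [coeff_add, map_add]; ring

theorem fischer_add_right (f g g' : MvPolynomial σ ℂ) :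
    fischer f (g + g') = fischer f g + fischer f g' := by
  simp only [fischer, ← Finset.sum_add_distrib, coeff_add, mul_add]

theorem fischer_smul_right (c : ℂ) (f g : MvPolynomial σ ℂ) :
    fischer f (c • g) = c * fischer f g := by
  simp only [fischer, coeff_smul, Finset.mul_sum, smul_eq_mul]
  exact Finset.sum_congr rfl fun α _ => by ring

theorem fischer_conj (f g : MvPolynomial σ ℂ) : conj (fischer g f) = fischer f g := by
  classical
  rw [fischer_eq_sum (s := f.support ∪ g.support) Finset.subset_union_right,
    fischer_eq_sum (f := f) (s := f.support ∪ g.support) Finset.subset_union_left, map_sum]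
  refine Finset.sum_congr rfl fun α _ => ?_
  simp only [multiFactorial, map_mul, map_prod, Complex.conj_conj, map_natCast]; ring

theorem fischer_smul_left (c : ℂ) (f g : MvPolynomial σ ℂ) :
    fischer (c • f) g = conj c * fischer f g := by
  rw [← fischer_conj, fischer_smul_right, map_mul, fischer_conj]

/-- The Fischer form, linear in the second argument. -/
def fischerLin (f : MvPolynomial σ ℂ) : MvPolynomial σ ℂ →ₗ[ℂ] ℂ where
  toFun := fischer f
  map_add' := fischer_add_right f
  map_smul' c g := fischer_smul_right c f g

@[simp] theorem fischerLin_apply (f g : MvPolynomial σ ℂ) : fischerLin f g = fischer f g := rfl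

theorem fischer_monomial (α : σ →₀ ℕ) (x : ℂ) (g : MvPolynomial σ ℂ) :
    fischer (monomial α x) g = conj x * multiFactorial α * coeff α g := by
  classical
  rw [fischer_eq_sum support_monomial_subset]; simp [coeff_monomial]

theorem multiFactorial_ne_zero (α : σ →₀ ℕ) : multiFactorial α ≠ 0 :=
  Finset.prod_ne_zero_iff.2 fun _ _ => Nat.cast_ne_zero.2 (Nat.factorial_ne_zero _)

theorem multiFactorial_add_single (α : σ →₀ ℕ) (i : σ) :
    multiFactorial (α + Finsupp.single i 1) = multiFactorial α * (α i + 1) := by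
  classical
  simp only [multiFactorial]
  rw [← Finset.mul_prod_erase _ _ (Finset.mem_univ i),
    ← Finset.mul_prod_erase _ (fun j => ((α j).factorial : ℂ)) (Finset.mem_univ i)]
  have h : ∏ x ∈ Finset.univ.erase i, (((α + Finsupp.single i 1 : σ →₀ ℕ) x).factorial : ℂ)
      = ∏ x ∈ Finset.univ.erase i, ((α x).factorial : ℂ) :=
    Finset.prod_congr rfl fun x hx => by simp [(Finset.ne_of_mem_erase hx).symm]
  rw [h]
  simp [Nat.factorial_succ]
  ring

/-- The weights by factorials are chosen for this: `(α + 1_i)! = α! (α_i + 1)` makes multiplication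
by a variable adjoint to the derivative. -/
theorem fischer_X_mul (i : σ) (f g : MvPolynomial σ ℂ) :
    fischer (MvPolynomial.X i * f) g = fischer f (pderiv i g) := by
  induction f using MvPolynomial.induction_on' with
  | monomial α x =>
    rw [MvPolynomial.X, monomial_mul, one_mul, fischer_monomial, fischer_monomial, coeff_pderiv, add_comm,
      multiFactorial_add_single]
    ring
  | add f f' hf hf' => rw [mul_add, fischer_add_left, hf, hf', fischer_add_left]

theorem fischer_pderiv (i : σ) (f g : MvPolynomial σ ℂ) :
    fischer (pderiv i f) g = fischer f (MvPolynomial.X i * g) := by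
  rw [← fischer_conj, ← fischer_X_mul, fischer_conj]

theorem fischer_self (f : MvPolynomial σ ℂ) : fischer f f =
    ((∑ α ∈ f.support, ‖coeff α f‖ ^ 2 * ∏ i, ((α i).factorial : ℝ) : ℝ) : ℂ) := by
  simp only [fischer, multiFactorial]
  push_cast
  refine Finset.sum_congr rfl fun α _ => ?_
  rw [← Complex.conj_mul']; ring

theorem fischer_self_nonneg (f : MvPolynomial σ ℂ) : 0 ≤ (fischer f f).re := by
  rw [fischer_self, Complex.ofReal_re]
  positivity

theorem eq_zero_of_fischer_self {f : MvPolynomial σ ℂ} (h : fischer f f = 0) : f = 0 := by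
  rw [fischer_self, Complex.ofReal_eq_zero,
    Finset.sum_eq_zero_iff_of_nonneg fun _ _ => by positivity] at h
  ext α
  by_contra hα
  have h1 := h α (mem_support_iff.2 hα)
  have h2 : (0 : ℝ) < ∏ i, ((α i).factorial : ℝ) :=
    Finset.prod_pos fun _ _ => Nat.cast_pos.2 (Nat.factorial_pos _)
  rcases mul_eq_zero.1 h1 with h3 | h3
  · exact hα (by simpa using h3)
  · exact h2.ne' h3

end Fischer

/-! ### The polynomial representation -/

section Poly

open MvPolynomial ComplexConjugate

/-- Polynomials in a vector `y` (the variables `inl i`) and a covector `η` (the variables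
`inr i`). -/
abbrev Poly : Type := MvPolynomial (Fin 3 ⊕ Fin 3) ℂ

/-- The derivation of `Poly` given by a matrix. -/
def polyDer (A : Matrix (Fin 3) (Fin 3) ℂ) : Derivation ℂ Poly Poly :=
  ∑ p, ∑ q, A p q • ((MvPolynomial.X (Sum.inl p) : Poly) • pderiv (Sum.inl q)
    - (MvPolynomial.X (Sum.inr q) : Poly) • pderiv (Sum.inr p))

theorem polyDer_apply (A : Matrix (Fin 3) (Fin 3) ℂ) (f : Poly) :
    polyDer A f = ∑ p, ∑ q, A p q • (MvPolynomial.X (Sum.inl p) * pderiv (Sum.inl q) f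
      - MvPolynomial.X (Sum.inr q) * pderiv (Sum.inr p) f) := by
  simp only [polyDer, ← Derivation.coeFnAddMonoidHom_apply, map_sum, Finset.sum_apply]
  rfl

theorem polyDer_inl (A : Matrix (Fin 3) (Fin 3) ℂ) (i : Fin 3) :
    polyDer A (MvPolynomial.X (Sum.inl i)) = ∑ p, A p i • MvPolynomial.X (Sum.inl p) := by
  simp [polyDer_apply, pderiv_X, Pi.single_apply]

theorem polyDer_inr (A : Matrix (Fin 3) (Fin 3) ℂ) (i : Fin 3) :
    polyDer A (MvPolynomial.X (Sum.inr i)) = - ∑ q, A i q • MvPolynomial.X (Sum.inr q) := by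
  simp [polyDer_apply, pderiv_X, Pi.single_apply]

theorem polyDer_lie (A B : Matrix (Fin 3) (Fin 3) ℂ) :
    polyDer (A * B - B * A) = ⁅polyDer A, polyDer B⁆ := by
  refine MvPolynomial.derivation_ext fun i => ?_
  rw [Derivation.commutator_apply]
  rcases i with i | i
  · simp only [polyDer_inl, Derivation.map_smul, Fin.sum_univ_three, Matrix.sub_apply, Matrix.mul_apply,
      map_add]
    module
  · simp only [polyDer_inr, Derivation.map_smul, Fin.sum_univ_three, Matrix.sub_apply, Matrix.mul_apply,
      map_add, map_neg]
    module

instance : LieRingModule Sl3 Poly where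
  bracket x f := polyDer x.1 f
  add_lie x y f := by
    change polyDer (x.1 + y.1) f = polyDer x.1 f + polyDer y.1 f
    simp only [polyDer_apply, Matrix.add_apply, add_smul, Finset.sum_add_distrib]
  lie_add x f g := map_add _ _ _
  leibniz_lie x y f := by
    change polyDer x.1 (polyDer y.1 f) = polyDer (x.1 * y.1 - y.1 * x.1) f
      + polyDer y.1 (polyDer x.1 f)
    rw [polyDer_lie, Derivation.commutator_apply]; abel

theorem lie_poly (x : Sl3) (f : Poly) : ⁅x, f⁆ = polyDer x.1 f := rfl

instance : LieModule ℂ Sl3 Poly where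
  smul_lie c x f := by
    change polyDer (c • x.1) f = c • polyDer x.1 f
    simp only [polyDer_apply, Matrix.smul_apply, smul_eq_mul, mul_smul, Finset.smul_sum]
  lie_smul c x f := (polyDer x.1).map_smul c f

theorem lie_poly_mul (x : Sl3) (f g : Poly) : ⁅x, f * g⁆ = f * ⁅x, g⁆ + g * ⁅x, f⁆ := by
  simp only [lie_poly, Derivation.leibniz, smul_eq_mul]

theorem fischer_sub_right (f g g' : Poly) : fischer f (g - g') = fischer f g - fischer f g' :=
  map_sub (fischerLin f) g g'

theorem fischer_sum_right {ι : Type*} (s : Finset ι) (f : Poly) (g : ι → Poly) :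
    fischer f (∑ i ∈ s, g i) = ∑ i ∈ s, fischer f (g i) :=
  map_sum (fischerLin f) g s

/-- The operator `y_p ∂/∂y_q` is adjoint to `y_q ∂/∂y_p`, and likewise for `η`, so the adjoint on
polynomials is the conjugate transpose on matrices. -/
theorem fischer_polyDer (A : Matrix (Fin 3) (Fin 3) ℂ) (f g : Poly) :
    fischer f (polyDer A g) = fischer (polyDer A.conjTranspose f) g := by
  rw [← fischer_conj (polyDer A.conjTranspose f)]
  simp only [polyDer_apply, fischer_sum_right, fischer_smul_right, fischer_sub_right, map_sum,
    map_mul, map_sub, fischer_conj, ← fischer_pderiv, Matrix.conjTranspose_apply]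
  rw [Finset.sum_comm]
  simp [fischer_pderiv]

theorem fischer_lie_e (p q : Fin 3) (f g : Poly) :
    fischer ⁅e p q, f⁆ g = fischer f ⁅e q p, g⁆ := by
  rw [lie_poly, lie_poly, fischer_polyDer]
  congr 3
  ext i j
  fin_cases p <;> fin_cases q <;> fin_cases i <;> fin_cases j <;> simp [e, Matrix.single]

end Poly
end MissingLabel
end

noncomputable section

namespace MissingLabel

/-! ### Embedding irreducible representations into polynomials -/

section Derivation

variable {A : Type*} [CommRing A] [Algebra ℂ A] (δ : Derivation ℂ A A)

theorem derivation_mul_eq_smul {f g : A} {c c' : ℂ} (hf : δ f = c • f) (hg : δ g = c' • g) :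
    δ (f * g) = (c + c') • (f * g) := by
  rw [Derivation.leibniz, hf, hg, smul_eq_mul, smul_eq_mul, mul_smul_comm, mul_smul_comm,
    mul_comm g f, add_smul, add_comm]

theorem derivation_pow_eq_smul {f : A} {c : ℂ} (hf : δ f = c • f) (n : ℕ) :
    δ (f ^ n) = (n * c) • f ^ n := by
  induction n with
  | zero => simp
  | succ n ih =>
    rw [pow_succ, derivation_mul_eq_smul δ ih hf]
    push_cast
    congr 1; ring

end Derivation

section Poly

open MvPolynomial ComplexConjugate

theorem lie_e_inl (p q i : Fin 3) : ⁅e p q, (MvPolynomial.X (Sum.inl i) : Poly)⁆ =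
    (if i = q then MvPolynomial.X (Sum.inl p) else 0)
      - (if p = q then (1 / 3 : ℂ) else 0) • MvPolynomial.X (Sum.inl i) := by
  rw [lie_poly, polyDer_inl]
  fin_cases p <;> fin_cases q <;> fin_cases i <;>
    simp [e, Matrix.single, Fin.sum_univ_three] <;> module

theorem lie_e_inr (p q i : Fin 3) : ⁅e p q, (MvPolynomial.X (Sum.inr i) : Poly)⁆ =
    - (if i = p then MvPolynomial.X (Sum.inr q) else 0)
      + (if p = q then (1 / 3 : ℂ) else 0) • MvPolynomial.X (Sum.inr i) := by
  rw [lie_poly, polyDer_inr]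
  fin_cases p <;> fin_cases q <;> fin_cases i <;>
    simp [e, Matrix.single, Fin.sum_univ_three] <;> module

/-- The highest-weight polynomial `y₀^p η₂^q`. -/
def hwPoly (p q : ℕ) : Poly := MvPolynomial.X (Sum.inl 0) ^ p * MvPolynomial.X (Sum.inr 2) ^ q

/-- The exponent of the highest-weight polynomial. -/
def hwExp (p q : ℕ) : Fin 3 ⊕ Fin 3 →₀ ℕ :=
  Finsupp.single (Sum.inl 0) p + Finsupp.single (Sum.inr 2) q

theorem hwPoly_eq_monomial (p q : ℕ) : hwPoly p q = monomial (hwExp p q) 1 := by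
  rw [hwPoly, hwExp, X_pow_eq_monomial, X_pow_eq_monomial, monomial_mul, one_mul]

theorem hwPoly_ne_zero (p q : ℕ) : hwPoly p q ≠ 0 := by
  rw [hwPoly_eq_monomial, Ne, monomial_eq_zero]; exact one_ne_zero

theorem hwPoly_mem (p q : ℕ) : hwPoly p q ∈ highestWeightSpace Poly (p + 1) (q + 1) := by
  rw [mem_highestWeightSpace_iff]
  constructor
  · intro i
    have h1 : polyDer (e i i).1 (MvPolynomial.X (Sum.inl 0)) =
        ((if 0 = i then 1 else 0) - 1 / 3 : ℂ) • MvPolynomial.X (Sum.inl 0) := by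
      rw [← lie_poly, lie_e_inl]; fin_cases i <;> simp <;> module
    have h2 : polyDer (e i i).1 (MvPolynomial.X (Sum.inr 2)) =
        (-(if 2 = i then 1 else 0) + 1 / 3 : ℂ) • MvPolynomial.X (Sum.inr 2) := by
      rw [← lie_poly, lie_e_inr]; fin_cases i <;> simp <;> module
    rw [lie_poly, hwPoly, derivation_mul_eq_smul _ (derivation_pow_eq_smul _ h1 p)
      (derivation_pow_eq_smul _ h2 q)]
    congr 1
    fin_cases i <;> simp [wt] <;> ring
  · intro i j hij
    have h1 : polyDer (e i j).1 (MvPolynomial.X (Sum.inl 0)) =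
        (0 : ℂ) • MvPolynomial.X (Sum.inl 0) := by
      rw [← lie_poly, lie_e_inl, if_neg (by omega), if_neg hij.ne]; simp
    have h2 : polyDer (e i j).1 (MvPolynomial.X (Sum.inr 2)) =
        (0 : ℂ) • MvPolynomial.X (Sum.inr 2) := by
      rw [← lie_poly, lie_e_inr, if_neg (by omega), if_neg hij.ne]; simp
    rw [lie_poly, hwPoly, derivation_mul_eq_smul _ (derivation_pow_eq_smul _ h1 p)
      (derivation_pow_eq_smul _ h2 q)]
    simp

end Poly

section Embedding

variable {V : Type*} [AddCommGroup V] [Module ℂ V] [LieRingModule Sl3 V] [LieModule ℂ Sl3 V]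

/-- The direct sum is needed because the embedding of `V` into polynomials is obtained from its
graph, a subrepresentation of `V × Poly`. -/
instance prodLieRingModule {N : Type*} [AddCommGroup N] [LieRingModule Sl3 N] :
    LieRingModule Sl3 (V × N) where
  bracket x m := (⁅x, m.1⁆, ⁅x, m.2⁆)
  add_lie x y m := by ext <;> simp
  lie_add x m n := by ext <;> simp
  leibniz_lie x y m := by ext <;> simp

theorem lie_prod {N : Type*} [AddCommGroup N] [LieRingModule Sl3 N] (x : Sl3) (m : V × N) :
    ⁅x, m⁆ = (⁅x, m.1⁆, ⁅x, m.2⁆) := rfl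

instance prodLieModule {N : Type*} [AddCommGroup N] [Module ℂ N] [LieRingModule Sl3 N]
    [LieModule ℂ Sl3 N] : LieModule ℂ Sl3 (V × N) where
  smul_lie c x m := by ext <;> simp [lie_prod]
  lie_smul c x m := by ext <;> simp [lie_prod]

theorem lieSpan_eq_top [LieModule.IsIrreducible ℂ Sl3 V] {v : V} (hv : v ≠ 0) :
    LieSubmodule.lieSpan ℂ Sl3 {v} = ⊤ := by
  refine (eq_bot_or_eq_top _).resolve_left fun h => hv ?_
  have := LieSubmodule.subset_lieSpan (R := ℂ) (L := Sl3) (Set.mem_singleton v)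
  rw [h] at this
  simpa using this

/-- `grad = e₁₁ - e₃₃` is self-adjoint for the Fischer form, so distinct real degrees are
orthogonal. -/
theorem fischer_eq_zero_of_lie_grad {f g : Poly} {c c' : ℝ} (hf : ⁅grad, f⁆ = (c : ℂ) • f)
    (hg : ⁅grad, g⁆ = (c' : ℂ) • g) (h : c ≠ c') : fischer f g = 0 := by
  have h1 : fischer ⁅grad, f⁆ g = fischer f ⁅grad, g⁆ := by
    rw [grad, sub_lie, sub_lie, fischer_sub_right, ← fischer_lie_e, ← fischer_lie_e, sub_eq_add_neg,
      fischer_add_left, ← neg_one_smul ℂ ⁅e 2 2, f⁆, fischer_smul_left]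
    simp [sub_eq_add_neg]
  rw [hf, hg, fischer_smul_left, fischer_smul_right, Complex.conj_ofReal] at h1
  have h2 : ((c : ℂ) - c') * fischer f g = 0 := by linear_combination h1
  refine (mul_eq_zero.1 h2).resolve_left fun h3 => h ?_
  exact_mod_cast sub_eq_zero.1 h3

theorem fischer_eq_zero_of_mem_below {f g : Poly} {c : ℝ} (hf : ⁅grad, f⁆ = (c : ℂ) • f)
    (hg : g ∈ below Poly c) : fischer f g = 0 := by
  refine (iSup_le fun n => ?_ : below Poly c ≤ LinearMap.ker (fischerLin f)) hg
  intro x hx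
  rw [Module.End.mem_eigenspace_iff, LieModule.toEnd_apply_apply] at hx
  refine fischer_eq_zero_of_lie_grad (c' := c - (n + 1)) hf (by rw [hx]; push_cast; rfl) ?_
  have : (0 : ℝ) < n + 1 := by positivity
  intro h
  linarith

/-- Vectors orthogonal to a vector generating a polynomial representation are orthogonal to that
representation when they belong to a subrepresentation. -/
theorem fischer_eq_zero_of_mem_lieSpan {f : Poly} (K : LieSubmodule ℂ Sl3 Poly)
    (hK : ∀ g ∈ K, fischer f g = 0) {f' : Poly} (hf' : f' ∈ LieSubmodule.lieSpan ℂ Sl3 {f})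
    {g : Poly} (hg : g ∈ K) : fischer f' g = 0 := by
  let S : Submodule ℂ Poly :=
    { carrier := {f' | ∀ g ∈ K, fischer f' g = 0}
      add_mem' := fun ha hb g hg => by rw [fischer_add_left, ha g hg, hb g hg, add_zero]
      zero_mem' := fun g _ => by simp [fischer]
      smul_mem' := fun c f' hf' g hg => by rw [fischer_smul_left, hf' g hg, mul_zero] }
  let N : LieSubmodule ℂ Sl3 Poly :=
    { S with
      lie_mem := fun {x f'} hf' => lie_mem_of_forall_e (S := S) (fun p q g hg => by
        rw [fischer_lie_e]
        exact hf' _ (K.lie_mem hg)) x }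
  exact (LieSubmodule.lieSpan_le.2 (Set.singleton_subset_iff.2 hK) :
    LieSubmodule.lieSpan ℂ Sl3 {f} ≤ N) hf' g hg

/-- The subrepresentation `N` of `V × Poly` generated by the pair of highest-weight vectors is the
graph of the embedding. It projects onto `V` by irreducibility. It meets `0 × Poly` trivially
because that intersection is orthogonal to the polynomial highest-weight vector, hence to everything
it generates, in particular to itself. -/
theorem exists_embedding {p q : ℕ} (hV : IsIrrep V (p + 1) (q + 1)) :
    ∃ ι : V →ₗ⁅ℂ, Sl3⁆ Poly, Function.Injective ι ∧
      ∃ v ∈ highestWeightSpace V (p + 1) (q + 1), ι v = hwPoly p q := by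
  obtain ⟨v, hv, hv0⟩ := hV.exists_highestWeight
  have hirr := hV.irreducible
  set v' := hwPoly p q
  have hv' : v' ∈ highestWeightSpace Poly (p + 1) (q + 1) := hwPoly_mem p q
  have hw : ((v, v') : V × Poly) ∈ highestWeightSpace (V × Poly) (p + 1) (q + 1) :=
    ⟨Prod.ext hv.1 hv'.1, Prod.ext hv.2.1 hv'.2.1,
      fun i j hij => Prod.ext (hv.2.2 i j hij) (hv'.2.2 i j hij)⟩
  set N := LieSubmodule.lieSpan ℂ Sl3 {((v, v') : V × Poly)} with hN
  have hvN : (v, v') ∈ N := LieSubmodule.subset_lieSpan (Set.mem_singleton _)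
  let c : ℝ := p + q
  have hc : ((p + 1 : ℕ) : ℂ) + ((q + 1 : ℕ) : ℂ) - 2 = (c : ℂ) := by
    simp only [c]; push_cast; ring
  have hgv : ⁅grad, v⁆ = (c : ℂ) • v := by rw [lie_grad_of_mem hv, hc]
  have hgv' : ⁅grad, v'⁆ = (c : ℂ) • v' := by rw [lie_grad_of_mem hv', hc]
  have hfst : ∀ x ∈ below (V × Poly) c, x.1 ∈ below V c ∧ x.2 ∈ below Poly c := by
    intro x hx
    induction hx using Submodule.iSup_induction' with
    | mem n x hx =>
      rw [Module.End.mem_eigenspace_iff, LieModule.toEnd_apply_apply] at hx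
      constructor
      · refine Submodule.mem_iSup_of_mem n ?_
        rw [Module.End.mem_eigenspace_iff]; exact congrArg Prod.fst hx
      · refine Submodule.mem_iSup_of_mem n ?_
        rw [Module.End.mem_eigenspace_iff]; exact congrArg Prod.snd hx
    | zero => exact ⟨zero_mem _, zero_mem _⟩
    | add x y _ _ hx hy => exact ⟨add_mem hx.1 hy.1, add_mem hx.2 hy.2⟩
  -- `K` is the intersection of `N` with `0 × Poly`, the obstruction to `N` being a graph over `V`.
  let K : LieSubmodule ℂ Sl3 Poly :=
    { carrier := {z | ((0, z) : V × Poly) ∈ N}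
      add_mem' := fun {x y} hx hy => by
        have : ((0, x) : V × Poly) + (0, y) ∈ N := add_mem hx hy
        simpa using this
      zero_mem' := N.zero_mem
      smul_mem' := fun c x hx => by
        have : c • ((0, x) : V × Poly) ∈ N := N.toSubmodule.smul_mem c hx
        simpa using this
      lie_mem := fun {x z} hz => by
        have : ⁅x, ((0, z) : V × Poly)⁆ ∈ N := N.lie_mem hz
        rw [lie_prod] at this
        simpa using this }
  -- The top degree of `N` is the line through `(v, v')`. An element `(0, g)` has no component on
  -- it, since its first entry would contain a non-zero multiple of `v`; so `g` has only lower
  -- degrees.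
  have hK : ∀ g ∈ K, fischer v' g = 0 := by
    intro g hg
    have h1 := lieSpan_le_sup_below hw (show ((0, g) : V × Poly) ∈ N from hg)
    rw [hc] at h1
    obtain ⟨y, hy, z, hz, hyz⟩ := Submodule.mem_sup.1 h1
    obtain ⟨t, rfl⟩ := Submodule.mem_span_singleton.1 hy
    obtain ⟨hz1, hz2⟩ := hfst z hz
    have e1 : t • v + z.1 = 0 := congrArg Prod.fst hyz
    have e2 : t • v' + z.2 = g := congrArg Prod.snd hyz
    have ht : t • v = 0 := by
      refine eq_zero_of_mem_below (c := c) (by rw [lie_smul, hgv, smul_comm]) ?_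
      rw [eq_neg_of_add_eq_zero_left e1]
      exact neg_mem hz1
    have ht0 : t = 0 := (smul_eq_zero.1 ht).resolve_right hv0
    rw [ht0, zero_smul, zero_add] at e2
    rw [← e2]
    exact fischer_eq_zero_of_mem_below hgv' hz2
  have hsnd : ∀ x ∈ N, x.2 ∈ LieSubmodule.lieSpan ℂ Sl3 {v'} := by
    intro x hx
    let N' : LieSubmodule ℂ Sl3 (V × Poly) :=
      { carrier := {x | x.2 ∈ LieSubmodule.lieSpan ℂ Sl3 {v'}}
        add_mem' := fun {x y} hx hy => (LieSubmodule.lieSpan ℂ Sl3 {v'}).add_mem hx hy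
        zero_mem' := (LieSubmodule.lieSpan ℂ Sl3 {v'}).zero_mem
        smul_mem' := fun c x hx => (LieSubmodule.lieSpan ℂ Sl3 {v'}).toSubmodule.smul_mem c hx
        lie_mem := fun {x z} hz => (LieSubmodule.lieSpan ℂ Sl3 {v'}).lie_mem hz }
    exact (LieSubmodule.lieSpan_le.2 (Set.singleton_subset_iff.2
      (LieSubmodule.subset_lieSpan (Set.mem_singleton v'))) : N ≤ N') hx
  -- `z` lies in `K` and also in the representation generated by `v'`, to which `K` is orthogonal;
  -- hence `z` is orthogonal to itself.
  have hK0 : ∀ z : Poly, ((0, z) : V × Poly) ∈ N → z = 0 := fun z hz =>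
    eq_zero_of_fischer_self (fischer_eq_zero_of_mem_lieSpan K hK (hsnd _ hz) hz)
  let f : N →ₗ[ℂ] V := LinearMap.fst ℂ V Poly ∘ₗ (N : Submodule ℂ (V × Poly)).subtype
  have hf : Function.Bijective f := by
    constructor
    · rw [← LinearMap.ker_eq_bot, LinearMap.ker_eq_bot']
      rintro ⟨⟨x, z⟩, hx⟩ h0
      have h0' : x = 0 := h0
      subst h0'
      exact Subtype.ext (Prod.ext rfl (hK0 z hx))
    · intro w
      let S : LieSubmodule ℂ Sl3 V :=
        { carrier := {w | ∃ z, (w, z) ∈ N}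
          add_mem' := fun {x y} ⟨z, hz⟩ ⟨z', hz'⟩ => ⟨z + z', add_mem hz hz'⟩
          zero_mem' := ⟨0, N.zero_mem⟩
          smul_mem' := fun c x ⟨z, hz⟩ => ⟨c • z, N.toSubmodule.smul_mem c hz⟩
          lie_mem := fun {x w} ⟨z, hz⟩ => ⟨⁅x, z⁆, N.lie_mem hz⟩ }
      have hS : S = ⊤ := by
        rw [← top_le_iff, ← lieSpan_eq_top hv0]
        exact LieSubmodule.lieSpan_le.2 (Set.singleton_subset_iff.2 ⟨v', hvN⟩)
      obtain ⟨z, hz⟩ : w ∈ S := by rw [hS]; exact LieSubmodule.mem_top _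
      exact ⟨⟨(w, z), hz⟩, rfl⟩
  let E := LinearEquiv.ofBijective f hf
  let g : V →ₗ[ℂ] Poly :=
    LinearMap.snd ℂ V Poly ∘ₗ (N : Submodule ℂ (V × Poly)).subtype ∘ₗ E.symm.toLinearMap
  have hg : ∀ w, (w, g w) ∈ N := fun w => by
    have h1 : (E.symm w : V × Poly).1 = w := E.apply_symm_apply w
    have h2 : ((w, g w) : V × Poly) = (E.symm w : V × Poly) := Prod.ext h1.symm rfl
    rw [h2]; exact (E.symm w).2
  have huniq : ∀ w z, (w, z) ∈ N → z = g w := fun w z hz => by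
    have h1 := sub_mem hz (hg w)
    rw [Prod.mk_sub_mk, sub_self] at h1
    exact sub_eq_zero.1 (hK0 _ h1)
  let ι : V →ₗ⁅ℂ, Sl3⁆ Poly :=
    { g with map_lie' := fun {x w} => (huniq _ _ (N.lie_mem (x := x) (hg w))).symm }
  have hιv : ι v = v' := (huniq _ _ hvN).symm
  refine ⟨ι, ?_, v, hv, hιv⟩
  have hker : ι.ker = ⊥ := by
    refine (eq_bot_or_eq_top _).resolve_right fun h => hwPoly_ne_zero p q ?_
    have : v ∈ ι.ker := by rw [h]; exact LieSubmodule.mem_top _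
    rw [LieModuleHom.mem_ker, hιv] at this
    exact this
  exact (LieModuleHom.ker_eq_bot ι).1 hker

end Embedding
end MissingLabel
end

noncomputable section

namespace MissingLabel

/-! ### Laurent polynomials and the chart -/

section Laurent

/-- The exponents `(a, b, c, d, k)` of the Laurent monomials `y₀^a y₂^b η₀^c η₂^d η₁^k`. -/
abbrev Expo : Type := ℤ × ℤ × ℤ × ℤ × ℤ

/-- Laurent polynomials in `y₀, y₂, η₀, η₂, η₁`. -/
abbrev Laurent : Type := AddMonoidAlgebra ℂ Expo

/-- The Laurent monomials. -/
def mon (u : Expo) : Laurent := AddMonoidAlgebra.single u 1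

theorem mon_mul (u v : Expo) : mon u * mon v = mon (u + v) := by
  simp [mon, AddMonoidAlgebra.single_mul_single]

theorem mon_pow (u : Expo) (n : ℕ) : mon u ^ n = mon (n • u) := by
  simp [mon, AddMonoidAlgebra.single_pow]

theorem mon_zero : mon 0 = 1 := rfl

theorem coeff_mon (u v : Expo) : (mon u).coeff v = if u = v then 1 else 0 := by
  classical
  simp [mon, Finsupp.single_apply]

theorem coeff_mon_mul (s u : Expo) (x : Laurent) : (mon s * x).coeff u = x.coeff (u - s) := by
  rw [mon, AddMonoidAlgebra.coeff_single_mul_apply, one_mul, neg_add_eq_sub]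

/-- The linear map which multiplies each Laurent monomial by a function of its exponent. -/
def eulLin (l : Expo → ℂ) : Laurent →ₗ[ℂ] Laurent where
  toFun x := AddMonoidAlgebra.ofCoeff (l • x.coeff)
  map_add' x y := by ext; simp
  map_smul' c x := by ext; simp; ring

theorem eulLin_single (l : Expo → ℂ) (u : Expo) (r : ℂ) :
    eulLin l (AddMonoidAlgebra.single u r) = AddMonoidAlgebra.single u (l u * r) := by
  classical
  ext v
  simp only [eulLin, LinearMap.coe_mk, AddHom.coe_mk, AddMonoidAlgebra.coeff_single,
    Finsupp.coe_pointwise_smul, Pi.smul_apply', smul_eq_mul, Finsupp.single_apply]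
  split_ifs with h
  · rw [h]
  · simp

/-- The derivation which multiplies each Laurent monomial by an additive function of its
exponent. -/
def eul (l : Expo →+ ℂ) : Derivation ℂ Laurent Laurent :=
  Derivation.mk' (eulLin l) (fun x y => by
    simp only [smul_eq_mul]
    induction x using AddMonoidAlgebra.induction_linear with
    | zero => simp
    | add f g hf hg => rw [add_mul, map_add, map_add, hf, hg, add_mul, mul_add]; abel
    | single u r =>
      induction y using AddMonoidAlgebra.induction_linear with
      | zero => simp
      | add f g hf hg => rw [mul_add, map_add, map_add, hf, hg, add_mul, mul_add]; abel
      | single v t =>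
        rw [AddMonoidAlgebra.single_mul_single, eulLin_single, eulLin_single, eulLin_single,
          AddMonoidAlgebra.single_mul_single, AddMonoidAlgebra.single_mul_single, add_comm v u,
          ← AddMonoidAlgebra.single_add, map_add]
        congr 1
        ring)

theorem coeff_eul (l : Expo →+ ℂ) (x : Laurent) (u : Expo) :
    (eul l x).coeff u = l u * x.coeff u := rfl

theorem eul_mon (l : Expo →+ ℂ) (u : Expo) : eul l (mon u) = l u • mon u := by
  ext v
  rw [coeff_eul, AddMonoidAlgebra.coeff_smul_apply, coeff_mon]
  split_ifs with h
  · rw [h]; rfl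
  · simp

/-- The exponent of `y₀`. -/
def expA : Expo →+ ℂ := (Int.castAddHom ℂ).comp (AddMonoidHom.fst _ _)

/-- The exponent of `y₂`. -/
def expB : Expo →+ ℂ :=
  (Int.castAddHom ℂ).comp ((AddMonoidHom.fst _ _).comp (AddMonoidHom.snd _ _))

/-- The exponent of `η₀`. -/
def expC : Expo →+ ℂ := (Int.castAddHom ℂ).comp
  ((AddMonoidHom.fst _ _).comp ((AddMonoidHom.snd _ _).comp (AddMonoidHom.snd _ _)))

/-- The exponent of `η₂`. -/
def expD : Expo →+ ℂ := (Int.castAddHom ℂ).comp ((AddMonoidHom.fst _ _).comp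
  ((AddMonoidHom.snd _ _).comp ((AddMonoidHom.snd _ _).comp (AddMonoidHom.snd _ _))))

/-- The exponent of `η₁`. -/
def expK : Expo →+ ℂ := (Int.castAddHom ℂ).comp ((AddMonoidHom.snd _ _).comp
  ((AddMonoidHom.snd _ _).comp ((AddMonoidHom.snd _ _).comp (AddMonoidHom.snd _ _))))

@[simp] theorem expA_apply (a b c d k : ℤ) : expA (a, b, c, d, k) = a := rfl
@[simp] theorem expB_apply (a b c d k : ℤ) : expB (a, b, c, d, k) = b := rfl
@[simp] theorem expC_apply (a b c d k : ℤ) : expC (a, b, c, d, k) = c := rfl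
@[simp] theorem expD_apply (a b c d k : ℤ) : expD (a, b, c, d, k) = d := rfl
@[simp] theorem expK_apply (a b c d k : ℤ) : expK (a, b, c, d, k) = k := rfl

/-- The degree of a Laurent monomial in `y` minus its degree in `η`. -/
def expT : Expo →+ ℂ := expA + expB - expC - expD - expK

/-- The derivations of `Laurent` which correspond to the generators `e_{pq}` in the chart. -/
def chartDer : Fin 3 → Fin 3 → Derivation ℂ Laurent Laurent :=
  ![![eul (expA - expC) - (1 / 3 : ℂ) • eul expT,
      - (mon (0, 0, -1, 0, 1) • eul expC),
      mon (1, -1, 0, 0, 0) • eul expB - mon (0, 0, -1, 1, 0) • eul expC],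
    ![- (mon (-1, 1, 0, 1, -1) • eul expA) - mon (0, 0, 1, 0, -1) • eul (expA + expK),
      eul (-expK) - (1 / 3 : ℂ) • eul expT,
      - (mon (1, -1, 1, 0, -1) • eul expB) - mon (0, 0, 0, 1, -1) • eul (expB + expK)],
    ![mon (-1, 1, 0, 0, 0) • eul expA - mon (0, 0, 1, -1, 0) • eul expD,
      - (mon (0, 0, 0, -1, 1) • eul expD),
      eul (expB - expD) - (1 / 3 : ℂ) • eul expT]]

/-- The operators underlying `chartDer`. -/
def chartOp (p q : Fin 3) : Module.End ℂ Laurent := (chartDer p q).toLinearMap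

@[simp] theorem chartOp_apply (p q : Fin 3) (x : Laurent) : chartOp p q x = chartDer p q x := rfl

theorem isChart (a b c d k : ℤ) : IsChart chartOp
    (fun x y z => mon (a - x, b + x, c + y, d - y - z, k + z)) a b c d k := by
  constructor <;> intro x y z <;>
    simp [chartDer, eul_mon, expT, mon_mul, neg_add_eq_sub, add_comm (1 : ℤ),
      add_comm (-1 : ℤ)]
  all_goals ring_nf
  all_goals module

/-- The chart on the cone `y₀ η₀ + y₁ η₁ + y₂ η₂ = 0`. -/
def chart : Poly →ₐ[ℂ] Laurent :=
  MvPolynomial.aeval (Sum.elim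
    ![mon (1, 0, 0, 0, 0), - mon (1, 0, 1, 0, -1) - mon (0, 1, 0, 1, -1), mon (0, 1, 0, 0, 0)]
    ![mon (0, 0, 1, 0, 0), mon (0, 0, 0, 0, 1), mon (0, 0, 0, 1, 0)])

theorem chart_derivation_eq {δ : Derivation ℂ Poly Poly} {δ' : Derivation ℂ Laurent Laurent}
    (h : ∀ i, chart (δ (MvPolynomial.X i)) = δ' (chart (MvPolynomial.X i))) (f : Poly) :
    chart (δ f) = δ' (chart f) := by
  induction f using MvPolynomial.induction_on with
  | C c => rw [← MvPolynomial.algebraMap_eq, Derivation.map_algebraMap, map_zero, AlgHom.commutes,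
      Derivation.map_algebraMap]
  | add f g hf hg => simp [hf, hg]
  | mul_X f i hf => simp only [Derivation.leibniz, map_add, smul_eq_mul, map_mul, hf, h]

/-- The form `y₀η₀ + y₁η₁ + y₂η₂` is invariant, so the generators descend to derivations of
functions on the cone. Two derivations along the same algebra map need only be compared on the six
variables. -/
theorem chart_lie_e (p q : Fin 3) (f : Poly) : chart ⁅e p q, f⁆ = chartDer p q (chart f) := by
  rw [lie_poly]
  refine chart_derivation_eq (fun i => ?_) f
  rw [← lie_poly]
  rcases i with i | i
  · rw [lie_e_inl]
    fin_cases p <;> fin_cases q <;> fin_cases i <;>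
      simp [chart, chartDer, eul_mon, expT, mon_mul]
    abel
  · rw [lie_e_inr]
    fin_cases p <;> fin_cases q <;> fin_cases i <;>
      simp [chart, chartDer, eul_mon, expT, mon_mul]

theorem eq_zero_of_mon_mul {s : Expo} {x : Laurent} (h : mon s * x = 0) : x = 0 := by
  have h1 : mon (-s) * (mon s * x) = 0 := by rw [h, mul_zero]
  rwa [← mul_assoc, mon_mul, neg_add_cancel, mon_zero, one_mul] at h1

/-- A Laurent polynomial killed by the raising operators only involves `y₀` and `η₂`. -/
theorem exponents_of_raising {x : Laurent} (h : ∀ p q : Fin 3, p < q → chartDer p q x = 0)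
    {a b c d k : ℤ} (hu : x.coeff (a, b, c, d, k) ≠ 0) : b = 0 ∧ c = 0 ∧ k = 0 := by
  have hC : eul expC x = 0 := by
    have h1 := h 0 1 (by decide)
    simp only [chartDer, Matrix.cons_val_zero, Matrix.cons_val_one, Derivation.neg_apply,
      Derivation.smul_apply, smul_eq_mul, neg_eq_zero] at h1
    exact eq_zero_of_mon_mul h1
  have hB : eul expB x = 0 := by
    have h1 := h 0 2 (by decide)
    simp only [chartDer, Matrix.cons_val_zero, Matrix.cons_val, Derivation.sub_apply,
      Derivation.smul_apply, smul_eq_mul, hC, mul_zero, sub_zero] at h1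
    exact eq_zero_of_mon_mul h1
  have hK : eul (expB + expK) x = 0 := by
    have h1 := h 1 2 (by decide)
    simp only [chartDer, Matrix.cons_val_one, Matrix.cons_val, Derivation.sub_apply,
      Derivation.neg_apply, Matrix.cons_val_zero,
      Derivation.smul_apply, smul_eq_mul, hB, mul_zero, neg_zero, zero_sub, neg_eq_zero] at h1
    exact eq_zero_of_mon_mul h1
  have key : ∀ l : Expo →+ ℂ, eul l x = 0 → l (a, b, c, d, k) = 0 := fun l hl => by
    have h1 := coeff_eul l x (a, b, c, d, k)
    rw [hl] at h1
    exact (mul_eq_zero.1 h1.symm).resolve_right hu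
  have h1 := key _ hB
  have h2 := key _ hC
  have h3 := key _ hK
  simp only [AddMonoidHom.add_apply, expB_apply, expC_apply, expK_apply] at h1 h2 h3
  rw [h1, zero_add] at h3
  exact ⟨by exact_mod_cast h1, by exact_mod_cast h2, by exact_mod_cast h3⟩

open MvPolynomial in
/-- The derivation which multiplies each monomial by a linear function of its exponent. -/
def wder (l : Fin 3 ⊕ Fin 3 → ℂ) : Derivation ℂ Poly Poly :=
  mkDerivation ℂ fun i => l i • MvPolynomial.X i

theorem wder_X (l : Fin 3 ⊕ Fin 3 → ℂ) (i : Fin 3 ⊕ Fin 3) :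
    wder l (MvPolynomial.X i) = l i • MvPolynomial.X i := by
  rw [wder, MvPolynomial.mkDerivation_X]

theorem wder_monomial (l : Fin 3 ⊕ Fin 3 → ℂ) (α : Fin 3 ⊕ Fin 3 →₀ ℕ) (r : ℂ) :
    wder l (MvPolynomial.monomial α r) = (∑ i, α i * l i) • MvPolynomial.monomial α r := by
  rw [wder, MvPolynomial.mkDerivation_monomial, Finsupp.sum_fintype _ _ (by simp), Finset.sum_smul,
    Finset.smul_sum]
  refine Finset.sum_congr rfl fun i _ => ?_
  by_cases h : α i = 0
  · simp [h]
  · have h1 : α - Finsupp.single i 1 + Finsupp.single i 1 = α :=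
      tsub_add_cancel_of_le (Finsupp.single_le_iff.2 (Nat.one_le_iff_ne_zero.2 h))
    rw [smul_eq_mul, mul_smul_comm, MvPolynomial.X, MvPolynomial.monomial_mul, h1,
      MvPolynomial.smul_monomial, MvPolynomial.smul_monomial, MvPolynomial.smul_monomial]
    congr 1
    simp only [smul_eq_mul]
    ring

theorem coeff_wder (l : Fin 3 ⊕ Fin 3 → ℂ) (α : Fin 3 ⊕ Fin 3 →₀ ℕ) (f : Poly) :
    MvPolynomial.coeff α (wder l f) = (∑ i, α i * l i) * MvPolynomial.coeff α f := by
  classical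
  induction f using MvPolynomial.induction_on' with
  | monomial β r =>
    rw [wder_monomial, MvPolynomial.coeff_smul, MvPolynomial.coeff_monomial, smul_eq_mul]
    split_ifs with h
    · rw [h]
    · simp
  | add f g hf hg => rw [map_add, MvPolynomial.coeff_add, hf, hg, MvPolynomial.coeff_add, mul_add]

/-- The degree in `y`. -/
def degY : Fin 3 ⊕ Fin 3 → ℂ := Sum.elim 1 0

/-- The degree in `η`. -/
def degH : Fin 3 ⊕ Fin 3 → ℂ := Sum.elim 0 1

theorem wder_polyDer {l : Fin 3 ⊕ Fin 3 → ℂ} (hl : l = degY ∨ l = degH)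
    (A : Matrix (Fin 3) (Fin 3) ℂ) (f : Poly) :
    wder l (polyDer A f) = polyDer A (wder l f) := by
  have h : ⁅wder l, polyDer A⁆ = 0 := by
    refine MvPolynomial.derivation_ext fun i => ?_
    rw [Derivation.commutator_apply]
    rcases hl with rfl | rfl <;> rcases i with i | i <;>
      simp [wder_X, polyDer_inl, polyDer_inr, degY, degH, Fin.sum_univ_three]
  have h1 := DFunLike.congr_fun h f
  rw [Derivation.commutator_apply, Derivation.zero_apply] at h1
  exact sub_eq_zero.1 h1

/-- Polynomials of bidegree `(p, q)`. -/
def bideg (p q : ℕ) : LieSubmodule ℂ Sl3 Poly where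
  carrier := {f | wder degY f = (p : ℂ) • f ∧ wder degH f = (q : ℂ) • f}
  add_mem' := by
    rintro f g ⟨h1, h2⟩ ⟨h3, h4⟩
    exact ⟨by rw [map_add, h1, h3, smul_add], by rw [map_add, h2, h4, smul_add]⟩
  zero_mem' := by simp
  smul_mem' := by
    rintro c f ⟨h1, h2⟩
    exact ⟨by rw [Derivation.map_smul, h1, smul_comm], by rw [Derivation.map_smul, h2, smul_comm]⟩
  lie_mem := by
    rintro x f ⟨h1, h2⟩
    refine ⟨?_, ?_⟩
    · rw [lie_poly, wder_polyDer (Or.inl rfl), h1, Derivation.map_smul]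
    · rw [lie_poly, wder_polyDer (Or.inr rfl), h2, Derivation.map_smul]

theorem mem_bideg {p q : ℕ} {f : Poly} :
    f ∈ bideg p q ↔ wder degY f = (p : ℂ) • f ∧ wder degH f = (q : ℂ) • f := Iff.rfl

theorem mul_mem_bideg {p q p' q' : ℕ} {f g : Poly} (hf : f ∈ bideg p q) (hg : g ∈ bideg p' q') :
    f * g ∈ bideg (p + p') (q + q') := by
  rw [mem_bideg] at hf hg ⊢
  push_cast
  exact ⟨derivation_mul_eq_smul _ hf.1 hg.1, derivation_mul_eq_smul _ hf.2 hg.2⟩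

theorem X_inl_mem_bideg (i : Fin 3) : (MvPolynomial.X (Sum.inl i) : Poly) ∈ bideg 1 0 := by
  rw [mem_bideg, wder_X, wder_X]; simp [degY, degH]

theorem X_inr_mem_bideg (i : Fin 3) : (MvPolynomial.X (Sum.inr i) : Poly) ∈ bideg 0 1 := by
  rw [mem_bideg, wder_X, wder_X]; simp [degY, degH]

theorem one_mem_bideg : (1 : Poly) ∈ bideg 0 0 := by
  rw [mem_bideg]; simp

theorem pow_mem_bideg {p q : ℕ} {f : Poly} (hf : f ∈ bideg p q) (n : ℕ) :
    f ^ n ∈ bideg (n * p) (n * q) := by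
  rw [mem_bideg] at hf ⊢
  push_cast
  exact ⟨derivation_pow_eq_smul _ hf.1 n, derivation_pow_eq_smul _ hf.2 n⟩

theorem hwPoly_mem_bideg (p q : ℕ) : hwPoly p q ∈ bideg p q := by
  have := mul_mem_bideg (pow_mem_bideg (X_inl_mem_bideg 0) p) (pow_mem_bideg (X_inr_mem_bideg 2) q)
  simpa [hwPoly] using this

theorem exponent_of_mem_bideg {p q : ℕ} {f : Poly} (hf : f ∈ bideg p q)
    {α : Fin 3 ⊕ Fin 3 →₀ ℕ} (hα : MvPolynomial.coeff α f ≠ 0) :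
    α (Sum.inl 0) + α (Sum.inl 1) + α (Sum.inl 2) = p ∧
      α (Sum.inr 0) + α (Sum.inr 1) + α (Sum.inr 2) = q := by
  have h1 := coeff_wder degY α f
  have h2 := coeff_wder degH α f
  rw [hf.1, MvPolynomial.coeff_smul, smul_eq_mul] at h1
  rw [hf.2, MvPolynomial.coeff_smul, smul_eq_mul] at h2
  have h3 := mul_right_cancel₀ hα h1
  have h4 := mul_right_cancel₀ hα h2
  simp only [degY, degH, Fintype.sum_sum_type, Fin.sum_univ_three, Sum.elim_inl, Sum.elim_inr,
    Pi.one_apply, Pi.zero_apply, mul_one, mul_zero, add_zero, zero_add] at h3 h4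
  exact ⟨by exact_mod_cast h3.symm, by exact_mod_cast h4.symm⟩

instance finiteDimensional_bideg (p q : ℕ) : FiniteDimensional ℂ (bideg p q) := by
  have hle : (bideg p q : Submodule ℂ Poly) ≤
      MvPolynomial.restrictTotalDegree (Fin 3 ⊕ Fin 3) ℂ (p + q) := by
    intro f hf
    rw [MvPolynomial.mem_restrictTotalDegree]
    refine Finset.sup_le fun α hα => ?_
    have := exponent_of_mem_bideg hf (MvPolynomial.mem_support_iff.1 hα)
    rw [Finsupp.sum_fintype _ _ (fun _ => rfl), Fintype.sum_sum_type]
    simp only [Fin.sum_univ_three]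
    omega
  exact Submodule.finiteDimensional_of_le hle

theorem chart_X (i : Fin 3 ⊕ Fin 3) : chart (MvPolynomial.X i) = Sum.elim
    ![mon (1, 0, 0, 0, 0), - mon (1, 0, 1, 0, -1) - mon (0, 1, 0, 1, -1), mon (0, 1, 0, 0, 0)]
    ![mon (0, 0, 1, 0, 0), mon (0, 0, 0, 0, 1), mon (0, 0, 0, 1, 0)] i := by
  rw [chart, MvPolynomial.aeval_X]

/-- The expression substituted for `y₁` is homogeneous for all three gradings: the degree in `y`,
the degree in `η`, and the weight under `grad`. -/
theorem chart_wder {l : Fin 3 ⊕ Fin 3 → ℂ} {l' : Expo →+ ℂ}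
    (h : l = degY ∧ l' = expA + expB ∨ l = degH ∧ l' = expC + expD + expK ∨
      l = Sum.elim ![1, 0, -1] ![-1, 0, 1] ∧ l' = expA - expB - expC + expD) (f : Poly) :
    chart (wder l f) = eul l' (chart f) := by
  refine chart_derivation_eq (fun i => ?_) f
  rw [wder_X, map_smul, chart_X]
  rcases h with ⟨rfl, rfl⟩ | ⟨rfl, rfl⟩ | ⟨rfl, rfl⟩ <;> rcases i with i | i <;> fin_cases i <;>
    simp [degY, degH, eul_mon]

theorem chart_hwPoly (p q : ℕ) : chart (hwPoly p q) = mon (p, 0, 0, q, 0) := by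
  simp [hwPoly, chart_X, mon_pow, mon_mul]

/-- The leading coefficient of a bihomogeneous polynomial can be read off in the chart. -/
theorem coeff_chart {p q : ℕ} {f : Poly} (hf : f ∈ bideg p q) :
    (chart f).coeff (p, 0, 0, q, 0) = MvPolynomial.coeff (hwExp p q) f := by
  have hmon : ∀ α ∈ f.support, (chart (MvPolynomial.monomial α (MvPolynomial.coeff α f))).coeff
      ((p, 0, 0, q, 0) : Expo) = if α = hwExp p q then MvPolynomial.coeff α f else 0 := by
    intro α hα
    obtain ⟨h1, h2⟩ := exponent_of_mem_bideg hf (MvPolynomial.mem_support_iff.1 hα)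
    split_ifs with h
    · rw [h, ← mul_one (MvPolynomial.coeff (hwExp p q) f), ← smul_eq_mul,
        ← MvPolynomial.smul_monomial, ← hwPoly_eq_monomial, map_smul, chart_hwPoly,
        AddMonoidAlgebra.coeff_smul_apply, coeff_mon, if_pos rfl]
    · set g : Poly := MvPolynomial.monomial α (MvPolynomial.coeff α f)
      have h3 := congrArg (fun x => x.coeff ((p, 0, 0, q, 0) : Expo))
        (chart_wder (Or.inr (Or.inr ⟨rfl, rfl⟩)) g)
      simp only [coeff_eul, g, wder_monomial, map_smul, AddMonoidAlgebra.coeff_smul_apply,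
        smul_eq_mul] at h3
      by_contra h0
      have h4 := mul_right_cancel₀ h0 h3
      simp only [Fintype.sum_sum_type, Fin.sum_univ_three, Sum.elim_inl, Sum.elim_inr,
        AddMonoidHom.add_apply, AddMonoidHom.sub_apply, expA_apply, expB_apply, expC_apply,
        expD_apply, Matrix.cons_val_zero, Matrix.cons_val_one, Matrix.cons_val] at h4
      -- In bidegree `(p, q)` the `grad`-weight is at most `p + q`, with equality only for `y₀^p
      -- η₂^q`; no other monomial can contribute to this coefficient.
      have h5 : ((α (Sum.inl 0) + α (Sum.inr 2) : ℕ) : ℂ) =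
          ((p + q + α (Sum.inl 2) + α (Sum.inr 0) : ℕ) : ℂ) := by
        push_cast at h4 ⊢
        linear_combination h4
      have h6 := Nat.cast_injective h5
      apply h
      ext i
      rcases i with i | i <;> fin_cases i <;> simp [hwExp] <;> omega
  conv_lhs => rw [f.as_sum, map_sum]
  rw [AddMonoidAlgebra.coeff_sum, Finsupp.finsetSum_apply, Finset.sum_congr rfl hmon]
  rw [Finset.sum_ite_eq']
  split_ifs with h
  · rfl
  · exact (MvPolynomial.notMem_support_iff.1 h).symm

/-- The Laurent polynomials which are polynomials in `y₀, y₂, η₀, η₂`. -/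
def posPart : Subalgebra ℂ Laurent where
  carrier := {x | ∀ u : Expo, x.coeff u ≠ 0 → 0 ≤ u.1 ∧ 0 ≤ u.2.1 ∧ 0 ≤ u.2.2.1 ∧ 0 ≤ u.2.2.2.1}
  mul_mem' := by
    classical
    intro x y hx hy u hu
    obtain ⟨v, hv, w, hw, rfl⟩ := Finset.mem_add.1
      (AddMonoidAlgebra.support_coeff_mul_subset x y (Finsupp.mem_support_iff.2 hu))
    obtain ⟨h1, h2, h3, h4⟩ := hx v (Finsupp.mem_support_iff.1 hv)
    obtain ⟨k1, k2, k3, k4⟩ := hy w (Finsupp.mem_support_iff.1 hw)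
    exact ⟨add_nonneg h1 k1, add_nonneg h2 k2, add_nonneg h3 k3, add_nonneg h4 k4⟩
  add_mem' := by
    intro x y hx hy u hu
    by_cases h : x.coeff u = 0
    · refine hy u fun h' => hu ?_
      rw [AddMonoidAlgebra.coeff_add, Finsupp.add_apply, h, h', add_zero]
    · exact hx u h
  algebraMap_mem' := by
    classical
    intro r u hu
    have h1 : u = 0 := by
      by_contra h
      refine hu ?_
      rw [Algebra.algebraMap_eq_smul_one, AddMonoidAlgebra.coeff_smul_apply, ← mon_zero, coeff_mon,
        if_neg (Ne.symm h), smul_zero]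
    subst h1
    exact ⟨le_rfl, le_rfl, le_rfl, le_rfl⟩

theorem mon_mem_posPart {a b c d k : ℤ} (ha : 0 ≤ a) (hb : 0 ≤ b) (hc : 0 ≤ c) (hd : 0 ≤ d) :
    mon (a, b, c, d, k) ∈ posPart := by
  intro u hu
  rw [coeff_mon] at hu
  have : (a, b, c, d, k) = u := by by_contra h; exact hu (if_neg h)
  subst this
  exact ⟨ha, hb, hc, hd⟩

/-- Only `η₁` is inverted in the chart. This is the source of the inequalities `a, b, c, d ≥ 0` on
leading exponents. -/
theorem chart_mem_posPart (f : Poly) : chart f ∈ posPart := by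
  induction f using MvPolynomial.induction_on with
  | C c => rw [← MvPolynomial.algebraMap_eq, AlgHom.commutes]; exact posPart.algebraMap_mem c
  | add f g hf hg => rw [map_add]; exact add_mem hf hg
  | mul_X f i hf =>
    rw [map_mul]
    refine mul_mem hf ?_
    rw [chart_X]
    rcases i with i | i <;> fin_cases i
    · exact mon_mem_posPart (by decide) (by decide) (by decide) (by decide)
    · exact sub_mem (neg_mem (mon_mem_posPart (by decide) (by decide) (by decide) (by decide)))
        (mon_mem_posPart (by decide) (by decide) (by decide) (by decide))
    all_goals exact mon_mem_posPart (by decide) (by decide) (by decide) (by decide)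

end Laurent
end MissingLabel
end

noncomputable section

namespace MissingLabel

/-! ### Irreducible representations with their invariant inner product -/

section Model

/-- A representation with an inner product for which it is isometrically embedded into the
polynomials, a given highest-weight vector being sent to `y₀^p η₂^q`. -/
structure Model (V : Type*) [NormedAddCommGroup V] [InnerProductSpace ℂ V] [LieRingModule Sl3 V]
    [LieModule ℂ Sl3 V] (p q : ℕ) where
  ι : V →ₗ⁅ℂ, Sl3⁆ Poly
  inner_eq : ∀ x y, inner ℂ x y = fischer (ι x) (ι y)
  v : V
  v_mem : v ∈ highestWeightSpace V (p + 1) (q + 1)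
  ι_v : ι v = hwPoly p q

/-- Each irreducible representation carries an inner product coming from the Fischer form. -/
theorem exists_core {V : Type*} [AddCommGroup V] [Module ℂ V] [LieRingModule Sl3 V]
    [LieModule ℂ Sl3 V] {p q : ℕ} (hV : IsIrrep V (p + 1) (q + 1)) :
    ∃ (c : InnerProductSpace.Core ℂ V) (ι : V →ₗ⁅ℂ, Sl3⁆ Poly),
      (∀ x y, c.inner x y = fischer (ι x) (ι y)) ∧
      ∃ v ∈ highestWeightSpace V (p + 1) (q + 1), ι v = hwPoly p q := by
  obtain ⟨ι, hι, v, hv, hιv⟩ := exists_embedding hV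
  refine ⟨{ inner := fun x y => fischer (ι x) (ι y)
            conj_inner_symm := fun x y => fischer_conj _ _
            re_inner_nonneg := fun x => fischer_self_nonneg _
            add_left := fun x y z => by rw [map_add, fischer_add_left]
            smul_left := fun x y r => by rw [map_smul, fischer_smul_left]
            definite := fun x hx => hι (by rw [eq_zero_of_fischer_self hx, map_zero]) },
    ι, fun x y => rfl, v, hv, hιv⟩

variable {V : Type*} [NormedAddCommGroup V] [InnerProductSpace ℂ V] [LieRingModule Sl3 V]
  [LieModule ℂ Sl3 V] {p q : ℕ}

namespace Model

theorem inner_lie (A : Model V p q) (i j : Fin 3) (x y : V) :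
    inner ℂ ⁅e i j, x⁆ y = inner ℂ x ⁅e j i, y⁆ := by
  rw [A.inner_eq, A.inner_eq, LieModuleHom.map_lie, LieModuleHom.map_lie, fischer_lie_e]

variable (A : Model V p q)

theorem v_ne_zero : A.v ≠ 0 := fun h => hwPoly_ne_zero p q (by rw [← A.ι_v, h, map_zero])

theorem ι_mem [LieModule.IsIrreducible ℂ Sl3 V] (x : V) : A.ι x ∈ bideg p q := by
  have h : LieSubmodule.lieSpan ℂ Sl3 {A.v} ≤ (bideg p q).comap A.ι := by
    refine LieSubmodule.lieSpan_le.2 (Set.singleton_subset_iff.2 ?_)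
    change A.ι A.v ∈ bideg p q
    rw [A.ι_v]; exact hwPoly_mem_bideg p q
  rw [lieSpan_eq_top A.v_ne_zero] at h
  exact h (LieSubmodule.mem_top x)

variable [FiniteDimensional ℂ V]

/-- The adjoint of the embedding into the polynomials. -/
def π : Poly →ₗ[ℂ] V :=
  ∑ i, (fischerLin (A.ι (stdOrthonormalBasis ℂ V i))).smulRight (stdOrthonormalBasis ℂ V i)

theorem inner_π (x : V) (f : Poly) : inner ℂ x (A.π f) = fischer (A.ι x) f := by
  have hx := (stdOrthonormalBasis ℂ V).sum_repr' x
  conv_rhs => rw [← hx]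
  rw [← fischer_conj]
  simp only [π, LinearMap.sum_apply, LinearMap.smulRight_apply, fischerLin_apply, inner_sum,
    inner_smul_right, map_sum, map_smul, fischer_sum_right, fischer_smul_right, map_mul,
    fischer_conj, inner_conj_symm]
  exact Finset.sum_congr rfl fun i _ => mul_comm _ _

/-- `π` is the adjoint of an equivariant map, and `e_{ij}` and `e_{ji}` are adjoint for both forms.
-/
theorem π_lie (i j : Fin 3) (f : Poly) : A.π ⁅e i j, f⁆ = ⁅e i j, A.π f⁆ := by
  refine ext_inner_left ℂ fun x => ?_
  rw [A.inner_π, ← fischer_lie_e, ← A.inner_lie, A.inner_π, LieModuleHom.map_lie]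

theorem inner_v_π (f : Poly) :
    inner ℂ A.v (A.π f) = multiFactorial (hwExp p q) * MvPolynomial.coeff (hwExp p q) f := by
  rw [A.inner_π, A.ι_v, hwPoly_eq_monomial, fischer_monomial, map_one, one_mul]

/-- The bihomogeneous polynomials orthogonal to the representation. -/
def orth : LieSubmodule ℂ Sl3 Poly :=
  let S : Submodule ℂ Poly := (bideg p q : Submodule ℂ Poly) ⊓
    ⨅ x : V, LinearMap.ker (fischerLin (A.ι x))
  { S with
    lie_mem := fun {y f} hf => lie_mem_of_forall_e (S := S) (fun i j => by
      obtain ⟨h1, h2⟩ := Submodule.mem_inf.1 hf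
      refine Submodule.mem_inf.2 ⟨(bideg p q).lie_mem h1, ?_⟩
      rw [Submodule.mem_iInf] at h2 ⊢
      intro x
      rw [LinearMap.mem_ker, fischerLin_apply, ← fischer_lie_e, ← LieModuleHom.map_lie]
      exact h2 _) y }

theorem mem_orth {f : Poly} :
    f ∈ A.orth ↔ f ∈ bideg p q ∧ ∀ x : V, fischer (A.ι x) f = 0 := by
  change f ∈ (bideg p q : Submodule ℂ Poly) ⊓ ⨅ x : V, LinearMap.ker (fischerLin (A.ι x)) ↔ _
  rw [Submodule.mem_inf, Submodule.mem_iInf]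
  rfl

instance : FiniteDimensional ℂ A.orth :=
  have : FiniteDimensional ℂ (bideg p q : Submodule ℂ Poly) := finiteDimensional_bideg p q
  Submodule.finiteDimensional_of_le
    (show (A.orth : Submodule ℂ Poly) ≤ (bideg p q : Submodule ℂ Poly) from
      fun _ hf => (A.mem_orth.1 hf).1)

/-- The bihomogeneous polynomials orthogonal to the representation vanish on the cone. -/
theorem chart_eq_zero {f : Poly} (hf : f ∈ A.orth) : chart f = 0 := by
  by_contra hne
  let chartOrth : A.orth →ₗ[ℂ] Laurent := chart.toLinearMap ∘ₗ (A.orth : Submodule ℂ Poly).subtype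
  let K : LieSubmodule ℂ Sl3 A.orth :=
    { LinearMap.ker chartOrth with
      lie_mem := fun {y f} hf => lie_mem_of_forall_e (S := LinearMap.ker chartOrth)
        (fun i j => by
          have hf' : chart (f : Poly) = 0 := hf
          change chart ⁅e i j, (f : Poly)⁆ = 0
          rw [chart_lie_e, hf', map_zero]) y }
  have hK : ∀ g : A.orth, g ∈ K ↔ chart (g : Poly) = 0 := fun g => Iff.rfl
  have hnt : Nontrivial (A.orth ⧸ K) := by
    refine ⟨LieSubmodule.Quotient.mk ⟨f, hf⟩, 0, fun h => hne ?_⟩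
    exact (hK ⟨f, hf⟩).1 ((LieSubmodule.Quotient.mk_eq_zero' (N := K)).1 h)
  have : FiniteDimensional ℂ (A.orth ⧸ K) :=
    inferInstanceAs (FiniteDimensional ℂ (A.orth ⧸ K.toSubmodule))
  -- The quotient is the image of the orthogonal complement in the chart. A lift `g` of a vector
  -- killed by the raising operators need not be killed itself, but its chart image is.
  obtain ⟨x, hx, hxe⟩ := exists_raising_eq_zero (A.orth ⧸ K)
  obtain ⟨g, rfl⟩ := LieSubmodule.Quotient.surjective_mk' K x
  have hg : chart (g : Poly) ≠ 0 := fun h => hx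
    ((LieSubmodule.Quotient.mk_eq_zero (N := K)).2 ((hK g).2 h))
  have hraise : ∀ i j : Fin 3, i < j → chartDer i j (chart (g : Poly)) = 0 := fun i j hij => by
    have h1 := hxe i j hij
    rw [← LieModuleHom.map_lie] at h1
    have h2 := (hK _).1 ((LieSubmodule.Quotient.mk_eq_zero (N := K)).1 h1)
    rw [← chart_lie_e]; exact h2
  obtain ⟨hgb, hgo⟩ := A.mem_orth.1 g.2
  obtain ⟨⟨a, b, c, d, k⟩, hu⟩ : ∃ u, (chart (g : Poly)).coeff u ≠ 0 := by
    by_contra h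
    push Not at h
    exact hg (by ext u; simpa using h u)
  obtain ⟨rfl, rfl, rfl⟩ := exponents_of_raising hraise hu
  have hp := congrArg (fun x => x.coeff ((a, 0, 0, d, 0) : Expo))
    (chart_wder (Or.inl ⟨rfl, rfl⟩) (g : Poly))
  have hq := congrArg (fun x => x.coeff ((a, 0, 0, d, 0) : Expo))
    (chart_wder (Or.inr (Or.inl ⟨rfl, rfl⟩)) (g : Poly))
  simp only [hgb.1, hgb.2, map_smul, coeff_eul, AddMonoidAlgebra.coeff_smul_apply, smul_eq_mul,
    mul_eq_mul_right_iff, hu, or_false, AddMonoidHom.add_apply, expA_apply, expB_apply,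
    expC_apply, expD_apply, expK_apply, Int.cast_zero, add_zero, zero_add] at hp hq
  have ha : a = p := by exact_mod_cast hp.symm
  have hd : d = q := by exact_mod_cast hq.symm
  subst ha hd
  -- The surviving monomial is `y₀^p η₂^q`, and its coefficient is up to a factorial the Fischer
  -- product of `g` with the highest-weight vector. It vanishes because `g` is orthogonal to the
  -- representation.
  rw [coeff_chart hgb] at hu
  have h0 := hgo A.v
  rw [A.ι_v, hwPoly_eq_monomial, fischer_monomial, map_one, one_mul] at h0
  exact (mul_ne_zero (multiFactorial_ne_zero _) hu) h0

/-- The difference between `f` and its orthogonal projection lies in the complement, which vanishes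
on the cone. So projecting to the irreducible representation is invisible in the chart. -/
theorem chart_ι_π [LieModule.IsIrreducible ℂ Sl3 V] {f : Poly} (hf : f ∈ bideg p q) :
    chart (A.ι (A.π f)) = chart f := by
  have h : f - A.ι (A.π f) ∈ A.orth := by
    refine A.mem_orth.2 ⟨sub_mem hf (A.ι_mem _), fun x => ?_⟩
    rw [fischer_sub_right, ← A.inner_eq, A.inner_π, sub_self]
  have h1 := A.chart_eq_zero h
  rw [map_sub, sub_eq_zero] at h1
  exact h1.symm

/-- The representation as Laurent polynomials. -/
def J : V →ₗ[ℂ] Laurent := chart.toLinearMap ∘ₗ A.ι.toLinearMap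

theorem J_apply (x : V) : A.J x = chart (A.ι x) := rfl

theorem J_lie (i j : Fin 3) (x : V) : A.J ⁅e i j, x⁆ = chartDer i j (A.J x) := by
  rw [J_apply, J_apply, LieModuleHom.map_lie, chart_lie_e]

/-- The kernel is a subrepresentation, and it does not contain the highest-weight vector, whose
image is a monomial. -/
theorem J_injective [LieModule.IsIrreducible ℂ Sl3 V] : Function.Injective A.J := by
  let K : LieSubmodule ℂ Sl3 V :=
    { LinearMap.ker A.J with
      lie_mem := fun {y x} hx => lie_mem_of_forall_e (S := LinearMap.ker A.J) (fun i j => by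
        have hx' : A.J x = 0 := hx
        rw [LinearMap.mem_ker, J_lie, hx', map_zero]) y }
  have hK : K = ⊥ := by
    refine (eq_bot_or_eq_top K).resolve_right fun h => ?_
    have hv : A.v ∈ K := by rw [h]; exact LieSubmodule.mem_top _
    have hv' : A.J A.v = 0 := hv
    rw [J_apply, A.ι_v, chart_hwPoly] at hv'
    have := congrArg (fun x => x.coeff ((p, 0, 0, q, 0) : Expo)) hv'
    simp [coeff_mon] at this
  rw [← LinearMap.ker_eq_bot, eq_bot_iff]
  intro x hx
  have : x ∈ K := hx
  rw [hK] at this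
  simpa using this

end Model
end Model
end MissingLabel
end

noncomputable section

namespace MissingLabel

/-! ### Invariance of the polarised traces -/

section Tensor

variable {A : Type*} [Ring A]

/-- A family of elements which transforms under the commutator with `x` as the generators
`e_{rs}` transform under `e_{pq}`. -/
def IsTens (x : A) (p q : Fin 3) (F : Fin 3 → Fin 3 → A) : Prop :=
  ∀ r s, x * F r s - F r s * x = (if q = r then F p s else 0) - (if s = p then F r q else 0)

variable {x : A} {p q : Fin 3} {F G : Fin 3 → Fin 3 → A}

/-- By the Leibniz rule for the commutator the two contributions of the contracted index cancel.
Iterating this and taking the trace produces the invariance of `T̄`; the variant `IsTens.mul'`, with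
the contraction in the other order, serves `T`. -/
theorem IsTens.mul (hF : IsTens x p q F) (hG : IsTens x p q G) :
    IsTens x p q fun r s => ∑ t, F r t * G t s := by
  intro r s
  have h : ∀ t, x * (F r t * G t s) - F r t * G t s * x =
      (x * F r t - F r t * x) * G t s + F r t * (x * G t s - G t s * x) := fun t => by noncomm_ring
  rw [Finset.mul_sum, Finset.sum_mul, ← Finset.sum_sub_distrib]
  simp only [h, hF r _, hG _ s, sub_mul, mul_sub, Finset.sum_add_distrib, Finset.sum_sub_distrib,
    ite_mul, mul_ite, zero_mul, mul_zero, Finset.sum_ite_eq, Finset.sum_ite_eq', Finset.mem_univ,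
    if_true]
  split_ifs <;> simp <;> abel

theorem IsTens.mul' (hF : IsTens x p q F) (hG : IsTens x p q G) :
    IsTens x p q fun r s => ∑ t, F t s * G r t := by
  intro r s
  have h : ∀ t, x * (F t s * G r t) - F t s * G r t * x =
      (x * F t s - F t s * x) * G r t + F t s * (x * G r t - G r t * x) := fun t => by noncomm_ring
  rw [Finset.mul_sum, Finset.sum_mul, ← Finset.sum_sub_distrib]
  simp only [h, hF _ s, hG r _, sub_mul, mul_sub, Finset.sum_add_distrib, Finset.sum_sub_distrib,
    ite_mul, mul_ite, zero_mul, mul_zero, Finset.sum_ite_eq, Finset.sum_ite_eq', Finset.mem_univ,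
    if_true]
  split_ifs <;> simp <;> abel

theorem IsTens.commute_trace (hF : IsTens x p q F) : Commute x (∑ r, F r r) := by
  rw [Commute, SemiconjBy, ← sub_eq_zero, Finset.mul_sum, Finset.sum_mul, ← Finset.sum_sub_distrib]
  simp [hF _ _, Finset.sum_sub_distrib]

theorem sum_trace_three (F G H : Fin 3 → Fin 3 → A) :
    ∑ i, ∑ j, ∑ k, F i j * G j k * H k i = ∑ i, ∑ k, (∑ j, F i j * G j k) * H k i := by
  refine Finset.sum_congr rfl fun i _ => ?_
  rw [Finset.sum_comm]
  simp only [Finset.sum_mul]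

theorem sum_trace_four (F G H K : Fin 3 → Fin 3 → A) :
    ∑ i, ∑ j, ∑ k, ∑ s, F i j * G j k * H k s * K s i =
      ∑ i, ∑ s, (∑ k, (∑ j, F i j * G j k) * H k s) * K s i := by
  refine Finset.sum_congr rfl fun i _ => ?_
  simp only [Finset.sum_mul]
  rw [Finset.sum_comm]
  conv_rhs => rw [Finset.sum_comm]
  exact Finset.sum_congr rfl fun k _ => Finset.sum_comm

end Tensor

section Traces

theorem sum_fin_succ_pi {α β : Type*} [Fintype α] [AddCommMonoid β] {n : ℕ}
    (f : (Fin (n + 1) → α) → β) : ∑ i, f i = ∑ a, ∑ i : Fin n → α, f (Fin.cons a i) := by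
  rw [← Fintype.sum_prod_type', ← (Fin.consEquiv fun _ => α).sum_comp]
  rfl

theorem T_two (a b : Fin 2) : T ![a, b] = ∑ i, ∑ j, eLeg a j i * eLeg b i j := by
  simp [T, sum_fin_succ_pi, List.ofFn_succ]

theorem T_three (a b c : Fin 2) :
    T ![a, b, c] = ∑ i, ∑ j, ∑ k, eLeg a j i * eLeg b k j * eLeg c i k := by
  simp [T, sum_fin_succ_pi, List.ofFn_succ, mul_assoc]
  rfl

theorem T_four (a b c d : Fin 2) : T ![a, b, c, d] =
    ∑ i, ∑ j, ∑ k, ∑ s, eLeg a j i * eLeg b k j * eLeg c s k * eLeg d i s := by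
  simp [T, sum_fin_succ_pi, List.ofFn_succ, mul_assoc]
  rfl

theorem Tbar_four (a b c d : Fin 2) : Tbar ![a, b, c, d] =
    ∑ i, ∑ j, ∑ k, ∑ s, eLeg a i j * eLeg b j k * eLeg c k s * eLeg d s i := by
  simp [Tbar, sum_fin_succ_pi, List.ofFn_succ, mul_assoc]
  rfl

theorem eU_commutator (p q r s : Fin 3) : eU p q * eU r s - eU r s * eU p q =
    (if q = r then eU p s else 0) - (if s = p then eU r q else 0) := by
  let _ : LieRing U := LieRing.ofAssociativeRing
  have h : UniversalEnvelopingAlgebra.ι ℂ ⁅e p q, e r s⁆ = eU p q * eU r s - eU r s * eU p q :=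
    LieHom.map_lie _ _ _
  rw [← h, lie_e, map_sub]
  split_ifs <;> simp [eU]

theorem leg_commute (x y : U) : Commute (leg 0 x) (leg 1 y) := by
  simp [leg, Commute, SemiconjBy]

theorem eLeg_comm (p q r s : Fin 3) : eLeg 1 r s * eLeg 0 p q = eLeg 0 p q * eLeg 1 r s :=
  (leg_commute _ _).eq.symm

theorem eLeg_commutator (a : Fin 2) (p q r s : Fin 3) :
    eLeg a p q * eLeg a r s - eLeg a r s * eLeg a p q =
      (if q = r then eLeg a p s else 0) - (if s = p then eLeg a r q else 0) := by
  have h := congrArg (leg a) (eU_commutator p q r s)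
  simp only [map_sub, map_mul, apply_ite (leg a), map_zero] at h
  exact h

/-- The diagonal embedding of the generators. -/
def eDiag (p q : Fin 3) : U ⊗[ℂ] U := eLeg 0 p q + eLeg 1 p q

theorem isTens_eLeg (a : Fin 2) (p q : Fin 3) : IsTens (eDiag p q) p q (eLeg a) := by
  intro r s
  have h := eLeg_commutator a p q r s
  fin_cases a
  · have h2 := eLeg_comm r s p q
    simp only [Fin.zero_eta, Fin.isValue, eDiag, add_mul, mul_add] at h ⊢
    rw [← h, h2]; abel
  · have h2 := eLeg_comm p q r s
    simp only [Fin.mk_one, Fin.isValue, eDiag, add_mul, mul_add] at h ⊢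
    rw [← h, h2]; abel

theorem mem_centraliser_iff {z : U ⊗[ℂ] U} :
    z ∈ centraliser ↔ ∀ p q, Commute (eDiag p q) z := by
  rw [centraliser, Subalgebra.mem_centralizer_iff]
  constructor
  · exact fun h p q => h _ ⟨(p, q), rfl⟩
  · rintro h _ ⟨⟨p, q⟩, rfl⟩
    exact h p q

theorem T_two_mem (a b : Fin 2) : T ![a, b] ∈ centraliser := mem_centraliser_iff.2 fun p q => by
  have h := ((isTens_eLeg a p q).mul' (isTens_eLeg b p q)).commute_trace
  rwa [T_two]

theorem T_three_mem (a b c : Fin 2) : T ![a, b, c] ∈ centraliser :=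
  mem_centraliser_iff.2 fun p q => by
    have h := (((isTens_eLeg a p q).mul' (isTens_eLeg b p q)).mul'
      (isTens_eLeg c p q)).commute_trace
    rw [T_three, sum_trace_three (fun i j => eLeg a j i) (fun j k => eLeg b k j)
      (fun k i => eLeg c i k)]
    exact h

theorem T_four_mem (a b c d : Fin 2) : T ![a, b, c, d] ∈ centraliser :=
  mem_centraliser_iff.2 fun p q => by
    have h := ((((isTens_eLeg a p q).mul' (isTens_eLeg b p q)).mul'
      (isTens_eLeg c p q)).mul' (isTens_eLeg d p q)).commute_trace
    rw [T_four, sum_trace_four (fun i j => eLeg a j i) (fun j k => eLeg b k j)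
      (fun k s => eLeg c s k) (fun s i => eLeg d i s)]
    exact h

theorem Tbar_four_mem (a b c d : Fin 2) : Tbar ![a, b, c, d] ∈ centraliser :=
  mem_centraliser_iff.2 fun p q => by
    have h := ((((isTens_eLeg a p q).mul (isTens_eLeg b p q)).mul
      (isTens_eLeg c p q)).mul (isTens_eLeg d p q)).commute_trace
    rw [Tbar_four, sum_trace_four]
    exact h

theorem isTens_eU (p q : Fin 3) : IsTens (eU p q) p q eU := eU_commutator p q

theorem eU_commute_casimirL (p q : Fin 3) : Commute (eU p q) casimirL := by
  have h := (((isTens_eU p q).mul (isTens_eU p q)).mul (isTens_eU p q)).commute_trace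
  have h' := (((isTens_eU p q).mul' (isTens_eU p q)).mul' (isTens_eU p q)).commute_trace
  rw [casimirL]
  refine Commute.smul_right ?_ _
  simp only [Finset.sum_add_distrib]
  rw [sum_trace_three, sum_trace_three (fun i j => eU j i) (fun j k => eU k j) (fun k i => eU i k)]
  exact h.add_right h'

theorem eU_commute_casimir (p q : Fin 3) :
    Commute (eU p q) (∑ i, ∑ j, eU j i * eU i j) :=
  ((isTens_eU p q).mul' (isTens_eU p q)).commute_trace

theorem leg_casimirL_mem (a : Fin 2) : leg a casimirL ∈ centraliser :=
  mem_centraliser_iff.2 fun p q => by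
    have h := (eU_commute_casimirL p q).map (leg a)
    fin_cases a
    · exact h.add_left (leg_commute casimirL (eU p q)).symm
    · exact (leg_commute (eU p q) casimirL).add_left h

theorem X_mem_centraliser : X ∈ centraliser :=
  add_mem (Subalgebra.smul_mem _ (sub_mem (T_three_mem _ _ _) (T_three_mem _ _ _)) _)
    (Subalgebra.smul_mem _ (sub_mem (leg_casimirL_mem 0) (leg_casimirL_mem 1)) _)

theorem Y_mem_centraliser : Y ∈ centraliser :=
  sub_mem (sub_mem (sub_mem
    (Subalgebra.smul_mem _ (add_mem (T_four_mem _ _ _ _) (Tbar_four_mem _ _ _ _)) _)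
    (Subalgebra.smul_mem _ (pow_mem (T_two_mem _ _) 2) _))
    (Subalgebra.smul_mem _ (mul_mem (T_two_mem _ _) (T_two_mem _ _)) _))
    (Subalgebra.smul_mem _ (T_two_mem _ _) _)

end Traces

/-! ### Casimir elements -/

section Casimir

variable {M : Type*} [AddCommGroup M] [Module ℂ M] [LieRingModule Sl3 M] [LieModule ℂ Sl3 M]

theorem lie_e_lie_e (a b c d : Fin 3) (x : M) : ⁅e a b, ⁅e c d, x⁆⁆ = ⁅e c d, ⁅e a b, x⁆⁆ +
    ((if b = c then ⁅e a d, x⁆ else 0) - (if d = a then ⁅e c b, x⁆ else 0)) := by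
  rw [leibniz_lie, lie_e, sub_lie, add_comm]
  split_ifs <;> simp

/-- The action of the enveloping algebra. -/
def actU (M : Type*) [AddCommGroup M] [Module ℂ M] [LieRingModule Sl3 M] [LieModule ℂ Sl3 M] :
    U →ₐ[ℂ] Module.End ℂ M :=
  UniversalEnvelopingAlgebra.lift ℂ (LieModule.toEnd ℂ Sl3 M)

theorem actU_eU (p q : Fin 3) (x : M) : actU M (eU p q) x = ⁅e p q, x⁆ := by
  rw [actU, eU, UniversalEnvelopingAlgebra.lift_ι_apply]
  rfl

-- Raising operators are commuted to the right until they meet `v`; only products of diagonal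
-- generators and commutator terms remain.
set_option maxHeartbeats 1000000 in
theorem actU_casimirL_of_mem {a b : ℕ} {v : M} (hv : v ∈ highestWeightSpace M a b) :
    actU M casimirL v = casimirLValue a b • v := by
  obtain ⟨h1, h2⟩ := mem_highestWeightSpace_iff.1 hv
  have h01 := h2 0 1 (by decide)
  have h02 := h2 0 2 (by decide)
  have h12 := h2 1 2 (by decide)
  simp only [casimirL, Fin.sum_univ_three, map_smul, map_add, map_mul, LinearMap.smul_apply,
    LinearMap.add_apply, Module.End.mul_apply, actU_eU, h1, h01, h02, h12, lie_zero]
  simp only [lie_e_lie_e 0 1 1 0, lie_e_lie_e 0 1 2 0,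
    lie_e_lie_e 0 2 1 0, lie_e_lie_e 0 2 2 0, lie_e_lie_e 0 2 2 1,
    lie_e_lie_e 1 2 2 0, lie_e_lie_e 1 2 2 1,
    lie_e_lie_e 0 0 1 0, lie_e_lie_e 0 0 2 0, lie_e_lie_e 0 0 2 1,
    lie_e_lie_e 1 1 1 0, lie_e_lie_e 1 1 2 1,
    lie_e_lie_e 2 2 1 0, lie_e_lie_e 2 2 2 0, lie_e_lie_e 2 2 2 1, Fin.isValue,
    Fin.reduceEq, if_true, if_false, h1, h01, h02, h12, lie_zero, lie_smul, lie_add, lie_sub,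
    add_zero, zero_add, sub_zero, zero_sub, lie_neg, smul_zero]
  simp only [wt, casimirLValue, Fin.isValue, Fin.reduceEq, if_true, if_false]
  match_scalars
  ring

theorem actU_casimir_of_mem {a b : ℕ} {v : M} (hv : v ∈ highestWeightSpace M a b) :
    actU M (∑ i, ∑ j, eU j i * eU i j) v = casimirValue a b • v := by
  obtain ⟨h1, h2⟩ := mem_highestWeightSpace_iff.1 hv
  have h01 := h2 0 1 (by decide)
  have h02 := h2 0 2 (by decide)
  have h12 := h2 1 2 (by decide)
  simp only [Fin.sum_univ_three, map_add, map_mul,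
    LinearMap.add_apply, Module.End.mul_apply, actU_eU, h1, h01, h02, h12, lie_zero, lie_smul]
  simp only [lie_e_lie_e 0 1 1 0, lie_e_lie_e 0 2 2 0, lie_e_lie_e 1 2 2 1, Fin.isValue,
    Fin.reduceEq, if_true, if_false, h1, h01, h02, h12, lie_zero,
    add_zero, zero_add, sub_zero, zero_sub]
  simp only [wt, casimirValue, Fin.isValue, Fin.reduceEq, if_true, if_false]
  match_scalars
  ring

/-- Schur's lemma in elementary form: the eigenspace of a central element is a subrepresentation
containing a non-zero highest-weight vector. -/
theorem actU_eq_smul {a b : ℕ} (hM : IsIrrep M a b) {z : U} (hz : ∀ p q, Commute (eU p q) z)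
    {c : ℂ} (hc : ∀ v ∈ highestWeightSpace M a b, actU M z v = c • v) (x : M) :
    actU M z x = c • x := by
  obtain ⟨v, hv, hv0⟩ := hM.exists_highestWeight
  have := hM.irreducible
  let S : Submodule ℂ M := (actU M z).eigenspace c
  let N : LieSubmodule ℂ Sl3 M :=
    { S with
      lie_mem := fun {y x} hx => lie_mem_of_forall_e (S := S) (fun p q => by
        have hx' : actU M z x = c • x := Module.End.mem_eigenspace_iff.1 hx
        have h := congrArg (fun f => actU M f x) (hz p q).eq
        simp only [map_mul, Module.End.mul_apply, actU_eU, hx'] at h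
        rw [Module.End.mem_eigenspace_iff, ← h, lie_smul]) y }
  have hN : LieSubmodule.lieSpan ℂ Sl3 {v} ≤ N :=
    LieSubmodule.lieSpan_le.2 (Set.singleton_subset_iff.2
      (Module.End.mem_eigenspace_iff.2 (hc v hv)))
  rw [lieSpan_eq_top hv0] at hN
  exact Module.End.mem_eigenspace_iff.1 (hN (LieSubmodule.mem_top x))

end Casimir
end MissingLabel
end

noncomputable section

namespace MissingLabel

/-! ### The leading component of a highest-weight vector of a tensor product -/

section ActLeg

variable {V W : Type*} [AddCommGroup V] [Module ℂ V] [LieRingModule Sl3 V] [LieModule ℂ Sl3 V]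
  [AddCommGroup W] [Module ℂ W] [LieRingModule Sl3 W] [LieModule ℂ Sl3 W]

theorem lie_eq_act (i j : Fin 3) (t : V ⊗[ℂ] W) :
    ⁅e i j, t⁆ = act V W (eLeg 0 i j) t + act V W (eLeg 1 i j) t := by
  induction t with
  | zero => simp
  | tmul v w => rw [act_eLeg_tmul, act_eLeg_tmul]; simp [TensorProduct.LieModule.lie_tmul_right]
  | add s t hs ht => rw [lie_add, hs, ht, map_add, map_add]; abel

theorem act_eDiag (i j : Fin 3) (t : V ⊗[ℂ] W) : act V W (eDiag i j) t = ⁅e i j, t⁆ := by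
  rw [eDiag, map_add, LinearMap.add_apply, lie_eq_act]

theorem act_leg_tmul (a : Fin 2) (z : U) (v : V) (w : W) :
    act V W (leg a z) (v ⊗ₜ w) = if a = 0 then actU V z v ⊗ₜ w else v ⊗ₜ actU W z w := by
  fin_cases a <;> simp [act, leg, actU, Module.endTensorEndAlgHom_apply]

theorem act_leg_zero_eq_smul {z : U} {c : ℂ} (hz : ∀ v : V, actU V z v = c • v) (t : V ⊗[ℂ] W) :
    act V W (leg 0 z) t = c • t := by
  induction t with
  | zero => simp
  | tmul v w => rw [act_leg_tmul, if_pos rfl, hz, TensorProduct.smul_tmul']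
  | add s t hs ht => rw [map_add, hs, ht, smul_add]

theorem act_leg_one_eq_smul {z : U} {c : ℂ} (hz : ∀ w : W, actU W z w = c • w) (t : V ⊗[ℂ] W) :
    act V W (leg 1 z) t = c • t := by
  induction t with
  | zero => simp
  | tmul v w => rw [act_leg_tmul, if_neg one_ne_zero, hz, TensorProduct.tmul_smul]
  | add s t hs ht => rw [map_add, hs, ht, smul_add]

theorem lie_act_of_mem {z : U ⊗[ℂ] U} (hz : z ∈ centraliser) (i j : Fin 3) (t : V ⊗[ℂ] W) :
    ⁅e i j, act V W z t⁆ = act V W z ⁅e i j, t⁆ := by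
  rw [← act_eDiag, ← act_eDiag, ← Module.End.mul_apply, ← Module.End.mul_apply, ← map_mul,
    ← map_mul, (mem_centraliser_iff.1 hz i j).eq]

theorem act_mem_highestWeightSpace {z : U ⊗[ℂ] U} (hz : z ∈ centraliser) {a b : ℕ}
    {t : V ⊗[ℂ] W} (ht : t ∈ highestWeightSpace (V ⊗[ℂ] W) a b) :
    act V W z t ∈ highestWeightSpace (V ⊗[ℂ] W) a b := by
  rw [mem_highestWeightSpace_iff] at ht ⊢
  refine ⟨fun p => ?_, fun p q hpq => ?_⟩
  · rw [lie_act_of_mem hz, ht.1, map_smul]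
  · rw [lie_act_of_mem hz, ht.2 p q hpq, map_zero]

theorem T_two_same (a : Fin 2) : T ![a, a] = leg a (∑ i, ∑ j, eU j i * eU i j) := by
  simp [T_two, eLeg]

end ActLeg

section Leading

variable {V W : Type*} [NormedAddCommGroup V] [InnerProductSpace ℂ V] [LieRingModule Sl3 V]
  [LieModule ℂ Sl3 V] [NormedAddCommGroup W] [InnerProductSpace ℂ W] [LieRingModule Sl3 W]
  [LieModule ℂ Sl3 W] {p q p' q' : ℕ}

/-- Contraction of the first tensor factor with a vector. -/
def contract (W : Type*) [NormedAddCommGroup W] [InnerProductSpace ℂ W] (x : V) :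
    V ⊗[ℂ] W →ₗ[ℂ] W :=
  (TensorProduct.lid ℂ W).toLinearMap ∘ₗ LinearMap.rTensor W (innerₛₗ ℂ x)

theorem contract_tmul (x v : V) (w : W) : contract W x (v ⊗ₜ w) = inner ℂ x v • w := by
  simp [contract]

theorem inner_tmul_left (x : V) (y : W) (t : V ⊗[ℂ] W) :
    inner ℂ (x ⊗ₜ[ℂ] y) t = inner ℂ y (contract W x t) := by
  induction t with
  | zero => simp
  | tmul v w => rw [TensorProduct.inner_tmul, contract_tmul, inner_smul_right]
  | add s t hs ht => rw [inner_add_right, map_add, inner_add_right, hs, ht]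

theorem contract_add_left (x y : V) (t : V ⊗[ℂ] W) :
    contract W (x + y) t = contract W x t + contract W y t := by
  induction t with
  | zero => simp
  | tmul v w => simp [contract_tmul, add_smul]
  | add s t hs ht => rw [map_add, hs, ht, map_add, map_add]; abel

theorem contract_smul_left (c : ℂ) (x : V) (t : V ⊗[ℂ] W) :
    contract W (c • x) t = (starRingEnd ℂ c) • contract W x t := by
  induction t with
  | zero => simp
  | tmul v w => rw [contract_tmul, contract_tmul, inner_smul_left, mul_smul]
  | add s t hs ht => rw [map_add, hs, ht, map_add, smul_add]

theorem contract_zero_left (t : V ⊗[ℂ] W) : contract W (0 : V) t = 0 := by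
  simpa using contract_smul_left 0 (0 : V) t

theorem contract_eLeg_one (x : V) (i j : Fin 3) (t : V ⊗[ℂ] W) :
    contract W x (act V W (eLeg 1 i j) t) = ⁅e i j, contract W x t⁆ := by
  induction t with
  | zero => simp
  | tmul v w => rw [act_eLeg_tmul, if_neg one_ne_zero, contract_tmul, contract_tmul, lie_smul]
  | add s t hs ht => rw [map_add, map_add, hs, ht, map_add, lie_add]

theorem conj_wt (a b : ℕ) (i : Fin 3) : starRingEnd ℂ (wt a b i) = wt a b i := by
  simp only [wt, map_sub, map_div₀, map_add, map_mul, Complex.conj_ofNat, map_one,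
    Complex.conj_natCast, apply_ite (starRingEnd ℂ), map_zero]

namespace Model

/-- By invariance of the inner product, a generator acting on the first factor moves, transposed, to
the vector used for the contraction. -/
theorem contract_eLeg_zero (A : Model V p q) (x : V) (i j : Fin 3) (t : V ⊗[ℂ] W) :
    contract W x (act V W (eLeg 0 i j) t) = contract W ⁅e j i, x⁆ t := by
  induction t with
  | zero => simp
  | tmul v w => rw [act_eLeg_tmul, if_pos rfl, contract_tmul, contract_tmul, A.inner_lie]
  | add s t hs ht => rw [map_add, map_add, hs, ht, map_add]

/-- The action on `u` is the sum of the actions on the two factors. When it vanishes, lowering the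
contracting vector can be traded for raising in `W`; so contraction with `v` determines all other
contractions. -/
theorem contract_lie_of_raising (A : Model V p q) {u : V ⊗[ℂ] W} {i j : Fin 3} (hu : ⁅e i j, u⁆ = 0) (x : V) :
    contract W ⁅e j i, x⁆ u = - ⁅e i j, contract W x u⁆ := by
  have h := congrArg (contract W x) hu
  rw [lie_eq_act, map_add, A.contract_eLeg_zero, contract_eLeg_one, map_zero] at h
  exact eq_neg_of_add_eq_zero_left h

variable [FiniteDimensional ℂ W] (A : Model V p q) (B : Model W p' q')

/-- The component of a tensor along the highest-weight vector of the first factor, as a Laurent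
polynomial. -/
def lead : V ⊗[ℂ] W →ₗ[ℂ] Laurent := B.J ∘ₗ contract W A.v

theorem lead_apply (t : V ⊗[ℂ] W) : A.lead B t = B.J (contract W A.v t) := rfl

theorem lead_eLeg_one (i j : Fin 3) (t : V ⊗[ℂ] W) :
    A.lead B (act V W (eLeg 1 i j) t) = chartOp i j (A.lead B t) := by
  rw [lead_apply, contract_eLeg_one, B.J_lie]; rfl

theorem lead_eLeg_zero_self (i : Fin 3) (t : V ⊗[ℂ] W) :
    A.lead B (act V W (eLeg 0 i i) t) = wt (p + 1 : ℕ) (q + 1 : ℕ) i • A.lead B t := by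
  rw [lead_apply, A.contract_eLeg_zero, (mem_highestWeightSpace_iff.1 A.v_mem).1,
    contract_smul_left, conj_wt, map_smul]; rfl

theorem lead_eLeg_zero_lowering {i j : Fin 3} (hij : j < i) (t : V ⊗[ℂ] W) :
    A.lead B (act V W (eLeg 0 i j) t) = 0 := by
  rw [lead_apply, A.contract_eLeg_zero, (mem_highestWeightSpace_iff.1 A.v_mem).2 j i hij,
    contract_zero_left, map_zero]

section Raising

variable {u : V ⊗[ℂ] W}

theorem act_eLeg_zero_raising
    (hu : ∀ i j : Fin 3, i < j → ⁅e i j, u⁆ = 0) {i j : Fin 3} (hij : i < j) :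
    act V W (eLeg 0 i j) u = - act V W (eLeg 1 i j) u := by
  have h := hu i j hij
  rw [lie_eq_act] at h
  exact eq_neg_of_add_eq_zero_left h

/-- This is the elimination of the first factor: raising generators pass to the second factor with a
sign, diagonal ones act by the weight of `v`, and lowering ones disappear since their adjoints raise
`v`. -/
theorem lead_eLeg_zero
    (hu : ∀ i j : Fin 3, i < j → ⁅e i j, u⁆ = 0) (i j : Fin 3) : A.lead B (act V W (eLeg 0 i j) u) =
    opA chartOp (wt (p + 1 : ℕ) (q + 1 : ℕ)) i j (A.lead B u) := by
  rw [opA]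
  rcases lt_trichotomy i j with h | rfl | h
  · rw [if_pos h, act_eLeg_zero_raising hu h, map_neg, lead_eLeg_one]; rfl
  · rw [if_neg (lt_irrefl _), if_pos rfl, lead_eLeg_zero_self]; rfl
  · rw [if_neg h.not_gt, if_neg h.ne', lead_eLeg_zero_lowering A B h]; rfl

/-- The vector `e_{rs}^{(1)} u` is in general not killed by raising operators, so `e_{ij}^{(1)}` is
first commuted to the right, replaced by `-e_{ij}^{(2)}` on `u`, and the latter commuted back. The
bracket in the first factor is the correction term. -/
theorem act_eLeg_zero_zero_raising
    (hu : ∀ i j : Fin 3, i < j → ⁅e i j, u⁆ = 0) {i j : Fin 3} (hij : i < j) (r s : Fin 3) :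
    act V W (eLeg 0 i j) (act V W (eLeg 0 r s) u) =
      - act V W (eLeg 1 i j) (act V W (eLeg 0 r s) u)
        + ((if j = r then act V W (eLeg 0 i s) u else 0)
          - (if s = i then act V W (eLeg 0 r j) u else 0)) := by
  have h1 := congrArg (fun z => act V W z u) (sub_eq_iff_eq_add'.1 (eLeg_commutator 0 i j r s))
  have h2 := congrArg (fun z => act V W z u) (eLeg_comm r s i j)
  simp only [map_add, map_sub, map_mul, LinearMap.add_apply, LinearMap.sub_apply,
    Module.End.mul_apply, act_eLeg_zero_raising hu hij, map_neg] at h1 h2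
  rw [h2, h1]
  split_ifs <;> simp

theorem lead_opAA
    (hu : ∀ i j : Fin 3, i < j → ⁅e i j, u⁆ = 0) (k j i : Fin 3) :
    A.lead B (act V W (eLeg 0 j i) (act V W (eLeg 0 k j) u)) =
      opAA chartOp (wt (p + 1 : ℕ) (q + 1 : ℕ)) k j i (A.lead B u) := by
  rw [opAA]
  rcases lt_trichotomy j i with h | rfl | h
  · rw [if_pos h, act_eLeg_zero_zero_raising hu h, if_pos rfl, map_add, map_neg, lead_eLeg_one,
      map_sub, A.lead_eLeg_zero B hu, A.lead_eLeg_zero B hu]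
    split_ifs with h1
    · rw [lead_eLeg_zero_self]
      simp only [LinearMap.add_apply, LinearMap.sub_apply, LinearMap.neg_apply,
        Module.End.mul_apply, LinearMap.smul_apply, Module.End.one_apply]
      abel
    · simp only [LinearMap.add_apply, LinearMap.sub_apply, LinearMap.neg_apply,
        Module.End.mul_apply, LinearMap.zero_apply, map_zero]
      abel
  · rw [if_neg (lt_irrefl _), if_pos rfl, lead_eLeg_zero_self, A.lead_eLeg_zero B hu]; rfl
  · rw [if_neg h.not_gt, if_neg h.ne', lead_eLeg_zero_lowering A B h]; rfl

theorem lead_opAAbar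
    (hu : ∀ i j : Fin 3, i < j → ⁅e i j, u⁆ = 0) (i j k : Fin 3) :
    A.lead B (act V W (eLeg 0 i j) (act V W (eLeg 0 j k) u)) =
      opAAbar chartOp (wt (p + 1 : ℕ) (q + 1 : ℕ)) i j k (A.lead B u) := by
  rw [opAAbar]
  rcases lt_trichotomy i j with h | rfl | h
  · rw [if_pos h, act_eLeg_zero_zero_raising hu h, if_pos rfl, map_add, map_neg, lead_eLeg_one,
      map_sub, A.lead_eLeg_zero B hu, A.lead_eLeg_zero B hu]
    simp only [eq_comm (a := k)]
    split_ifs with h1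
    · rw [lead_eLeg_zero_self]
      simp only [LinearMap.add_apply, LinearMap.sub_apply, LinearMap.neg_apply,
        Module.End.mul_apply, LinearMap.smul_apply, Module.End.one_apply]
      abel
    · simp only [LinearMap.add_apply, LinearMap.sub_apply, LinearMap.neg_apply,
        Module.End.mul_apply, LinearMap.zero_apply, map_zero]
      abel
  · rw [if_neg (lt_irrefl _), if_pos rfl, lead_eLeg_zero_self, A.lead_eLeg_zero B hu]; rfl
  · rw [if_neg h.not_gt, if_neg h.ne', lead_eLeg_zero_lowering A B h]; rfl

/-- Generators of the two factors commute, so those of the second factor can be moved to the left,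
where they pass through the contraction as chart derivations. The longer traces are treated in the
same way. -/
theorem lead_T12
    (hu : ∀ i j : Fin 3, i < j → ⁅e i j, u⁆ = 0) : A.lead B (act V W (T ![0, 1]) u) =
    opT12 chartOp (wt (p + 1 : ℕ) (q + 1 : ℕ)) (A.lead B u) := by
  simp only [T_two, opT12, map_sum, LinearMap.sum_apply, ← eLeg_comm, map_mul,
    Module.End.mul_apply, lead_eLeg_one, A.lead_eLeg_zero B hu]

theorem lead_T112
    (hu : ∀ i j : Fin 3, i < j → ⁅e i j, u⁆ = 0) : A.lead B (act V W (T ![0, 0, 1]) u) =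
    opT112 chartOp (wt (p + 1 : ℕ) (q + 1 : ℕ)) (A.lead B u) := by
  have h : ∀ i j k, eLeg 0 j i * eLeg 0 k j * eLeg 1 i k =
      eLeg 1 i k * (eLeg 0 j i * eLeg 0 k j) := fun i j k => by
    rw [mul_assoc, ← eLeg_comm, ← mul_assoc, ← eLeg_comm, mul_assoc]
  simp only [T_three, h, opT112, map_sum, LinearMap.sum_apply, map_mul,
    Module.End.mul_apply, lead_eLeg_one, A.lead_opAA B hu]

theorem lead_T122
    (hu : ∀ i j : Fin 3, i < j → ⁅e i j, u⁆ = 0) : A.lead B (act V W (T ![0, 1, 1]) u) =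
    opT122 chartOp (wt (p + 1 : ℕ) (q + 1 : ℕ)) (A.lead B u) := by
  have h : ∀ i j k, eLeg 0 j i * eLeg 1 k j * eLeg 1 i k =
      eLeg 1 k j * (eLeg 1 i k * eLeg 0 j i) := fun i j k => by
    rw [← eLeg_comm, mul_assoc, ← eLeg_comm]
  simp only [T_three, h, opT122, map_sum, LinearMap.sum_apply, map_mul,
    Module.End.mul_apply, lead_eLeg_one, A.lead_eLeg_zero B hu]

theorem lead_T1122
    (hu : ∀ i j : Fin 3, i < j → ⁅e i j, u⁆ = 0) : A.lead B (act V W (T ![0, 0, 1, 1]) u) =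
    opT1122 chartOp (wt (p + 1 : ℕ) (q + 1 : ℕ)) (A.lead B u) := by
  have h : ∀ i j k s, eLeg 0 j i * eLeg 0 k j * eLeg 1 s k * eLeg 1 i s =
      eLeg 1 s k * (eLeg 1 i s * (eLeg 0 j i * eLeg 0 k j)) := fun i j k s => by
    have h1 : ∀ a b, Commute (eLeg 0 j i * eLeg 0 k j) (eLeg 1 a b) := fun a b =>
      (leg_commute _ _).mul_left (leg_commute _ _)
    rw [(h1 s k).eq, mul_assoc, (h1 i s).eq]
  simp only [T_four, h, opT1122, map_sum, LinearMap.sum_apply, map_mul,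
    Module.End.mul_apply, lead_eLeg_one, A.lead_opAA B hu]

theorem lead_Tbar1122
    (hu : ∀ i j : Fin 3, i < j → ⁅e i j, u⁆ = 0) : A.lead B (act V W (Tbar ![0, 0, 1, 1]) u) =
    opTbar1122 chartOp (wt (p + 1 : ℕ) (q + 1 : ℕ)) (A.lead B u) := by
  have h : ∀ i j k s, eLeg 0 i j * eLeg 0 j k * eLeg 1 k s * eLeg 1 s i =
      eLeg 1 k s * (eLeg 1 s i * (eLeg 0 i j * eLeg 0 j k)) := fun i j k s => by
    have h1 : ∀ a b, Commute (eLeg 0 i j * eLeg 0 j k) (eLeg 1 a b) := fun a b =>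
      (leg_commute _ _).mul_left (leg_commute _ _)
    rw [(h1 k s).eq, mul_assoc, (h1 s i).eq]
  simp only [Tbar_four, h, opTbar1122, map_sum, LinearMap.sum_apply, map_mul,
    Module.End.mul_apply, lead_eLeg_one, A.lead_opAAbar B hu]

theorem lead_X
    (hu : ∀ i j : Fin 3, i < j → ⁅e i j, u⁆ = 0) (hV : IsIrrep V (p + 1) (q + 1)) (hW : IsIrrep W (p' + 1) (q' + 1)) :
    A.lead B (act V W X u) = opX chartOp (wt (p + 1 : ℕ) (q + 1 : ℕ)) (p + 1 : ℕ) (q + 1 : ℕ)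
      (p' + 1 : ℕ) (q' + 1 : ℕ) (A.lead B u) := by
  have h0 := act_leg_zero_eq_smul (W := W)
    (actU_eq_smul hV eU_commute_casimirL fun v hv => actU_casimirL_of_mem hv)
  have h1 := act_leg_one_eq_smul (V := V)
    (actU_eq_smul hW eU_commute_casimirL fun v hv => actU_casimirL_of_mem hv)
  simp only [X, opX, map_add, map_sub, map_smul, LinearMap.add_apply, LinearMap.sub_apply,
    LinearMap.smul_apply, h0, h1, A.lead_T112 B hu, A.lead_T122 B hu, Module.End.one_apply,
    sub_smul]

theorem lead_Y
    (hu : ∀ i j : Fin 3, i < j → ⁅e i j, u⁆ = 0) (hV : IsIrrep V (p + 1) (q + 1)) (hW : IsIrrep W (p' + 1) (q' + 1)) :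
    A.lead B (act V W Y u) = opY chartOp (wt (p + 1 : ℕ) (q + 1 : ℕ)) (p + 1 : ℕ) (q + 1 : ℕ)
      (p' + 1 : ℕ) (q' + 1 : ℕ) (A.lead B u) := by
  have h0 := act_leg_zero_eq_smul (W := W)
    (actU_eq_smul hV eU_commute_casimir fun v hv => actU_casimir_of_mem hv)
  have h1 := act_leg_one_eq_smul (V := V)
    (actU_eq_smul hW eU_commute_casimir fun v hv => actU_casimir_of_mem hv)
  -- `T^{(1,2)} u` is again killed by the raising operators, so the reduction may be applied twice
  -- to the square.
  have h2 : ∀ i j : Fin 3, i < j → ⁅e i j, act V W (T ![0, 1]) u⁆ = 0 := fun i j hij => by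
    rw [lie_act_of_mem (T_two_mem 0 1), hu i j hij, map_zero]
  simp only [Y, opY, map_add, map_sub, map_smul, LinearMap.add_apply, LinearMap.sub_apply,
    LinearMap.smul_apply, map_mul, Module.End.mul_apply, T_two_same, h0, h1, pow_two,
    A.lead_T12 B h2, A.lead_T12 B hu, A.lead_T1122 B hu, A.lead_Tbar1122 B hu,
    Module.End.one_apply, mul_smul]

/-- The vectors whose contraction with `u` vanishes contain `v` and are stable under lowering
operators, hence fill `V`. -/
theorem eq_zero_of_lead
    (hu : ∀ i j : Fin 3, i < j → ⁅e i j, u⁆ = 0) [LieModule.IsIrreducible ℂ Sl3 V]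
    [LieModule.IsIrreducible ℂ Sl3 W] (h : A.lead B u = 0) : u = 0 := by
  let S : Submodule ℂ V :=
    { carrier := {x | contract W x u = 0}
      add_mem' := fun {x y} hx hy => by
        rw [Set.mem_ofPred_eq] at hx hy ⊢; rw [contract_add_left, hx, hy, add_zero]
      zero_mem' := contract_zero_left u
      smul_mem' := fun c x hx => by
        rw [Set.mem_ofPred_eq] at hx ⊢; rw [contract_smul_left, hx, smul_zero] }
  obtain ⟨h1, h2⟩ := mem_highestWeightSpace_iff.1 A.v_mem
  have hS := lieSpan_le_of_lowering h1 h2 (S := S) (B.J_injective (by rw [map_zero]; exact h))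
    (fun i j hij x hx => by
      change contract W _ u = 0
      have hx' : contract W x u = 0 := hx
      rw [A.contract_lie_of_raising (hu j i hij), hx', lie_zero, neg_zero])
  rw [lieSpan_eq_top A.v_ne_zero] at hS
  refine TensorProduct.ext_iff_inner_left.2 fun x y => ?_
  have hx : contract W x u = 0 := hS (Submodule.mem_top (x := x))
  rw [inner_tmul_left, hx]
  simp

end Raising

end Model
end Leading
end MissingLabel
end

noncomputable section

namespace MissingLabel

/-! ### The exponents which occur in leading components -/

section Exponents

theorem coeff_chartDer_zero_zero (x : Laurent) (a b c d k : ℤ) :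
    (chartDer 0 0 x).coeff (a, b, c, d, k) =
      (a - c - (1 / 3) * (a + b - c - d - k)) * x.coeff (a, b, c, d, k) := by
  simp [chartDer, coeff_eul, expT]
  ring

theorem coeff_chartDer_one_one (x : Laurent) (a b c d k : ℤ) :
    (chartDer 1 1 x).coeff (a, b, c, d, k) =
      (- k - (1 / 3) * (a + b - c - d - k)) * x.coeff (a, b, c, d, k) := by
  simp [chartDer, coeff_eul, expT]
  ring

theorem coeff_chartDer_zero_one (x : Laurent) (a b c d k : ℤ) :
    (chartDer 0 1 x).coeff (a, b, c, d, k) =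
      -(c + 1) * x.coeff (a, b, c + 1, d, k - 1) := by
  simp [chartDer, coeff_mon_mul, coeff_eul]
  ring

theorem coeff_chartDer_one_two (x : Laurent) (a b c d k : ℤ) :
    (chartDer 1 2 x).coeff (a, b, c, d, k) =
      -(b + 1) * x.coeff (a - 1, b + 1, c - 1, d, k + 1)
        - (b + k + 1) * x.coeff (a, b, c, d - 1, k + 1) := by
  simp [chartDer, coeff_mon_mul, coeff_eul]
  ring

/-- In the chart `e₁₂` is `-η₁ ∂/∂η₀`, so its powers send monomials to monomials. The product is, up
to sign, a falling factorial of `c`, which for `c ≥ 0` vanishes only if `c < n`. -/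
theorem coeff_chartOp_zero_one_pow (x : Laurent) (a b c d k : ℤ) (n : ℕ) :
    ((chartOp 0 1 ^ n) x).coeff (a, b, c - n, d, k + n) =
      (∏ i ∈ Finset.range n, -((c : ℂ) - i)) * x.coeff (a, b, c, d, k) := by
  induction n with
  | zero => simp
  | succ n ih =>
    rw [pow_succ', Module.End.mul_apply, chartOp_apply, coeff_chartDer_zero_one,
      Finset.prod_range_succ]
    have h1 : c - ((n + 1 : ℕ) : ℤ) + 1 = c - n := by push_cast; ring
    have h2 : k + ((n + 1 : ℕ) : ℤ) - 1 = k + n := by push_cast; ring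
    rw [h1, h2, ih]
    push_cast
    ring

/-- In the chart `e₂₃` has a part lowering the exponent of `y₂` and a part preserving it with factor
`-(b + k)`. On the largest exponent `b` only the latter contributes. -/
theorem coeff_chartOp_one_two_pow {x : Laurent} {b : ℤ}
    (hx : ∀ u : Expo, b < u.2.1 → x.coeff u = 0) (n : ℕ) :
    (∀ u : Expo, b < u.2.1 → ((chartOp 1 2 ^ n) x).coeff u = 0) ∧
    ∀ a c d k : ℤ, ((chartOp 1 2 ^ n) x).coeff (a, b, c, d + n, k - n) =
      (∏ i ∈ Finset.range n, -((b : ℂ) + k - i)) * x.coeff (a, b, c, d, k) := by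
  induction n with
  | zero => simpa using hx
  | succ n ih =>
    refine ⟨?_, fun a c d k => ?_⟩
    · rintro ⟨a', b', c', d', k'⟩ hb
      change b < b' at hb
      rw [pow_succ', Module.End.mul_apply, chartOp_apply, coeff_chartDer_one_two,
        ih.1 _ (show b < b' + 1 by omega), ih.1 _ (show b < b' from hb)]
      ring
    · rw [pow_succ', Module.End.mul_apply, chartOp_apply, coeff_chartDer_one_two,
        Finset.prod_range_succ, ih.1 _ (show b < b + 1 by omega)]
      have h1 : d + ((n + 1 : ℕ) : ℤ) - 1 = d + n := by push_cast; ring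
      have h2 : k - ((n + 1 : ℕ) : ℤ) + 1 = k - n := by push_cast; ring
      rw [h1, h2, ih.2]
      push_cast
      ring

theorem le_of_prod_neg_eq_zero {n : ℕ} {c : ℤ}
    (h : ∏ i ∈ Finset.range n, -((c : ℂ) - i) = 0) : c < n := by
  obtain ⟨i, hi, h0⟩ := Finset.prod_eq_zero_iff.1 h
  have h1 : (c : ℂ) = ((i : ℤ) : ℂ) := by push_cast; linear_combination -h0
  have h2 : c = i := by exact_mod_cast h1
  have := Finset.mem_range.1 hi
  omega

end Exponents

/-! ### Restriction to the simple-root copies of sl₂ -/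

section SlTwo

variable {M : Type*} [AddCommGroup M] [Module ℂ M] [LieRingModule Sl3 M] [LieModule ℂ Sl3 M]
  [FiniteDimensional ℂ M]

theorem isSl2Triple {i j : Fin 3} (h : i ≠ j) : IsSl2Triple (e i i - e j j) (e i j) (e j i) where
  h_ne_zero := fun h0 => by
    have h1 := congrArg (fun x : Sl3 => x.1 i i - x.1 j j) h0
    simp [e, h, h.symm, Matrix.single] at h1
    norm_num at h1
  lie_e_f := by simp [lie_e]
  lie_h_e_nsmul := by simp [lie_e, sub_lie, h.symm, two_smul]
  lie_h_f_nsmul := by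
    simp [lie_e, sub_lie, h, two_smul]
    abel

/-- A highest-weight vector of weight `a` for sl₂ in a finite-dimensional representation is
annihilated by the power `a + 1` of the lowering operator. -/
theorem lowering_pow_eq_zero {a b : ℕ} {v : M} (hv : v ∈ highestWeightSpace M (a + 1) (b + 1)) :
    (LieModule.toEnd ℂ Sl3 M (e 1 0) ^ (a + 1)) v = 0 ∧
      (LieModule.toEnd ℂ Sl3 M (e 2 1) ^ (b + 1)) v = 0 := by
  by_cases h0 : v = 0
  · simp [h0]
  obtain ⟨h1, h2, h3⟩ := hv
  constructor
  · have P : (isSl2Triple (i := 0) (j := 1) (by decide)).HasPrimitiveVectorWith v (a : ℂ) :=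
      { ne_zero := h0
        lie_h := by rw [h₁] at h1; rw [h1]; push_cast; rw [add_sub_cancel_right]
        lie_e := h3 0 1 (by decide) }
    exact P.pow_toEnd_f_eq_zero_of_eq_nat rfl
  · have P : (isSl2Triple (i := 1) (j := 2) (by decide)).HasPrimitiveVectorWith v (b : ℂ) :=
      { ne_zero := h0
        lie_h := by rw [h₂] at h2; rw [h2]; push_cast; rw [add_sub_cancel_right]
        lie_e := h3 1 2 (by decide) }
    exact P.pow_toEnd_f_eq_zero_of_eq_nat rfl

end SlTwo

/-! ### Constraints on the exponents of leading components -/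

section Lead

variable {V W : Type*} [NormedAddCommGroup V] [InnerProductSpace ℂ V] [LieRingModule Sl3 V]
  [LieModule ℂ Sl3 V] [NormedAddCommGroup W] [InnerProductSpace ℂ W] [LieRingModule Sl3 W]
  [LieModule ℂ Sl3 W] {p q p' q' : ℕ}

namespace Model

variable [FiniteDimensional ℂ W] (A : Model V p q) (B : Model W p' q')

theorem J_mem_posPart (y : W) : B.J y ∈ posPart := chart_mem_posPart _

theorem exponent_of_J [LieModule.IsIrreducible ℂ Sl3 W] {y : W} {a b c d k : ℤ}
    (h : (B.J y).coeff (a, b, c, d, k) ≠ 0) : a + b = p' ∧ c + d + k = q' := by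
  have hm := B.ι_mem y
  have hp := congrArg (fun x => x.coeff ((a, b, c, d, k) : Expo))
    (chart_wder (Or.inl ⟨rfl, rfl⟩) (B.ι y))
  have hq := congrArg (fun x => x.coeff ((a, b, c, d, k) : Expo))
    (chart_wder (Or.inr (Or.inl ⟨rfl, rfl⟩)) (B.ι y))
  simp only [hm.1, hm.2, map_smul, ← J_apply, coeff_eul, AddMonoidAlgebra.coeff_smul_apply,
    smul_eq_mul, mul_eq_mul_right_iff, h, or_false, AddMonoidHom.add_apply, expA_apply,
    expB_apply, expC_apply, expD_apply, expK_apply] at hp hq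
  exact ⟨by exact_mod_cast hp.symm, by exact_mod_cast hq.symm⟩

/-- Each relation `e_{ji}^n v = 0` in `V` becomes the differential equation `e_{ij}^n = 0` for the
leading component, since every lowering of `v` is traded for a raising in the chart. -/
theorem lead_pow {u : V ⊗[ℂ] W} {i j : Fin 3} (hu : ⁅e i j, u⁆ = 0) {n : ℕ}
    (hn : (LieModule.toEnd ℂ Sl3 V (e j i) ^ n) A.v = 0) :
    (chartOp i j ^ n) (A.lead B u) = 0 := by
  have h : ∀ n : ℕ, B.J (contract W ((LieModule.toEnd ℂ Sl3 V (e j i) ^ n) A.v) u) =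
      (-1 : ℂ) ^ n • (chartOp i j ^ n) (A.lead B u) := by
    intro n
    induction n with
    | zero => simp [lead_apply]
    | succ n ih =>
      rw [pow_succ', Module.End.mul_apply, LieModule.toEnd_apply_apply,
        A.contract_lie_of_raising hu, map_neg, B.J_lie, ih, Derivation.map_smul, pow_succ',
        pow_succ', Module.End.mul_apply, chartOp_apply]
      module
  have h1 := h n
  rw [hn, contract_zero_left, map_zero] at h1
  exact (smul_eq_zero.1 h1.symm).resolve_left (pow_ne_zero _ (by norm_num))

theorem chartDer_lead {r s : ℕ} {u : V ⊗[ℂ] W} (hu : u ∈ highestWeightSpace (V ⊗[ℂ] W) r s)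
    (i : Fin 3) : chartDer i i (A.lead B u) =
      (wt r s i - wt (p + 1 : ℕ) (q + 1 : ℕ) i) • A.lead B u := by
  have h := congrArg (A.lead B) ((mem_highestWeightSpace_iff.1 hu).1 i)
  rw [lie_eq_act, map_add, lead_eLeg_zero_self, lead_eLeg_one, map_smul, chartOp_apply] at h
  rw [sub_smul, ← h, add_sub_cancel_left]

/-- In terms of the labels these equations read `k = ℓ - n` and `b + c + 1 = n`. Together with the
two degree conditions they leave `b` as the only free exponent. -/
theorem exponent_of_lead_weight {r s : ℕ} {u : V ⊗[ℂ] W}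
    (hu : u ∈ highestWeightSpace (V ⊗[ℂ] W) r s) [LieModule.IsIrreducible ℂ Sl3 W]
    {a b c d k : ℤ} (h : (A.lead B u).coeff (a, b, c, d, k) ≠ 0) :
    3 * k = r - s + q - p - p' + q' ∧
      3 * (b + c + 1) = 2 * p + q + 2 * p' + q' - 2 * r - s + 6 := by
  obtain ⟨h1, h2⟩ := B.exponent_of_J h
  have h3 := congrArg (fun x => x.coeff ((a, b, c, d, k) : Expo)) (A.chartDer_lead B hu 0)
  have h4 := congrArg (fun x => x.coeff ((a, b, c, d, k) : Expo)) (A.chartDer_lead B hu 1)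
  simp only [coeff_chartDer_zero_zero, coeff_chartDer_one_one, AddMonoidAlgebra.coeff_smul_apply,
    smul_eq_mul, mul_eq_mul_right_iff, h, or_false, wt, Fin.isValue, if_true, Fin.reduceEq,
    if_false] at h3 h4
  have h1' : (a : ℂ) + b = p' := by exact_mod_cast h1
  have h2' : (c : ℂ) + d + k = q' := by exact_mod_cast h2
  push_cast at h3 h4
  have h5 : (3 * k : ℂ) = r - s + q - p - p' + q' := by
    linear_combination (-3) * h4 - h1' + h2'
  have h6 : (3 * (b + c + 1) : ℂ) = 2 * p + q + 2 * p' + q' - 2 * r - s + 6 := by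
    linear_combination (-3) * h3 + 2 * h1' + h2'
  exact ⟨by exact_mod_cast h5, by exact_mod_cast h6⟩

/-- The four sign conditions come from polynomiality of the chart, and the two upper bounds from the
relations satisfied by `v` under the simple lowering operators. -/
theorem exponent_of_lead {r s : ℕ} {u : V ⊗[ℂ] W} (hu : u ∈ highestWeightSpace (V ⊗[ℂ] W) r s)
    [FiniteDimensional ℂ V] [LieModule.IsIrreducible ℂ Sl3 W]
    {a b c d k : ℤ} (h : (A.lead B u).coeff (a, b, c, d, k) ≠ 0) :
    (0 ≤ a ∧ 0 ≤ b ∧ 0 ≤ c ∧ 0 ≤ d) ∧ c ≤ p ∧ b + k ≤ q := by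
  obtain ⟨v1, v2⟩ := lowering_pow_eq_zero A.v_mem
  have hr := (mem_highestWeightSpace_iff.1 hu).2
  refine ⟨B.J_mem_posPart _ _ h, ?_, ?_⟩
  · have h1 := coeff_chartOp_zero_one_pow (A.lead B u) a b c d k (p + 1)
    rw [A.lead_pow B (hr 0 1 (by decide)) v1] at h1
    have h2 := le_of_prod_neg_eq_zero ((mul_eq_zero.1 h1.symm).resolve_right h)
    push_cast at h2
    omega
  · obtain ⟨⟨a₁, b₁, c₁, d₁, k₁⟩, hu₁, hmax⟩ := Finset.exists_max_image (A.lead B u).coeff.support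
      (fun u : Expo => u.2.1) ⟨_, Finsupp.mem_support_iff.2 h⟩
    have hb : b ≤ b₁ := hmax _ (Finsupp.mem_support_iff.2 h)
    have h1 := (coeff_chartOp_one_two_pow (x := A.lead B u) (b := b₁) (fun v hv => by
      by_contra h0
      exact (not_le.2 hv) (hmax _ (Finsupp.mem_support_iff.2 h0))) (q + 1)).2 a₁ c₁ d₁ k₁
    rw [A.lead_pow B (hr 1 2 (by decide)) v2] at h1
    have h2 := le_of_prod_neg_eq_zero (c := b₁ + k₁) (by
      push_cast
      exact (mul_eq_zero.1 h1.symm).resolve_right (Finsupp.mem_support_iff.1 hu₁))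
    have h3 := (A.exponent_of_lead_weight B hu h).1
    have h4 := (A.exponent_of_lead_weight B hu (Finsupp.mem_support_iff.1 hu₁)).1
    push_cast at h2
    omega

end Model
end Lead
end MissingLabel
end

noncomputable section

namespace MissingLabel

/-! ### Highest-weight vectors in the tensor square of the polynomial ring -/

section PolyTensor

theorem lie_tensor_mul (x : Sl3) (F G : Poly ⊗[ℂ] Poly) :
    ⁅x, F * G⁆ = ⁅x, F⁆ * G + F * ⁅x, G⁆ := by
  induction F with
  | zero => simp
  | add F F' h h' => rw [add_mul, lie_add, h, h', lie_add, add_mul, add_mul]; abel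
  | tmul f f' =>
    induction G with
    | zero => simp
    | add G G' h h' => rw [mul_add, lie_add, h, h', lie_add, mul_add, mul_add]; abel
    | tmul g g' =>
      simp only [Algebra.TensorProduct.tmul_mul_tmul, TensorProduct.LieModule.lie_tmul_right,
        lie_poly_mul, TensorProduct.add_tmul, TensorProduct.tmul_add, add_mul, mul_add, mul_comm _ ⁅x, f⁆,
        mul_comm _ ⁅x, f'⁆]
      abel

/-- Vectors of diagonal weight `l` killed by the raising operators. -/
def IsHighest (l : Fin 3 → ℂ) (F : Poly ⊗[ℂ] Poly) : Prop :=
  (∀ i, ⁅e i i, F⁆ = l i • F) ∧ ∀ i j : Fin 3, i < j → ⁅e i j, F⁆ = 0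

theorem IsHighest.mul {l l' : Fin 3 → ℂ} {F G : Poly ⊗[ℂ] Poly} (hF : IsHighest l F)
    (hG : IsHighest l' G) : IsHighest (l + l') (F * G) := by
  refine ⟨fun i => ?_, fun i j hij => ?_⟩
  · rw [lie_tensor_mul, hF.1, hG.1, Pi.add_apply, add_smul, smul_mul_assoc, mul_smul_comm]
  · rw [lie_tensor_mul, hF.2 i j hij, hG.2 i j hij, zero_mul, mul_zero, add_zero]

theorem IsHighest.pow {l : Fin 3 → ℂ} {F : Poly ⊗[ℂ] Poly} (hF : IsHighest l F) (n : ℕ) :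
    IsHighest ((n : ℂ) • l) (F ^ n) := by
  induction n with
  | zero =>
    have h : ∀ x : Sl3, ⁅x, (1 : Poly ⊗[ℂ] Poly)⁆ = 0 := fun x => by
      have h1 := lie_tensor_mul x 1 1
      simpa using h1
    simp [IsHighest, h]
  | succ n ih =>
    rw [pow_succ]
    convert ih.mul hF using 1
    push_cast
    rw [add_smul, one_smul]

/-- Tensors of bidegrees `(p, q)` and `(p', q')`. -/
def tensorBideg (p q p' q' : ℕ) : Submodule ℂ (Poly ⊗[ℂ] Poly) :=
  Submodule.span ℂ {t | ∃ f ∈ bideg p q, ∃ g ∈ bideg p' q', f ⊗ₜ[ℂ] g = t}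

theorem tmul_mem_tensorBideg {p q p' q' : ℕ} {f g : Poly} (hf : f ∈ bideg p q)
    (hg : g ∈ bideg p' q') : f ⊗ₜ[ℂ] g ∈ tensorBideg p q p' q' :=
  Submodule.subset_span ⟨f, hf, g, hg, rfl⟩

theorem mul_mem_tensorBideg {p q p' q' r s r' s' : ℕ} {F G : Poly ⊗[ℂ] Poly}
    (hF : F ∈ tensorBideg p q p' q') (hG : G ∈ tensorBideg r s r' s') :
    F * G ∈ tensorBideg (p + r) (q + s) (p' + r') (q' + s') := by
  have h := Submodule.mul_mem_mul hF hG
  rw [tensorBideg, tensorBideg, Submodule.span_mul_span] at h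
  refine Submodule.span_mono ?_ h
  rintro _ ⟨_, ⟨f, hf, g, hg, rfl⟩, _, ⟨f', hf', g', hg', rfl⟩, rfl⟩
  exact ⟨f * f', mul_mem_bideg hf hf', g * g', mul_mem_bideg hg hg',
    (Algebra.TensorProduct.tmul_mul_tmul _ _ _ _).symm⟩

theorem pow_mem_tensorBideg {p q p' q' : ℕ} {F : Poly ⊗[ℂ] Poly}
    (hF : F ∈ tensorBideg p q p' q') (n : ℕ) :
    F ^ n ∈ tensorBideg (n * p) (n * q) (n * p') (n * q') := by
  induction n with
  | zero =>
    simpa [Algebra.TensorProduct.one_def] using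
      tmul_mem_tensorBideg one_mem_bideg one_mem_bideg
  | succ n ih =>
    have h := mul_mem_tensorBideg ih hF
    rw [pow_succ]
    convert h using 1
    simp only [Nat.succ_mul]

/-- Evaluation at the highest-weight point of the cone. -/
def hwEval : Poly →ₐ[ℂ] ℂ := MvPolynomial.aeval (Sum.elim ![1, 0, 0] ![0, 0, 1])

theorem hwEval_eq_coeff {p q : ℕ} {f : Poly} (hf : f ∈ bideg p q) :
    hwEval f = MvPolynomial.coeff (hwExp p q) f := by
  have h : hwEval f = MvPolynomial.eval (Sum.elim ![1, 0, 0] ![0, 0, 1]) f := by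
    simp [hwEval, MvPolynomial.aeval_eq_eval]
  rw [h, MvPolynomial.eval_eq', Finset.sum_eq_single (hwExp p q)]
  · simp [hwExp, Fintype.prod_sum_type, Fin.prod_univ_three]
  · intro α hα hne
    obtain ⟨h1, h2⟩ := exponent_of_mem_bideg hf (MvPolynomial.mem_support_iff.1 hα)
    by_contra h0
    apply hne
    simp [Fintype.prod_sum_type, Fin.prod_univ_three] at h0
    ext i
    rcases i with i | i <;> fin_cases i <;> simp [hwExp] <;> omega
  · intro h0
    rw [MvPolynomial.notMem_support_iff.1 h0, zero_mul]

/-- Evaluation at the highest-weight point in the first factor and the chart in the second. -/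
def evalChart : Poly ⊗[ℂ] Poly →ₐ[ℂ] Laurent :=
  Algebra.TensorProduct.productMap ((Algebra.ofId ℂ Laurent).comp hwEval) chart

theorem evalChart_tmul (f g : Poly) : evalChart (f ⊗ₜ g) = hwEval f • chart g := by
  rw [evalChart, Algebra.TensorProduct.productMap_apply_tmul, AlgHom.comp_apply,
    Algebra.ofId_apply, Algebra.smul_def]

/-- The coordinates of the first factor. -/
def polyL (i : Fin 3 ⊕ Fin 3) : Poly ⊗[ℂ] Poly := MvPolynomial.X i ⊗ₜ 1

/-- The coordinates of the second factor. -/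
def polyR (i : Fin 3 ⊕ Fin 3) : Poly ⊗[ℂ] Poly := 1 ⊗ₜ MvPolynomial.X i

theorem lie_one_poly (x : Sl3) : ⁅x, (1 : Poly)⁆ = 0 := by
  simpa using lie_poly_mul x 1 1

/-- The invariant pairing of the first vector with the second covector. -/
def pairL : Poly ⊗[ℂ] Poly :=
  ∑ i, (MvPolynomial.X (Sum.inl i) : Poly) ⊗ₜ[ℂ] (MvPolynomial.X (Sum.inr i) : Poly)

/-- The invariant pairing of the first covector with the second vector. -/
def pairR : Poly ⊗[ℂ] Poly :=
  ∑ i, (MvPolynomial.X (Sum.inr i) : Poly) ⊗ₜ[ℂ] (MvPolynomial.X (Sum.inl i) : Poly)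

/-- The leading component of the cross product of the covectors. -/
def cross : Poly ⊗[ℂ] Poly :=
  (MvPolynomial.X (Sum.inr 2) : Poly) ⊗ₜ[ℂ] (MvPolynomial.X (Sum.inr 1) : Poly)
    - (MvPolynomial.X (Sum.inr 1) : Poly) ⊗ₜ[ℂ] (MvPolynomial.X (Sum.inr 2) : Poly)

theorem isHighest_polyL_inl : IsHighest ![2 / 3, -1 / 3, -1 / 3] (polyL (Sum.inl 0)) := by
  refine ⟨fun i => ?_, fun i j hij => ?_⟩
  · fin_cases i <;> simp [polyL, lie_e_inl, lie_one_poly, TensorProduct.sub_tmul, TensorProduct.add_tmul,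
    TensorProduct.neg_tmul, TensorProduct.tmul_sub, TensorProduct.tmul_add, TensorProduct.tmul_neg,
    ← TensorProduct.smul_tmul', TensorProduct.tmul_smul] <;> module
  · fin_cases i <;> fin_cases j <;> simp [polyL, lie_e_inl, lie_one_poly] at hij ⊢

theorem isHighest_polyR_inl : IsHighest ![2 / 3, -1 / 3, -1 / 3] (polyR (Sum.inl 0)) := by
  refine ⟨fun i => ?_, fun i j hij => ?_⟩
  · fin_cases i <;> simp [polyR, lie_e_inl, lie_one_poly, TensorProduct.sub_tmul, TensorProduct.add_tmul,
    TensorProduct.neg_tmul, TensorProduct.tmul_sub, TensorProduct.tmul_add, TensorProduct.tmul_neg,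
    ← TensorProduct.smul_tmul', TensorProduct.tmul_smul] <;> module
  · fin_cases i <;> fin_cases j <;> simp [polyR, lie_e_inl, lie_one_poly] at hij ⊢

theorem isHighest_polyL_inr : IsHighest ![1 / 3, 1 / 3, -2 / 3] (polyL (Sum.inr 2)) := by
  refine ⟨fun i => ?_, fun i j hij => ?_⟩
  · fin_cases i <;> simp [polyL, lie_e_inr, lie_one_poly, TensorProduct.sub_tmul, TensorProduct.add_tmul,
    TensorProduct.neg_tmul, TensorProduct.tmul_sub, TensorProduct.tmul_add, TensorProduct.tmul_neg,
    ← TensorProduct.smul_tmul', TensorProduct.tmul_smul] <;> module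
  · fin_cases i <;> fin_cases j <;> simp [polyL, lie_e_inr, lie_one_poly] at hij ⊢

theorem isHighest_polyR_inr : IsHighest ![1 / 3, 1 / 3, -2 / 3] (polyR (Sum.inr 2)) := by
  refine ⟨fun i => ?_, fun i j hij => ?_⟩
  · fin_cases i <;> simp [polyR, lie_e_inr, lie_one_poly, TensorProduct.sub_tmul, TensorProduct.add_tmul,
    TensorProduct.neg_tmul, TensorProduct.tmul_sub, TensorProduct.tmul_add, TensorProduct.tmul_neg,
    ← TensorProduct.smul_tmul', TensorProduct.tmul_smul] <;> module
  · fin_cases i <;> fin_cases j <;> simp [polyR, lie_e_inr, lie_one_poly] at hij ⊢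

theorem isHighest_cross : IsHighest ![2 / 3, -1 / 3, -1 / 3] (cross) := by
  refine ⟨fun i => ?_, fun i j hij => ?_⟩
  · fin_cases i <;> simp [cross, lie_e_inr, TensorProduct.sub_tmul, TensorProduct.add_tmul,
    TensorProduct.neg_tmul, TensorProduct.tmul_sub, TensorProduct.tmul_add, TensorProduct.tmul_neg,
    ← TensorProduct.smul_tmul', TensorProduct.tmul_smul] <;> module
  · fin_cases i <;> fin_cases j <;> 
    simp [cross, lie_e_inr, TensorProduct.neg_tmul, TensorProduct.tmul_neg] at hij ⊢

theorem lie_pairL (i j : Fin 3) : ⁅e i j, pairL⁆ = 0 := by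
  fin_cases i <;> fin_cases j <;> simp [pairL, Fin.sum_univ_three, lie_e_inl, lie_e_inr, TensorProduct.sub_tmul, TensorProduct.add_tmul,
    TensorProduct.neg_tmul, TensorProduct.tmul_sub, TensorProduct.tmul_add, TensorProduct.tmul_neg,
    ← TensorProduct.smul_tmul', TensorProduct.tmul_smul]

theorem isHighest_pairL : IsHighest 0 pairL :=
  ⟨fun i => by rw [lie_pairL, Pi.zero_apply, zero_smul], fun i j _ => lie_pairL i j⟩

theorem lie_pairR (i j : Fin 3) : ⁅e i j, pairR⁆ = 0 := by
  fin_cases i <;> fin_cases j <;> simp [pairR, Fin.sum_univ_three, lie_e_inl, lie_e_inr, TensorProduct.sub_tmul, TensorProduct.add_tmul,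
    TensorProduct.neg_tmul, TensorProduct.tmul_sub, TensorProduct.tmul_add, TensorProduct.tmul_neg,
    ← TensorProduct.smul_tmul', TensorProduct.tmul_smul]

theorem isHighest_pairR : IsHighest 0 pairR :=
  ⟨fun i => by rw [lie_pairR, Pi.zero_apply, zero_smul], fun i j _ => lie_pairR i j⟩

/-- A highest-weight vector of the tensor square of the polynomial ring. -/
def hwTensor (x y a b c d k : ℕ) : Poly ⊗[ℂ] Poly :=
  pairL ^ c * pairR ^ b * polyL (Sum.inl 0) ^ x * polyL (Sum.inr 2) ^ y * polyR (Sum.inl 0) ^ a *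
    polyR (Sum.inr 2) ^ d * cross ^ k

theorem isHighest_hwTensor (x y a b c d k : ℕ) :
    IsHighest (wt (x + a + k + 1) (y + d + 1)) (hwTensor x y a b c d k) := by
  have h := ((((((isHighest_pairL.pow c).mul (isHighest_pairR.pow b)).mul
    (isHighest_polyL_inl.pow x)).mul (isHighest_polyL_inr.pow y)).mul
    (isHighest_polyR_inl.pow a)).mul (isHighest_polyR_inr.pow d)).mul (isHighest_cross.pow k)
  rw [hwTensor]
  convert h using 1
  ext i
  fin_cases i <;> simp [wt] <;> ring

theorem hwTensor_mem (x y a b c d k : ℕ) :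
    hwTensor x y a b c d k ∈ tensorBideg (c + x) (b + y + k) (b + a) (c + d + k) := by
  have h1 : pairL ∈ tensorBideg 1 0 0 1 := Submodule.sum_mem _ fun i _ =>
    tmul_mem_tensorBideg (X_inl_mem_bideg i) (X_inr_mem_bideg i)
  have h2 : pairR ∈ tensorBideg 0 1 1 0 := Submodule.sum_mem _ fun i _ =>
    tmul_mem_tensorBideg (X_inr_mem_bideg i) (X_inl_mem_bideg i)
  have h3 : cross ∈ tensorBideg 0 1 0 1 := Submodule.sub_mem _
    (tmul_mem_tensorBideg (X_inr_mem_bideg 2) (X_inr_mem_bideg 1))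
    (tmul_mem_tensorBideg (X_inr_mem_bideg 1) (X_inr_mem_bideg 2))
  have h4 : polyL (Sum.inl 0) ∈ tensorBideg 1 0 0 0 :=
    tmul_mem_tensorBideg (X_inl_mem_bideg 0) one_mem_bideg
  have h5 : polyL (Sum.inr 2) ∈ tensorBideg 0 1 0 0 :=
    tmul_mem_tensorBideg (X_inr_mem_bideg 2) one_mem_bideg
  have h6 : polyR (Sum.inl 0) ∈ tensorBideg 0 0 1 0 :=
    tmul_mem_tensorBideg one_mem_bideg (X_inl_mem_bideg 0)
  have h7 : polyR (Sum.inr 2) ∈ tensorBideg 0 0 0 1 :=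
    tmul_mem_tensorBideg one_mem_bideg (X_inr_mem_bideg 2)
  have h := mul_mem_tensorBideg (mul_mem_tensorBideg (mul_mem_tensorBideg (mul_mem_tensorBideg
    (mul_mem_tensorBideg (mul_mem_tensorBideg (pow_mem_tensorBideg h1 c)
    (pow_mem_tensorBideg h2 b)) (pow_mem_tensorBideg h4 x)) (pow_mem_tensorBideg h5 y))
    (pow_mem_tensorBideg h6 a)) (pow_mem_tensorBideg h7 d)) (pow_mem_tensorBideg h3 k)
  simp only [mul_one, mul_zero, add_zero, zero_add] at h
  exact h

/-- At the point `y = (1, 0, 0)`, `η = (0, 0, 1)` of the first factor, `pairL`, `pairR` and `cross`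
become the coordinates `η₀`, `y₂` and `η₁` of the second, while `polyL` becomes `1` for the two
coordinates used. -/
theorem evalChart_hwTensor (x y a b c d k : ℕ) :
    evalChart (hwTensor x y a b c d k) = mon (a, b, c, d, k) := by
  have hX : ∀ i, hwEval (MvPolynomial.X i) = Sum.elim ![1, 0, 0] ![0, 0, 1] i := fun i =>
    MvPolynomial.aeval_X _ _
  simp [hwTensor, pairL, pairR, polyL, polyR, cross, evalChart_tmul, hX, chart_X,
    Fin.sum_univ_three, mon_pow, mon_mul]

end PolyTensor

/-! ### Highest-weight vectors with prescribed leading monomial -/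

section Vectors

variable {V W : Type*} [NormedAddCommGroup V] [InnerProductSpace ℂ V] [LieRingModule Sl3 V]
  [LieModule ℂ Sl3 V] [NormedAddCommGroup W] [InnerProductSpace ℂ W] [LieRingModule Sl3 W]
  [LieModule ℂ Sl3 W] {p q p' q' : ℕ} [FiniteDimensional ℂ V] [FiniteDimensional ℂ W]

namespace Model

variable (A : Model V p q) (B : Model W p' q')

theorem map_π_lie (i j : Fin 3) (F : Poly ⊗[ℂ] Poly) :
    TensorProduct.map A.π B.π ⁅e i j, F⁆ = ⁅e i j, TensorProduct.map A.π B.π F⁆ := by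
  induction F with
  | zero => simp
  | tmul f g => simp [TensorProduct.LieModule.lie_tmul_right, π_lie]
  | add F G hF hG => rw [lie_add, map_add, hF, hG, map_add, lie_add]

/-- Contracting the projection with `v` reads off the coefficient of `y₀^p η₂^q`, which is
evaluation at the highest-weight point. In the second factor the projection does not change the
chart image. -/
theorem lead_map_π [LieModule.IsIrreducible ℂ Sl3 W] {F : Poly ⊗[ℂ] Poly}
    (hF : F ∈ tensorBideg p q p' q') :
    A.lead B (TensorProduct.map A.π B.π F) = multiFactorial (hwExp p q) • evalChart F := by
  induction hF using Submodule.span_induction with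
  | mem t ht =>
    obtain ⟨f, hf, g, hg, rfl⟩ := ht
    rw [TensorProduct.map_tmul, lead_apply, contract_tmul, map_smul, inner_v_π, J_apply,
      B.chart_ι_π hg, evalChart_tmul, hwEval_eq_coeff hf, mul_smul]
  | zero => simp
  | add s t _ _ hs ht => rw [map_add, map_add, hs, ht, map_add, smul_add]
  | smul c t _ ht => rw [map_smul, map_smul, ht, map_smul, smul_comm]

/-- The remaining exponents of `hwTensor` are `x = p - c` and `y = q - b - k`, so the bounds on `c`
and `b + k` are exactly their non-negativity. The exponent `k = ℓ - n` is a power of `cross` and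
must be non-negative too, which is why `ℓ < n` needs a separate argument. -/
theorem exists_lead_eq_mon [LieModule.IsIrreducible ℂ Sl3 W] {r s : ℕ} {a b c d k : ℤ}
    (hk : 3 * k = r - s + q - p - p' + q')
    (hn : 3 * (b + c + 1) = 2 * p + q + 2 * p' + q' - 2 * r - s + 6)
    (hab : a + b = p') (hcd : c + d + k = q') (ha : 0 ≤ a) (hb : 0 ≤ b) (hc : 0 ≤ c)
    (hd : 0 ≤ d) (hk0 : 0 ≤ k) (hcp : c ≤ p) (hbq : b + k ≤ q) :
    ∃ u ∈ highestWeightSpace (V ⊗[ℂ] W) r s, A.lead B u = mon (a, b, c, d, k) := by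
  lift a to ℕ using ha
  lift b to ℕ using hb
  lift c to ℕ using hc
  lift d to ℕ using hd
  lift k to ℕ using hk0
  obtain ⟨x, rfl⟩ : ∃ x, p = c + x := Nat.exists_eq_add_of_le (by omega)
  obtain ⟨y, hy⟩ : ∃ y, q = b + k + y := Nat.exists_eq_add_of_le (by omega)
  obtain rfl : q = b + y + k := by omega
  obtain rfl : p' = b + a := by omega
  obtain rfl : q' = c + d + k := by omega
  obtain rfl : r = x + a + k + 1 := by push_cast at hk hn; omega
  obtain rfl : s = y + d + 1 := by push_cast at hk hn; omega
  have h1 := isHighest_hwTensor x y a b c d k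
  refine ⟨(multiFactorial (hwExp (c + x) (b + y + k)))⁻¹ •
    TensorProduct.map A.π B.π (hwTensor x y a b c d k), Submodule.smul_mem _ _ ?_, ?_⟩
  · rw [mem_highestWeightSpace_iff]
    refine ⟨fun i => ?_, fun i j hij => ?_⟩
    · rw [← map_π_lie, h1.1, map_smul]
      push_cast
      rfl
    · rw [← map_π_lie, h1.2 i j hij, map_zero]
  · rw [map_smul, A.lead_map_π B (hwTensor_mem x y a b c d k), smul_smul,
      inv_mul_cancel₀ (multiFactorial_ne_zero _), one_smul, evalChart_hwTensor]

end Model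
end Vectors
end MissingLabel
end

noncomputable section

namespace MissingLabel

/-! ### Self-adjointness -/

section Adjoint

theorem sum_swap_outer {β : Type*} [AddCommMonoid β] (f : Fin 3 → Fin 3 → Fin 3 → β) :
    ∑ i, ∑ j, ∑ k, f i j k = ∑ i, ∑ j, ∑ k, f k j i := by
  rw [Finset.sum_comm, Finset.sum_comm (f := fun i j => ∑ k, f k j i)]
  exact Finset.sum_congr rfl fun j _ => Finset.sum_comm

theorem eLeg_mul_commute (i j k l r s : Fin 3) :
    Commute (eLeg 0 i j * eLeg 0 k l) (eLeg 1 r s) :=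
  (leg_commute _ _).mul_left (leg_commute _ _)

theorem eLeg_mul_mul_comm (a b c d i j k l : Fin 3) :
    eLeg 1 i j * (eLeg 1 k l * (eLeg 0 a b * eLeg 0 c d)) =
      eLeg 0 a b * eLeg 0 c d * eLeg 1 i j * eLeg 1 k l := by
  rw [(eLeg_mul_commute a b c d i j).eq, mul_assoc, (eLeg_mul_commute a b c d k l).eq]

variable {V W : Type*} [NormedAddCommGroup V] [InnerProductSpace ℂ V] [LieRingModule Sl3 V]
  [LieModule ℂ Sl3 V] [NormedAddCommGroup W] [InnerProductSpace ℂ W] [LieRingModule Sl3 W]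
  [LieModule ℂ Sl3 W] {p q p' q' : ℕ}

/-- The actions of two elements of `U ⊗ U` are adjoint. -/
def IsAdj (V W : Type*) [NormedAddCommGroup V] [InnerProductSpace ℂ V] [LieRingModule Sl3 V]
    [LieModule ℂ Sl3 V] [NormedAddCommGroup W] [InnerProductSpace ℂ W] [LieRingModule Sl3 W]
    [LieModule ℂ Sl3 W] (z z' : U ⊗[ℂ] U) : Prop :=
  ∀ x y : V ⊗[ℂ] W, inner ℂ (act V W z x) y = inner ℂ x (act V W z' y)

theorem IsAdj.mul {z z' t t' : U ⊗[ℂ] U} (hz : IsAdj V W z z') (ht : IsAdj V W t t') :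
    IsAdj V W (z * t) (t' * z') := fun x y => by
  rw [map_mul, Module.End.mul_apply, hz, ht, map_mul, Module.End.mul_apply]

theorem IsAdj.sum {ι : Type*} {s : Finset ι} {f g : ι → U ⊗[ℂ] U}
    (h : ∀ i ∈ s, IsAdj V W (f i) (g i)) : IsAdj V W (∑ i ∈ s, f i) (∑ i ∈ s, g i) := fun x y => by
  simp only [map_sum, LinearMap.sum_apply, sum_inner, inner_sum]
  exact Finset.sum_congr rfl fun i hi => h i hi x y

theorem IsAdj.add {z z' t t' : U ⊗[ℂ] U} (hz : IsAdj V W z z') (ht : IsAdj V W t t') :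
    IsAdj V W (z + t) (z' + t') := fun x y => by
  rw [map_add, LinearMap.add_apply, inner_add_left, hz, ht, map_add, LinearMap.add_apply,
    inner_add_right]

theorem IsAdj.sub {z z' t t' : U ⊗[ℂ] U} (hz : IsAdj V W z z') (ht : IsAdj V W t t') :
    IsAdj V W (z - t) (z' - t') := fun x y => by
  rw [map_sub, LinearMap.sub_apply, inner_sub_left, hz, ht, map_sub, LinearMap.sub_apply,
    inner_sub_right]

theorem IsAdj.smul {z z' : U ⊗[ℂ] U} (hz : IsAdj V W z z') {c : ℂ} (hc : starRingEnd ℂ c = c) :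
    IsAdj V W (c • z) (c • z') := fun x y => by
  rw [map_smul, LinearMap.smul_apply, inner_smul_left, hz, hc, map_smul, LinearMap.smul_apply,
    inner_smul_right]

theorem isAdj_of_smul {z : U ⊗[ℂ] U} {c : ℂ} (hz : ∀ x : V ⊗[ℂ] W, act V W z x = c • x)
    (hc : starRingEnd ℂ c = c) : IsAdj V W z z := fun x y => by
  rw [hz, hz]
  exact (inner_smul_left x y c).trans (by rw [hc]; exact (inner_smul_right x y c).symm)

namespace Model

theorem isAdj_eLeg (A : Model V p q) (B : Model W p' q') (a : Fin 2) (i j : Fin 3) : IsAdj V W (eLeg a i j) (eLeg a j i) := by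
  intro x y
  induction x with
  | zero => simp
  | add x x' hx hx' => rw [map_add, inner_add_left, hx, hx', inner_add_left]
  | tmul v w =>
    induction y with
    | zero => simp
    | add y y' hy hy' => rw [inner_add_right, hy, hy', map_add, inner_add_right]
    | tmul v' w' =>
      rw [act_eLeg_tmul, act_eLeg_tmul]
      split_ifs
      · rw [TensorProduct.inner_tmul, TensorProduct.inner_tmul, A.inner_lie]
      · rw [TensorProduct.inner_tmul, TensorProduct.inner_tmul, B.inner_lie]

/-- Taking adjoints reverses a word and transposes each generator. Renaming the summation indices
and commuting the two tensor factors gives back the same trace; the longer traces follow the same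
pattern. -/
theorem isAdj_T12 (A : Model V p q) (B : Model W p' q') : IsAdj V W (T ![0, 1]) (T ![0, 1]) := by
  have h : IsAdj V W (∑ i, ∑ j, eLeg 0 j i * eLeg 1 i j) (∑ i, ∑ j, eLeg 1 j i * eLeg 0 i j) :=
    IsAdj.sum fun i _ => IsAdj.sum fun j _ => (isAdj_eLeg A B 0 j i).mul (isAdj_eLeg A B 1 i j)
  rw [Finset.sum_comm (f := fun i j => eLeg 1 j i * eLeg 0 i j)] at h
  simp only [eLeg_comm] at h
  rwa [← T_two] at h

theorem isAdj_T112 (A : Model V p q) (B : Model W p' q') :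
    IsAdj V W (T ![0, 0, 1]) (T ![0, 0, 1]) := by
  have h : IsAdj V W (∑ i, ∑ j, ∑ k, eLeg 0 j i * eLeg 0 k j * eLeg 1 i k)
      (∑ i, ∑ j, ∑ k, eLeg 1 k i * (eLeg 0 j k * eLeg 0 i j)) :=
    IsAdj.sum fun i _ => IsAdj.sum fun j _ => IsAdj.sum fun k _ =>
      ((isAdj_eLeg A B 0 j i).mul (isAdj_eLeg A B 0 k j)).mul (isAdj_eLeg A B 1 i k)
  rw [sum_swap_outer (fun i j k => eLeg 1 k i * (eLeg 0 j k * eLeg 0 i j))] at h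
  simp only [← (eLeg_mul_commute _ _ _ _ _ _).eq] at h
  rwa [← T_three] at h

theorem isAdj_T122 (A : Model V p q) (B : Model W p' q') :
    IsAdj V W (T ![0, 1, 1]) (T ![0, 1, 1]) := by
  have h : IsAdj V W (∑ i, ∑ j, ∑ k, eLeg 0 j i * eLeg 1 k j * eLeg 1 i k)
      (∑ i, ∑ j, ∑ k, eLeg 1 k i * (eLeg 1 j k * eLeg 0 i j)) :=
    IsAdj.sum fun i _ => IsAdj.sum fun j _ => IsAdj.sum fun k _ =>
      ((isAdj_eLeg A B 0 j i).mul (isAdj_eLeg A B 1 k j)).mul (isAdj_eLeg A B 1 i k)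
  have h1 : ∀ i j k, eLeg 0 j i * eLeg 1 k j * eLeg 1 i k =
      eLeg 1 k j * (eLeg 1 i k * eLeg 0 j i) := fun i j k => by
    rw [← eLeg_comm, mul_assoc, ← eLeg_comm]
  rw [Finset.sum_comm (f := fun i j => ∑ k, eLeg 1 k i * (eLeg 1 j k * eLeg 0 i j))] at h
  simp only [← h1] at h
  rwa [← T_three] at h

theorem isAdj_T1122 (A : Model V p q) (B : Model W p' q') :
    IsAdj V W (T ![0, 0, 1, 1]) (T ![0, 0, 1, 1]) := by
  have h : IsAdj V W (∑ i, ∑ j, ∑ k, ∑ s, eLeg 0 j i * eLeg 0 k j * eLeg 1 s k * eLeg 1 i s)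
      (∑ i, ∑ j, ∑ k, ∑ s, eLeg 1 s i * (eLeg 1 k s * (eLeg 0 j k * eLeg 0 i j))) :=
    IsAdj.sum fun i _ => IsAdj.sum fun j _ => IsAdj.sum fun k _ => IsAdj.sum fun s _ =>
      (((isAdj_eLeg A B 0 j i).mul (isAdj_eLeg A B 0 k j)).mul (isAdj_eLeg A B 1 s k)).mul
        (isAdj_eLeg A B 1 i s)
  rw [sum_swap_outer
    (fun i j k => ∑ s, eLeg 1 s i * (eLeg 1 k s * (eLeg 0 j k * eLeg 0 i j)))] at h
  simp only [eLeg_mul_mul_comm] at h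
  rwa [← T_four] at h

theorem isAdj_Tbar1122 (A : Model V p q) (B : Model W p' q') :
    IsAdj V W (Tbar ![0, 0, 1, 1]) (Tbar ![0, 0, 1, 1]) := by
  have h : IsAdj V W (∑ i, ∑ j, ∑ k, ∑ s, eLeg 0 i j * eLeg 0 j k * eLeg 1 k s * eLeg 1 s i)
      (∑ i, ∑ j, ∑ k, ∑ s, eLeg 1 i s * (eLeg 1 s k * (eLeg 0 k j * eLeg 0 j i))) :=
    IsAdj.sum fun i _ => IsAdj.sum fun j _ => IsAdj.sum fun k _ => IsAdj.sum fun s _ =>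
      (((isAdj_eLeg A B 0 i j).mul (isAdj_eLeg A B 0 j k)).mul (isAdj_eLeg A B 1 k s)).mul
        (isAdj_eLeg A B 1 s i)
  rw [sum_swap_outer
    (fun i j k => ∑ s, eLeg 1 i s * (eLeg 1 s k * (eLeg 0 k j * eLeg 0 j i)))] at h
  simp only [eLeg_mul_mul_comm] at h
  rwa [← Tbar_four] at h

/-- The traces are self-adjoint, and the Casimir elements act as real scalars. -/
theorem isAdj_X (A : Model V p q) (B : Model W p' q') (hV : IsIrrep V (p + 1) (q + 1))
    (hW : IsIrrep W (p' + 1) (q' + 1)) : IsAdj V W X X := by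
  have hc : ∀ a b : ℕ, starRingEnd ℂ (casimirLValue a b) = casimirLValue a b := fun a b => by
    simp [casimirLValue, Complex.conj_ofNat]
  have h0 : IsAdj V W (leg 0 casimirL) (leg 0 casimirL) := isAdj_of_smul (act_leg_zero_eq_smul
    (actU_eq_smul hV eU_commute_casimirL fun v hv => actU_casimirL_of_mem hv)) (hc _ _)
  have h1 : IsAdj V W (leg 1 casimirL) (leg 1 casimirL) := isAdj_of_smul (act_leg_one_eq_smul
    (actU_eq_smul hW eU_commute_casimirL fun v hv => actU_casimirL_of_mem hv)) (hc _ _)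
  exact (((isAdj_T112 A B).sub (isAdj_T122 A B)).smul (by simp [Complex.conj_ofNat])).add ((h0.sub h1).smul (by simp [Complex.conj_ofNat]))

theorem isAdj_Y (A : Model V p q) (B : Model W p' q') (hV : IsIrrep V (p + 1) (q + 1))
    (hW : IsIrrep W (p' + 1) (q' + 1)) : IsAdj V W Y Y := by
  have hc : ∀ a b : ℕ, starRingEnd ℂ (casimirValue a b) = casimirValue a b := fun a b => by
    simp [casimirValue, Complex.conj_ofNat]
  have h0 := act_leg_zero_eq_smul (W := W)
    (actU_eq_smul hV eU_commute_casimir fun v hv => actU_casimir_of_mem hv)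
  have h1 := act_leg_one_eq_smul (V := V)
    (actU_eq_smul hW eU_commute_casimir fun v hv => actU_casimir_of_mem hv)
  have h2 : IsAdj V W (T ![0, 0] * T ![1, 1]) (T ![0, 0] * T ![1, 1]) :=
    isAdj_of_smul (c := casimirValue (p' + 1 : ℕ) (q' + 1 : ℕ) *
      casimirValue (p + 1 : ℕ) (q + 1 : ℕ)) (fun x => by
      rw [T_two_same, T_two_same, map_mul, Module.End.mul_apply, h1, map_smul, h0, mul_smul])
      (by rw [map_mul, hc, hc])
  have h3 : IsAdj V W (T ![0, 1] ^ 2) (T ![0, 1] ^ 2) := by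
    rw [pow_two]; exact (isAdj_T12 A B).mul (isAdj_T12 A B)
  exact (((((isAdj_T1122 A B).add (isAdj_Tbar1122 A B)).smul (by simp [Complex.conj_ofNat])).sub
    (h3.smul (by simp [Complex.conj_ofNat]))).sub (h2.smul (by simp [Complex.conj_ofNat]))).sub ((isAdj_T12 A B).smul (by simp [Complex.conj_ofNat]))

end Model
end Adjoint
end MissingLabel
end

noncomputable section

namespace MissingLabel

/-! ### The tridiagonal matrices -/

section Tridiagonal

/-- `a_{j,j+1}` as a function of `B = j + ξ_b`. -/
def upProd (ξ : Fin 6 → ℂ) (B : ℂ) : ℂ := (B - ξ 0) * (B - ξ 1) * (B - ξ 2)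

/-- `a_{j+1,j}` as a function of `B = j + ξ_b`. -/
def lowProd (ξ : Fin 6 → ℂ) (B : ℂ) : ℂ := (B - ξ 3) * (B - ξ 4) * (B - ξ 5)

/-- The matrix of `X`, with rows and columns counted from `0`. -/
def triX (ξ : Fin 6 → ℂ) (L B : ℂ) (n : ℕ) : Matrix (Fin n) (Fin n) ℂ :=
  Matrix.of fun i j =>
    if (i : ℕ) = j then diagX (powerSum ξ (B + i + 1)) L
    else if (j : ℕ) = i + 1 then upProd ξ (B + i + 1)
    else if (i : ℕ) = j + 1 then lowProd ξ (B + j + 1)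
    else 0

/-- The matrix of `Y`, with rows and columns counted from `0`. -/
def triY (ξ : Fin 6 → ℂ) (L B : ℂ) (n : ℕ) : Matrix (Fin n) (Fin n) ℂ :=
  Matrix.of fun i j =>
    if (i : ℕ) = j then diagY (powerSum ξ (B + i + 1)) L
    else if (j : ℕ) = i + 1 then
      upProd ξ (B + i + 1) * (B + i + 1 - (-L / 2 + (∑ i, ξ i) / 6))
    else if (i : ℕ) = j + 1 then
      lowProd ξ (B + j + 1) * (B + j + 1 - (L / 2 + (∑ i, ξ i) / 6))
    else 0

variable {ξ : Fin 6 → ℂ} {L B : ℂ}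

theorem conj_powerSum (hξ : ∀ i, starRingEnd ℂ (ξ i) = ξ i) (hB : starRingEnd ℂ B = B) (k : ℕ) :
    starRingEnd ℂ (powerSum ξ B k) = powerSum ξ B k := by
  simp [powerSum, hξ, hB, Complex.conj_ofNat]

theorem conj_triX (hξ : ∀ i, starRingEnd ℂ (ξ i) = ξ i) (hL : starRingEnd ℂ L = L)
    (hB : starRingEnd ℂ B = B) {n : ℕ} (i j : Fin n) :
    starRingEnd ℂ (triX ξ L B n i j) = triX ξ L B n i j := by
  have h : ∀ m : ℕ, starRingEnd ℂ (B + m + 1) = B + m + 1 := fun m => by simp [hB]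
  simp only [triX, Matrix.of_apply, apply_ite (starRingEnd ℂ), upProd, lowProd, diagX, map_sub,
    map_mul, map_add, map_neg, map_div₀, map_pow, conj_powerSum hξ (h _), hξ, hL, hB, map_one,
    map_zero, Complex.conj_ofNat, Complex.conj_natCast]

theorem conj_triY (hξ : ∀ i, starRingEnd ℂ (ξ i) = ξ i) (hL : starRingEnd ℂ L = L)
    (hB : starRingEnd ℂ B = B) {n : ℕ} (i j : Fin n) :
    starRingEnd ℂ (triY ξ L B n i j) = triY ξ L B n i j := by
  have h : ∀ m : ℕ, starRingEnd ℂ (B + m + 1) = B + m + 1 := fun m => by simp [hB]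
  simp only [triY, Matrix.of_apply, apply_ite (starRingEnd ℂ), upProd, lowProd, diagY, map_sub,
    map_mul, map_add, map_neg, map_div₀, map_pow, map_sum, conj_powerSum hξ (h _), hξ, hL, hB,
    map_one, map_zero, Complex.conj_ofNat, Complex.conj_natCast]

end Tridiagonal

/-! ### `X` and `Y` on the family of leading monomials -/

section Monomials

/-- The exponents of the leading components of highest-weight vectors. -/
def chartExpo (p' q' : ℕ) (N K b : ℤ) : Expo := (p' - b, b, N - 1 - b, q' - K - (N - 1 - b), K)

theorem chartExpo_inj {p' q' : ℕ} {N K b b' : ℤ} :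
    chartExpo p' q' N K b = chartExpo p' q' N K b' ↔ b = b' :=
  ⟨fun h => (Prod.ext_iff.1 (Prod.ext_iff.1 h).2).1, fun h => by rw [h]⟩

/-- The sequence `ξ` when `n ≤ ℓ`, with `N = n` and `K = ℓ - n`. -/
def coreξ (p q p' q' : ℕ) (N K : ℤ) : Fin 6 → ℂ :=
  ![N, p' + 1, q + 1 - K, N + K - (q' + 1), N - (p + 1), 0]

/-- `Λ` when `n ≤ ℓ`, with `N = n`. -/
def coreLam (p q p' q' : ℕ) (N : ℤ) : ℂ := p + q + p' + q' + 4 - N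

theorem chartξ_eq (p q p' q' : ℕ) (N K b : ℤ) :
    chartξ (p + 1 : ℕ) (q + 1 : ℕ) (p' - b : ℤ) b (N - 1 - b : ℤ) (q' - K - (N - 1 - b) : ℤ) K =
      coreξ p q p' q' N K := by
  ext i
  fin_cases i <;> simp [chartξ, coreξ] <;> ring

theorem coreLam_eq (p q p' q' : ℕ) (N K b : ℤ) :
    ((p' - b : ℤ) : ℂ) + (q' - K - (N - 1 - b) : ℤ) + 1 + (p + 1 : ℕ) + (q + 1 : ℕ) + K =
      coreLam p q p' q' N := by
  rw [coreLam]; push_cast; ring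

theorem opX_mon (p q p' q' : ℕ) (N K b : ℤ) :
    opX chartOp (wt (p + 1 : ℕ) (q + 1 : ℕ)) (p + 1 : ℕ) (q + 1 : ℕ) (p' + 1 : ℕ) (q' + 1 : ℕ)
        (mon (chartExpo p' q' N K b)) =
      lowProd (coreξ p q p' q' N K) b • mon (chartExpo p' q' N K (b - 1))
        + diagX (powerSum (coreξ p q p' q' N K) (b + 1)) (coreLam p q p' q' N) •
          mon (chartExpo p' q' N K b)
        + upProd (coreξ p q p' q' N K) (b + 1) • mon (chartExpo p' q' N K (b + 1)) := by
  have h := (isChart (p' - b) b (N - 1 - b) (q' - K - (N - 1 - b)) K).opX_apply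
    (p + 1 : ℕ) (q + 1 : ℕ)
  have e1 : (((p' - b : ℤ) : ℂ) + b + 1) = (p' + 1 : ℕ) := by push_cast; ring
  have e2 : (((N - 1 - b : ℤ) : ℂ) + (q' - K - (N - 1 - b) : ℤ) + K + 1) = (q' + 1 : ℕ) := by
    push_cast; ring
  rw [e1, e2, chartξ_eq, coreLam_eq] at h
  have m0 : mon (p' - b - 0, b + 0, N - 1 - b + 0, q' - K - (N - 1 - b) - 0 - 0, K + 0) =
      mon (chartExpo p' q' N K b) := by simp [chartExpo]
  have m1 : mon (p' - b - -1, b + -1, N - 1 - b + 1, q' - K - (N - 1 - b) - 1 - 0, K + 0) =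
      mon (chartExpo p' q' N K (b - 1)) := by
    rw [chartExpo]; congr 1; ext <;> simp <;> ring
  have m2 : mon (p' - b - 1, b + 1, N - 1 - b + -1, q' - K - (N - 1 - b) - -1 - 0, K + 0) =
      mon (chartExpo p' q' N K (b + 1)) := by
    rw [chartExpo]; congr 1; ext <;> simp <;> ring
  rw [m0, m1, m2] at h
  rw [h]
  congr 2
  · congr 1
    simp [lowProd, coreξ, -mul_eq_mul_right_iff]; ring
  · simp [upProd, coreξ]; ring

theorem opY_mon (p q p' q' : ℕ) (N K b : ℤ) :
    opY chartOp (wt (p + 1 : ℕ) (q + 1 : ℕ)) (p + 1 : ℕ) (q + 1 : ℕ) (p' + 1 : ℕ) (q' + 1 : ℕ)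
        (mon (chartExpo p' q' N K b)) =
      (lowProd (coreξ p q p' q' N K) b * (b - (coreLam p q p' q' N / 2 +
          (∑ i, coreξ p q p' q' N K i) / 6))) • mon (chartExpo p' q' N K (b - 1))
        + diagY (powerSum (coreξ p q p' q' N K) (b + 1)) (coreLam p q p' q' N) •
          mon (chartExpo p' q' N K b)
        + (upProd (coreξ p q p' q' N K) (b + 1) * (b + 1 - (-coreLam p q p' q' N / 2 +
          (∑ i, coreξ p q p' q' N K i) / 6))) • mon (chartExpo p' q' N K (b + 1)) := by
  have h := (isChart (p' - b) b (N - 1 - b) (q' - K - (N - 1 - b)) K).opY_apply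
    (p + 1 : ℕ) (q + 1 : ℕ)
  have e1 : (((p' - b : ℤ) : ℂ) + b + 1) = (p' + 1 : ℕ) := by push_cast; ring
  have e2 : (((N - 1 - b : ℤ) : ℂ) + (q' - K - (N - 1 - b) : ℤ) + K + 1) = (q' + 1 : ℕ) := by
    push_cast; ring
  rw [e1, e2, chartξ_eq, coreLam_eq] at h
  have m0 : mon (p' - b - 0, b + 0, N - 1 - b + 0, q' - K - (N - 1 - b) - 0 - 0, K + 0) =
      mon (chartExpo p' q' N K b) := by simp [chartExpo]
  have m1 : mon (p' - b - -1, b + -1, N - 1 - b + 1, q' - K - (N - 1 - b) - 1 - 0, K + 0) =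
      mon (chartExpo p' q' N K (b - 1)) := by
    rw [chartExpo]; congr 1; ext <;> simp <;> ring
  have m2 : mon (p' - b - 1, b + 1, N - 1 - b + -1, q' - K - (N - 1 - b) - -1 - 0, K + 0) =
      mon (chartExpo p' q' N K (b + 1)) := by
    rw [chartExpo]; congr 1; ext <;> simp <;> ring
  rw [m0, m1, m2] at h
  rw [h]
  congr 2
  · congr 2
    simp [lowProd, coreξ, -mul_eq_mul_right_iff]; ring
  · congr 1
    simp [upProd, coreξ]; ring

end Monomials

/-- The three-term action produces lower entries written through the row index, whereas `triX` and
`triY` use the column index; the hypothesis `hl` reconciles them where they are needed. -/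
theorem sum_ite_tridiagonal (i j : ℕ) {d u l l' : ℂ} (hl : i = j + 1 → l = l') :
    (if (i : ℤ) - 1 = j then l else 0) + (if (i : ℤ) = j then d else 0)
      + (if (i : ℤ) + 1 = j then u else 0) =
      if i = j then d else if j = i + 1 then u else if i = j + 1 then l' else 0 := by
  split_ifs with h1 h2 h3 h4 h5 h6 <;> first
    | (exfalso; omega)
    | (simp only [add_zero, zero_add]; done)
    | (simp only [add_zero]; exact hl (by omega))

/-! ### Dual bases for a Hermitian form -/

section Dual

variable {E : Type*} [AddCommGroup E] [Module ℂ E] {n : ℕ}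

/-- In the basis dual to a given one for a Hermitian form, symmetric operators have the conjugate
transposed matrices. -/
theorem exists_dual_basis (φ : E → E →ₗ[ℂ] ℂ) (hφ : ∀ x y, starRingEnd ℂ (φ y x) = φ x y)
    (hdef : ∀ x, φ x x = 0 → x = 0) (β : Module.Basis (Fin n) ℂ E) :
    ∃ γ : Module.Basis (Fin n) ℂ E, ∀ f : E →ₗ[ℂ] E, (∀ x y, φ (f x) y = φ x (f y)) →
      ∀ i j, LinearMap.toMatrix γ γ f i j = starRingEnd ℂ (LinearMap.toMatrix β β f j i) := by
  -- The dual basis is defined through its coordinate functionals `φ (β i)`; definiteness of the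
  -- form makes these separate points.
  let F : E →ₗ[ℂ] Fin n → ℂ := LinearMap.pi fun i => φ (β i)
  have hF : Function.Injective F := by
    rw [← LinearMap.ker_eq_bot, eq_bot_iff]
    intro x hx
    have hx' : F x = 0 := hx
    have h0 : φ x = 0 := β.ext fun i => by
      have h1 : φ (β i) x = 0 := congrFun hx' i
      rw [← hφ, h1, map_zero, LinearMap.zero_apply]
    exact hdef x (by rw [h0, LinearMap.zero_apply])
  have : FiniteDimensional ℂ E := β.finiteDimensional_of_finite
  let γ := Module.Basis.ofEquivFun (LinearEquiv.ofInjectiveOfFinrankEq F hF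
    (by rw [Module.finrank_eq_card_basis β]; simp))
  have h : ∀ x i, γ.repr x i = φ (β i) x := fun x i => rfl
  refine ⟨γ, fun f hf i j => ?_⟩
  rw [LinearMap.toMatrix_apply, LinearMap.toMatrix_apply, h, ← hf, ← hφ]
  conv_lhs => rw [← β.sum_repr (f (β i))]
  rw [map_sum, Finset.sum_eq_single j]
  · rw [map_smul, smul_eq_mul, map_mul, hφ, ← h, γ.repr_self, Finsupp.single_eq_same, mul_one]
  · intro k _ hk
    rw [map_smul, smul_eq_mul, ← hφ, ← h, γ.repr_self, Finsupp.single_eq_of_ne hk, map_zero,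
      mul_zero]
  · simp

end Dual

/-! ### Bases of the multiplicity space when `n ≤ ℓ` -/

section Basis

variable {V W : Type*} [NormedAddCommGroup V] [InnerProductSpace ℂ V] [LieRingModule Sl3 V]
  [LieModule ℂ Sl3 V] [NormedAddCommGroup W] [InnerProductSpace ℂ W] [LieRingModule Sl3 W]
  [LieModule ℂ Sl3 W] {p q p' q' : ℕ} [FiniteDimensional ℂ V] [FiniteDimensional ℂ W]

namespace Model

variable {r s : ℕ} {N K lo : ℤ} {n : ℕ}

/-- When `n ≤ ℓ`, the highest-weight vectors with monomial leading components form a basis. -/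
theorem exists_monomial_basis (A : Model V p q) (B : Model W p' q')
    (hV : IsIrrep V (p + 1) (q + 1)) (hW : IsIrrep W (p' + 1) (q' + 1))
    (hK : 3 * K = r - s + q - p - p' + q')
    (hN : 3 * N = 2 * p + q + 2 * p' + q' - 2 * r - s + 6) (hK0 : 0 ≤ K)
    (hb : ∀ b : ℤ, lo ≤ b ∧ b < lo + n ↔ N + K - (q' + 1) ≤ b ∧ N - (p + 1) ≤ b ∧ 0 ≤ b ∧
      b < N ∧ b < p' + 1 ∧ b < q + 1 - K) :
    ∃ β : Module.Basis (Fin n) ℂ (highestWeightSpace (V ⊗[ℂ] W) r s),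
      (∀ i, A.lead B (β i : V ⊗[ℂ] W) = mon (chartExpo p' q' N K (lo + i))) ∧
      ∀ u i, β.repr u i = (A.lead B (u : V ⊗[ℂ] W)).coeff (chartExpo p' q' N K (lo + i)) := by
  classical
  have := hV.irreducible
  have := hW.irreducible
  have hex : ∀ i : Fin n, ∃ u ∈ highestWeightSpace (V ⊗[ℂ] W) r s,
      A.lead B u = mon (chartExpo p' q' N K (lo + i)) := fun i => by
    have h := (hb (lo + i)).1 (by omega)
    exact A.exists_lead_eq_mon B hK (by omega) (by omega) (by omega) (by omega) (by omega)
      (by omega) (by omega) hK0 (by omega) (by omega)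
  choose v hvM hv using hex
  have hcoeff : ∀ (g : Fin n → ℂ) (i : Fin n),
      (∑ j, g j • mon (chartExpo p' q' N K (lo + j))).coeff (chartExpo p' q' N K (lo + i)) =
        g i := by
    intro g i
    rw [AddMonoidAlgebra.coeff_sum, Finsupp.finsetSum_apply, Finset.sum_eq_single i]
    · rw [AddMonoidAlgebra.coeff_smul_apply, coeff_mon, if_pos rfl, smul_eq_mul, mul_one]
    · intro j _ hj
      rw [AddMonoidAlgebra.coeff_smul_apply, coeff_mon, if_neg, smul_zero]
      rw [chartExpo_inj]
      exact fun h => hj (Fin.ext (by omega))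
    · simp
  -- The weight equations put every exponent of a leading component in the form `chartExpo`, and the
  -- six inequalities confine `b` to the interval of length `n` starting at `lo`.
  have hsum : ∀ u ∈ highestWeightSpace (V ⊗[ℂ] W) r s, A.lead B u =
      ∑ j : Fin n, (A.lead B u).coeff (chartExpo p' q' N K (lo + j)) •
        mon (chartExpo p' q' N K (lo + j)) := by
    intro u hu
    ext ⟨a, b, c, d, k⟩
    by_cases hz : ∃ i : Fin n, (a, b, c, d, k) = chartExpo p' q' N K (lo + i)
    · obtain ⟨i, hi⟩ := hz
      rw [hi, hcoeff]
    · have h0 : (A.lead B u).coeff (a, b, c, d, k) = 0 := by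
        by_contra hne
        apply hz
        obtain ⟨h1, h2⟩ := B.exponent_of_J hne
        obtain ⟨h3, h4⟩ := A.exponent_of_lead_weight B hu hne
        obtain ⟨h5, h6, h7⟩ := A.exponent_of_lead B hu hne
        have h8 := (hb b).2 (by omega)
        refine ⟨⟨(b - lo).toNat, by omega⟩, ?_⟩
        have h9 : lo + ((b - lo).toNat : ℤ) = b := by omega
        rw [chartExpo, h9]
        ext <;> simp <;> omega
      rw [h0, AddMonoidAlgebra.coeff_sum, Finsupp.finsetSum_apply]
      refine (Finset.sum_eq_zero fun j _ => ?_).symm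
      rw [AddMonoidAlgebra.coeff_smul_apply, coeff_mon, if_neg, smul_zero]
      exact fun h => hz ⟨j, h.symm⟩
  let w : Fin n → highestWeightSpace (V ⊗[ℂ] W) r s := fun i => ⟨v i, hvM i⟩
  have hli : LinearIndependent ℂ w := by
    rw [Fintype.linearIndependent_iff]
    intro g hg i
    have h1 := congrArg (fun u : highestWeightSpace (V ⊗[ℂ] W) r s => A.lead B u) hg
    simp only [Submodule.coe_sum, Submodule.coe_smul, map_sum, map_smul, w, hv,
      Submodule.coe_zero, map_zero] at h1
    rw [← hcoeff g i, h1]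
    rfl
  have hspan : ⊤ ≤ Submodule.span ℂ (Set.range w) := by
    rintro u -
    have h1 : u = ∑ j : Fin n, (A.lead B (u : V ⊗[ℂ] W)).coeff (chartExpo p' q' N K (lo + j)) • w j := by
      rw [← sub_eq_zero]
      apply Subtype.ext
      have hm := (u - ∑ j : Fin n, (A.lead B (u : V ⊗[ℂ] W)).coeff
        (chartExpo p' q' N K (lo + j)) • w j).2
      refine A.eq_zero_of_lead B (mem_highestWeightSpace_iff.1 hm).2 ?_
      simp only [Submodule.coe_sub, Submodule.coe_sum, Submodule.coe_smul, map_sub, map_sum,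
        map_smul, w, hv]
      rw [sub_eq_zero]
      exact hsum u u.2
    rw [h1]
    exact Submodule.sum_mem _ fun j _ => Submodule.smul_mem _ _ (Submodule.subset_span ⟨j, rfl⟩)
  refine ⟨Module.Basis.mk hli hspan, fun i => ?_, fun u i => ?_⟩
  · rw [Module.Basis.mk_apply]; exact hv i
  · have h1 := congrArg (fun u : highestWeightSpace (V ⊗[ℂ] W) r s => A.lead B u)
      ((Module.Basis.mk hli hspan).sum_repr u)
    simp only [Submodule.coe_sum, Submodule.coe_smul, map_sum, map_smul, w, hv,
      Module.Basis.mk_apply] at h1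
    rw [← h1, hcoeff]

/-- In the monomial basis the coefficient leading from `b` to `b + 1` stands below the diagonal,
whereas the required matrix has it above. Passing to the dual basis transposes the matrix of a
self-adjoint operator, and the conjugation is harmless because all entries are real. -/
theorem exists_tridiagonal_basis (A : Model V p q) (B : Model W p' q')
    (hV : IsIrrep V (p + 1) (q + 1)) (hW : IsIrrep W (p' + 1) (q' + 1))
    (hK : 3 * K = r - s + q - p - p' + q')
    (hN : 3 * N = 2 * p + q + 2 * p' + q' - 2 * r - s + 6) (hK0 : 0 ≤ K)
    (hb : ∀ b : ℤ, lo ≤ b ∧ b < lo + n ↔ N + K - (q' + 1) ≤ b ∧ N - (p + 1) ≤ b ∧ 0 ≤ b ∧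
      b < N ∧ b < p' + 1 ∧ b < q + 1 - K)
    (hX : ∀ v ∈ highestWeightSpace (V ⊗[ℂ] W) r s,
      act V W X v ∈ highestWeightSpace (V ⊗[ℂ] W) r s)
    (hY : ∀ v ∈ highestWeightSpace (V ⊗[ℂ] W) r s,
      act V W Y v ∈ highestWeightSpace (V ⊗[ℂ] W) r s) :
    ∃ γ : Module.Basis (Fin n) ℂ (highestWeightSpace (V ⊗[ℂ] W) r s),
      LinearMap.toMatrix γ γ ((act V W X).restrict hX) =
        triX (coreξ p q p' q' N K) (coreLam p q p' q' N) lo n ∧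
      LinearMap.toMatrix γ γ ((act V W Y).restrict hY) =
        triY (coreξ p q p' q' N K) (coreLam p q p' q' N) lo n := by
  classical
  obtain ⟨β, hβ, hβr⟩ := A.exists_monomial_basis B hV hW hK hN hK0 hb
  obtain ⟨γ, hγ⟩ :=
    exists_dual_basis (fun x : highestWeightSpace (V ⊗[ℂ] W) r s =>
      (innerₛₗ ℂ (x : V ⊗[ℂ] W)).comp (Submodule.subtype _))
      (fun x y => inner_conj_symm (x : V ⊗[ℂ] W) (y : V ⊗[ℂ] W))
      (fun x hx => Subtype.ext (inner_self_eq_zero.1 hx)) β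
  have hξ : ∀ i, starRingEnd ℂ (coreξ p q p' q' N K i) = coreξ p q p' q' N K i := fun i => by
    fin_cases i <;> simp [coreξ]
  have hL : starRingEnd ℂ (coreLam p q p' q' N) = coreLam p q p' q' N := by
    simp [coreLam, Complex.conj_ofNat]
  have hlo : starRingEnd ℂ (lo : ℂ) = lo := by simp
  have hu : ∀ i, ∀ j k : Fin 3, j < k → ⁅e j k, (β i : V ⊗[ℂ] W)⁆ = 0 := fun i =>
    (mem_highestWeightSpace_iff.1 (β i).2).2
  have hc : ∀ i j : Fin n, ∀ x : ℤ, (mon (chartExpo p' q' N K (lo + j + x))).coeff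
      (chartExpo p' q' N K (lo + i)) = if (j + x : ℤ) = i then 1 else 0 := fun i j x => by
    rw [coeff_mon]
    simp only [chartExpo_inj]
    exact if_congr (by omega) rfl rfl
  have hc0 := fun i j => hc i j 0
  have hc1 := fun i j => hc i j 1
  have hc2 := fun i j => hc i j (-1)
  simp only [add_zero, ← sub_eq_add_neg] at hc0 hc1 hc2
  refine ⟨γ, ?_, ?_⟩
  · ext i j
    rw [hγ ((act V W X).restrict hX) fun x y => A.isAdj_X B hV hW x.1 y.1,
      ← conj_triX hξ hL hlo,
      LinearMap.toMatrix_apply, hβr, LinearMap.coe_restrict_apply, A.lead_X B (hu i) hV hW, hβ,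
      opX_mon]
    congr 1
    simp only [AddMonoidAlgebra.coeff_add, Finsupp.add_apply, AddMonoidAlgebra.coeff_smul_apply,
      hc0, hc1, hc2, triX, Matrix.of_apply, smul_eq_mul, mul_ite, mul_one, mul_zero]
    have hcast : ((lo + i : ℤ) : ℂ) = lo + i := by push_cast; rfl
    rw [hcast]
    exact sum_ite_tridiagonal i j fun h => by rw [h, Nat.cast_add_one, add_assoc]
  · ext i j
    rw [hγ ((act V W Y).restrict hY) fun x y => A.isAdj_Y B hV hW x.1 y.1,
      ← conj_triY hξ hL hlo,
      LinearMap.toMatrix_apply, hβr, LinearMap.coe_restrict_apply, A.lead_Y B (hu i) hV hW, hβ,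
      opY_mon]
    congr 1
    simp only [AddMonoidAlgebra.coeff_add, Finsupp.add_apply, AddMonoidAlgebra.coeff_smul_apply,
      hc0, hc1, hc2, triY, Matrix.of_apply, smul_eq_mul, mul_ite, mul_one, mul_zero]
    have hcast : ((lo + i : ℤ) : ℂ) = lo + i := by push_cast; rfl
    rw [hcast]
    exact sum_ite_tridiagonal i j fun h => by rw [h, Nat.cast_add_one, add_assoc]

end Model
end Basis
end MissingLabel
end

noncomputable section

namespace MissingLabel

/-! ### The diagram automorphism -/

section Twist

/-- The negative of the transpose of a traceless matrix along the antidiagonal. -/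
def antitranspose (x : Sl3) : Sl3 := ⟨- (x.1.submatrix Fin.rev Fin.rev).transpose, by
    have h : Matrix.trace x.1 = 0 := x.2
    change Matrix.trace (- (x.1.submatrix Fin.rev Fin.rev).transpose) = 0
    rw [Matrix.trace_neg, Matrix.trace_transpose, neg_eq_zero, ← h]
    exact Equiv.sum_comp Fin.revPerm fun i => x.1 i i⟩

theorem antitranspose_val (x : Sl3) :
    (antitranspose x).val = - (x.val.submatrix Fin.rev Fin.rev).transpose := rfl

/-- The automorphism `e_{pq} ↦ - e_{4-q,4-p}`. -/
def flipHom : Sl3 →ₗ⁅ℂ⁆ Sl3 where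
  toFun := antitranspose
  map_add' x y := by
    apply Subtype.ext
    ext i j
    simp [antitranspose]
    ring
  map_smul' c x := by
    apply Subtype.ext
    ext i j
    simp [antitranspose]
  map_lie' {x y} := by
    apply Subtype.ext
    have h : ∀ a b : Matrix (Fin 3) (Fin 3) ℂ, (a * b).submatrix Fin.rev Fin.rev =
        a.submatrix Fin.rev Fin.rev * b.submatrix Fin.rev Fin.rev := fun a b =>
      (Matrix.submatrix_mul_equiv a b Fin.rev Fin.revPerm Fin.rev).symm
    rw [LieAlgebra.SpecialLinear.sl_bracket, antitranspose_val, antitranspose_val,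
      antitranspose_val, LieAlgebra.SpecialLinear.sl_bracket, Matrix.submatrix_sub]
    rw [Pi.sub_apply, Pi.sub_apply, h, h, Matrix.transpose_sub, Matrix.transpose_mul,
      Matrix.transpose_mul]
    noncomm_ring

theorem flipHom_e (p q : Fin 3) : flipHom (e p q) = - e q.rev p.rev := by
  apply Subtype.ext
  ext i j
  change - (e p q).1 j.rev i.rev = - (e q.rev p.rev).1 i j
  fin_cases p <;> fin_cases q <;> fin_cases i <;> fin_cases j <;> simp [e, Matrix.single, Fin.rev]

theorem flipHom_flipHom (x : Sl3) : flipHom (flipHom x) = x := by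
  apply Subtype.ext
  ext i j
  change - - x.1 i.rev.rev j.rev.rev = x.1 i j
  simp

/-- A representation twisted by the diagram automorphism. -/
def Twist (V : Type*) : Type _ := V

variable (V W : Type*) [AddCommGroup V] [Module ℂ V] [LieRingModule Sl3 V] [LieModule ℂ Sl3 V]
  [AddCommGroup W] [Module ℂ W] [LieRingModule Sl3 W] [LieModule ℂ Sl3 W]

instance : AddCommGroup (Twist V) := inferInstanceAs (AddCommGroup V)
instance : Module ℂ (Twist V) := inferInstanceAs (Module ℂ V)
instance : LieRingModule Sl3 (Twist V) := LieRingModule.compLieHom V flipHom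
instance : LieModule ℂ Sl3 (Twist V) := LieModule.compLieHom V flipHom

/-- The identity map to the twisted representation. -/
def toTwist : V ≃ₗ[ℂ] Twist V := LinearEquiv.refl ℂ V

variable {V W}

theorem lie_toTwist (x : Sl3) (v : V) : ⁅x, toTwist V v⁆ = toTwist V ⁅flipHom x, v⁆ := rfl

/-- The automorphism exchanges `h₁` and `h₂` and permutes the raising operators up to sign, so the
two components of the weight are exchanged. -/
theorem mem_highestWeightSpace_flip {M M' : Type*} [AddCommGroup M] [Module ℂ M]
    [LieRingModule Sl3 M] [LieModule ℂ Sl3 M] [AddCommGroup M'] [Module ℂ M']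
    [LieRingModule Sl3 M'] [LieModule ℂ Sl3 M'] (σ : M ≃ₗ[ℂ] M')
    (hσ : ∀ x m, ⁅x, σ m⁆ = σ ⁅flipHom x, m⁆) {a b : ℕ} {m : M} :
    σ m ∈ highestWeightSpace M' b a ↔ m ∈ highestWeightSpace M a b := by
  have h1 : flipHom h₁ = h₂ := by rw [h₁, h₂, map_sub, flipHom_e, flipHom_e]; simp [Fin.rev]; abel
  have h2 : flipHom h₂ = h₁ := by rw [← h1, flipHom_flipHom]
  have h3 : ∀ p q, ⁅e p q, σ m⁆ = 0 ↔ ⁅e q.rev p.rev, m⁆ = 0 := fun p q => by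
    rw [hσ, flipHom_e, neg_lie, map_neg, neg_eq_zero, LinearEquiv.map_eq_zero_iff]
  change (_ ∧ _ ∧ _) ↔ (_ ∧ _ ∧ _)
  rw [hσ, hσ, h1, h2, ← map_smul, ← map_smul, σ.injective.eq_iff, σ.injective.eq_iff]
  constructor
  · rintro ⟨k1, k2, k3⟩
    refine ⟨k2, k1, fun p q hpq => ?_⟩
    have := (h3 q.rev p.rev).1 (k3 _ _ (Fin.rev_lt_rev.2 hpq))
    simpa using this
  · rintro ⟨k1, k2, k3⟩
    exact ⟨k2, k1, fun p q hpq => (h3 p q).2 (k3 _ _ (Fin.rev_lt_rev.2 hpq))⟩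

theorem IsIrrep.twist {a b : ℕ} (h : IsIrrep V a b) : IsIrrep (Twist V) b a where
  finiteDimensional := h.finiteDimensional
  irreducible := by
    have := h.irreducible
    have hnt : Nontrivial (LieSubmodule ℂ Sl3 (Twist V)) := by
      obtain ⟨v, hv⟩ := h.exists_highestWeight
      refine ⟨⊥, ⊤, fun h0 => hv.2 ?_⟩
      have h1 : toTwist V v ∈ (⊤ : LieSubmodule ℂ Sl3 (Twist V)) := LieSubmodule.mem_top _
      rw [← h0, LieSubmodule.mem_bot] at h1
      exact (LinearEquiv.map_eq_zero_iff _).1 h1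
    refine ⟨fun N => ?_⟩
    let N' : LieSubmodule ℂ Sl3 V :=
      { (N : Submodule ℂ (Twist V)).comap (toTwist V).toLinearMap with
        lie_mem := fun {x v} hv => by
          have h1 : toTwist V v ∈ N := hv
          have h2 : ⁅flipHom x, toTwist V v⁆ ∈ N := N.lie_mem h1
          rw [lie_toTwist, flipHom_flipHom] at h2
          exact h2 }
    have hN : ∀ v, v ∈ N' ↔ toTwist V v ∈ N := fun v => Iff.rfl
    rcases eq_bot_or_eq_top N' with h0 | h0
    · left
      rw [LieSubmodule.eq_bot_iff]
      intro v hv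
      have h1 : (toTwist V).symm v ∈ N' := (hN _).2 (by simpa using hv)
      rw [h0, LieSubmodule.mem_bot] at h1
      simpa using h1
    · right
      rw [eq_top_iff]
      intro v _
      have h1 : (toTwist V).symm v ∈ N' := by rw [h0]; exact LieSubmodule.mem_top _
      simpa using (hN _).1 h1
  exists_highestWeight := by
    obtain ⟨v, hv, hv0⟩ := h.exists_highestWeight
    exact ⟨toTwist V v, (mem_highestWeightSpace_flip (toTwist V) lie_toTwist).2 hv,
      fun h0 => hv0 ((LinearEquiv.map_eq_zero_iff _).1 h0)⟩

variable (V W) in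
/-- The identity map between tensor products. -/
def tensorTwist : V ⊗[ℂ] W ≃ₗ[ℂ] Twist V ⊗[ℂ] Twist W :=
  TensorProduct.congr (toTwist V) (toTwist W)

theorem lie_tensorTwist (x : Sl3) (t : V ⊗[ℂ] W) :
    ⁅x, tensorTwist V W t⁆ = tensorTwist V W ⁅flipHom x, t⁆ := by
  induction t with
  | zero => simp
  | tmul v w =>
    simp [tensorTwist, TensorProduct.LieModule.lie_tmul_right, lie_toTwist]
  | add s t hs ht => rw [map_add, lie_add, hs, ht, lie_add, map_add]

theorem act_tensorTwist_eLeg (a : Fin 2) (i j : Fin 3) (t : V ⊗[ℂ] W) :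
    act (Twist V) (Twist W) (eLeg a i j) (tensorTwist V W t) =
      - tensorTwist V W (act V W (eLeg a j.rev i.rev) t) := by
  induction t with
  | zero => simp
  | tmul v w =>
    rw [tensorTwist, TensorProduct.congr_tmul, act_eLeg_tmul, act_eLeg_tmul]
    split_ifs
    · rw [lie_toTwist, flipHom_e, neg_lie, map_neg, TensorProduct.neg_tmul, TensorProduct.congr_tmul]
    · rw [lie_toTwist, flipHom_e, neg_lie, map_neg, TensorProduct.tmul_neg, TensorProduct.congr_tmul]
  | add s t hs ht => rw [map_add, map_add, hs, ht, map_add, map_add, neg_add]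

end Twist
end MissingLabel
end

noncomputable section

namespace MissingLabel

/-! ### Polarised traces under the diagram automorphism -/

section FlipTraces

theorem sum_eLeg (a : Fin 2) : ∑ j, eLeg a j j = 0 := by
  have h : ∑ j, eU j j = 0 := by
    simp only [eU, ← map_sum, sum_e, map_zero]
  simp only [eLeg, ← map_sum, h, map_zero]

/-- Reversing the order of a product of two matrices of generators of the same factor costs the
commutators, whose sum is `3 e_{ik}` because `∑ e_{jj} = 0`. -/
theorem sum_eLeg_mul (a : Fin 2) (i k : Fin 3) : ∑ j, eLeg a i j * eLeg a j k =
    ∑ j, eLeg a j k * eLeg a i j + (3 : ℂ) • eLeg a i k := by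
  have h : ∀ j, eLeg a i j * eLeg a j k = eLeg a j k * eLeg a i j
      + (eLeg a i k - if k = i then eLeg a j j else 0) := fun j => by
    have h1 := eLeg_commutator a i j j k
    rw [if_pos rfl] at h1
    exact sub_eq_iff_eq_add'.1 h1
  simp only [h, Finset.sum_add_distrib, Finset.sum_sub_distrib]
  congr 1
  split_ifs with h1
  · rw [sum_eLeg, sub_zero, Fin.sum_univ_three]; module
  · rw [Finset.sum_const_zero, sub_zero, Fin.sum_univ_three]; module

theorem sum_bar_112 : ∑ i, ∑ j, ∑ k, eLeg 0 i j * eLeg 0 j k * eLeg 1 k i =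
    T ![0, 0, 1] + (3 : ℂ) • T ![0, 1] := by
  rw [sum_trace_three, T_three, sum_trace_three (fun i j => eLeg 0 j i) (fun j k => eLeg 0 k j)
    (fun k i => eLeg 1 i k), T_two, Finset.sum_comm (f := fun i k => (∑ j, eLeg 0 j i *
    eLeg 0 k j) * eLeg 1 i k), Finset.sum_comm (f := fun i j => eLeg 0 j i * eLeg 1 i j)]
  simp only [sum_eLeg_mul, add_mul, Finset.sum_add_distrib, smul_mul_assoc, Finset.smul_sum]

theorem sum_bar_122 : ∑ i, ∑ j, ∑ k, eLeg 0 i j * eLeg 1 j k * eLeg 1 k i =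
    T ![0, 1, 1] + (3 : ℂ) • T ![0, 1] := by
  rw [T_three, T_two, Finset.sum_comm (f := fun i j => ∑ k, eLeg 0 j i * eLeg 1 k j * eLeg 1 i k),
    Finset.sum_comm (f := fun i j => eLeg 0 j i * eLeg 1 i j)]
  simp only [mul_assoc, ← Finset.mul_sum, sum_eLeg_mul, mul_add, Finset.sum_add_distrib,
    mul_smul_comm, Finset.smul_sum]

theorem sum_rev {β : Type*} [AddCommMonoid β] (f : Fin 3 → β) : ∑ i : Fin 3, f i.rev = ∑ i, f i :=
  Equiv.sum_comp Fin.revPerm f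

theorem sum_rev_two {β : Type*} [AddCommMonoid β] (f : Fin 3 → Fin 3 → β) :
    ∑ i : Fin 3, ∑ j : Fin 3, f i.rev j.rev = ∑ i, ∑ j, f i j :=
  (sum_rev fun i => ∑ j : Fin 3, f i j.rev).trans (Finset.sum_congr rfl fun i _ => sum_rev (f i))

theorem sum_rev_three {β : Type*} [AddCommMonoid β] (f : Fin 3 → Fin 3 → Fin 3 → β) :
    ∑ i : Fin 3, ∑ j : Fin 3, ∑ k : Fin 3, f i.rev j.rev k.rev = ∑ i, ∑ j, ∑ k, f i j k :=
  (sum_rev fun i => ∑ j : Fin 3, ∑ k : Fin 3, f i j.rev k.rev).trans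
    (Finset.sum_congr rfl fun i _ => sum_rev_two (f i))

theorem sum_rev_four {β : Type*} [AddCommMonoid β] (f : Fin 3 → Fin 3 → Fin 3 → Fin 3 → β) :
    ∑ i : Fin 3, ∑ j : Fin 3, ∑ k : Fin 3, ∑ s : Fin 3, f i.rev j.rev k.rev s.rev =
      ∑ i, ∑ j, ∑ k, ∑ s, f i j k s :=
  (sum_rev fun i => ∑ j : Fin 3, ∑ k : Fin 3, ∑ s : Fin 3, f i j.rev k.rev s.rev).trans
    (Finset.sum_congr rfl fun i _ => sum_rev_three (f i))

variable {V W : Type*} [AddCommGroup V] [Module ℂ V] [LieRingModule Sl3 V] [LieModule ℂ Sl3 V]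
  [AddCommGroup W] [Module ℂ W] [LieRingModule Sl3 W] [LieModule ℂ Sl3 W]

/-- The action of `z` on a twisted tensor product is the action of `z'` on the original one. -/
def IsFlip (V W : Type*) [AddCommGroup V] [Module ℂ V] [LieRingModule Sl3 V] [LieModule ℂ Sl3 V]
    [AddCommGroup W] [Module ℂ W] [LieRingModule Sl3 W] [LieModule ℂ Sl3 W]
    (z z' : U ⊗[ℂ] U) : Prop :=
  ∀ t, act (Twist V) (Twist W) z (tensorTwist V W t) = tensorTwist V W (act V W z' t)

theorem isFlip_eLeg (a : Fin 2) (i j : Fin 3) :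
    IsFlip V W (eLeg a i j) (- eLeg a j.rev i.rev) := fun t => by
  rw [act_tensorTwist_eLeg, map_neg, LinearMap.neg_apply, map_neg]

theorem IsFlip.mul {z z' w w' : U ⊗[ℂ] U} (hz : IsFlip V W z z') (hw : IsFlip V W w w') :
    IsFlip V W (z * w) (z' * w') := fun t => by
  rw [map_mul, Module.End.mul_apply, hw, hz, map_mul, Module.End.mul_apply]

theorem IsFlip.sum {ι : Type*} {s : Finset ι} {f g : ι → U ⊗[ℂ] U}
    (h : ∀ i ∈ s, IsFlip V W (f i) (g i)) :
    IsFlip V W (∑ i ∈ s, f i) (∑ i ∈ s, g i) := fun t => by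
  simp only [map_sum, LinearMap.sum_apply]
  exact Finset.sum_congr rfl fun i hi => h i hi t

theorem IsFlip.add {z z' w w' : U ⊗[ℂ] U} (hz : IsFlip V W z z') (hw : IsFlip V W w w') :
    IsFlip V W (z + w) (z' + w') := fun t => by
  rw [map_add, LinearMap.add_apply, hw, hz, map_add, LinearMap.add_apply, map_add]

theorem IsFlip.sub {z z' w w' : U ⊗[ℂ] U} (hz : IsFlip V W z z') (hw : IsFlip V W w w') :
    IsFlip V W (z - w) (z' - w') := fun t => by
  rw [map_sub, LinearMap.sub_apply, hw, hz, map_sub, LinearMap.sub_apply, map_sub]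

theorem IsFlip.smul {z z' : U ⊗[ℂ] U} (hz : IsFlip V W z z') (c : ℂ) :
    IsFlip V W (c • z) (c • z') := fun t => by
  rw [map_smul, LinearMap.smul_apply, hz, map_smul, LinearMap.smul_apply, map_smul]

theorem isFlip_T12 : IsFlip V W (T ![0, 1]) (T ![0, 1]) := by
  have h : IsFlip V W (∑ i, ∑ j, eLeg 0 j i * eLeg 1 i j) (∑ i : Fin 3, ∑ j : Fin 3,
      (- eLeg 0 i.rev j.rev) * (- eLeg 1 j.rev i.rev)) :=
    IsFlip.sum fun i _ => IsFlip.sum fun j _ => (isFlip_eLeg 0 j i).mul (isFlip_eLeg 1 i j)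
  rw [sum_rev_two (fun i j => (- eLeg 0 i j) * (- eLeg 1 j i)), Finset.sum_comm
    (f := fun i j => (- eLeg 0 i j) * (- eLeg 1 j i))] at h
  simp only [neg_mul_neg] at h
  rwa [← T_two] at h

/-- The automorphism transposes the index pattern and gives the sign `(-1)³`; restoring the original
order adds `3 T^{(1,2)}`. The same correction occurs for `T^{(1,2,2)}`, so it cancels in `X`. -/
theorem isFlip_T112 : IsFlip V W (T ![0, 0, 1]) (-(T ![0, 0, 1] + (3 : ℂ) • T ![0, 1])) := by
  have h : IsFlip V W (∑ i, ∑ j, ∑ k, eLeg 0 j i * eLeg 0 k j * eLeg 1 i k)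
      (∑ i : Fin 3, ∑ j : Fin 3, ∑ k : Fin 3,
        (- eLeg 0 i.rev j.rev) * (- eLeg 0 j.rev k.rev) * (- eLeg 1 k.rev i.rev)) :=
    IsFlip.sum fun i _ => IsFlip.sum fun j _ => IsFlip.sum fun k _ =>
      ((isFlip_eLeg 0 j i).mul (isFlip_eLeg 0 k j)).mul (isFlip_eLeg 1 i k)
  rw [sum_rev_three (fun i j k => (- eLeg 0 i j) * (- eLeg 0 j k) * (- eLeg 1 k i))] at h
  simp only [mul_neg, neg_mul, neg_neg, Finset.sum_neg_distrib] at h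
  rwa [← T_three, sum_bar_112] at h

theorem isFlip_T122 : IsFlip V W (T ![0, 1, 1]) (-(T ![0, 1, 1] + (3 : ℂ) • T ![0, 1])) := by
  have h : IsFlip V W (∑ i, ∑ j, ∑ k, eLeg 0 j i * eLeg 1 k j * eLeg 1 i k)
      (∑ i : Fin 3, ∑ j : Fin 3, ∑ k : Fin 3,
        (- eLeg 0 i.rev j.rev) * (- eLeg 1 j.rev k.rev) * (- eLeg 1 k.rev i.rev)) :=
    IsFlip.sum fun i _ => IsFlip.sum fun j _ => IsFlip.sum fun k _ =>
      ((isFlip_eLeg 0 j i).mul (isFlip_eLeg 1 k j)).mul (isFlip_eLeg 1 i k)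
  rw [sum_rev_three (fun i j k => (- eLeg 0 i j) * (- eLeg 1 j k) * (- eLeg 1 k i))] at h
  simp only [mul_neg, neg_mul, neg_neg, Finset.sum_neg_distrib] at h
  rwa [← T_three, sum_bar_122] at h

/-- With four factors the signs cancel and the two index orders are exchanged, which is why `Y`
contains the sum `T^{(1,1,2,2)} + T̄^{(1,1,2,2)}`. -/
theorem isFlip_T1122 : IsFlip V W (T ![0, 0, 1, 1]) (Tbar ![0, 0, 1, 1]) := by
  have h : IsFlip V W (∑ i, ∑ j, ∑ k, ∑ s, eLeg 0 j i * eLeg 0 k j * eLeg 1 s k * eLeg 1 i s)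
      (∑ i : Fin 3, ∑ j : Fin 3, ∑ k : Fin 3, ∑ s : Fin 3,
        (- eLeg 0 i.rev j.rev) * (- eLeg 0 j.rev k.rev) * (- eLeg 1 k.rev s.rev) *
          (- eLeg 1 s.rev i.rev)) :=
    IsFlip.sum fun i _ => IsFlip.sum fun j _ => IsFlip.sum fun k _ => IsFlip.sum fun s _ =>
      (((isFlip_eLeg 0 j i).mul (isFlip_eLeg 0 k j)).mul (isFlip_eLeg 1 s k)).mul
        (isFlip_eLeg 1 i s)
  rw [sum_rev_four (fun i j k s => (- eLeg 0 i j) * (- eLeg 0 j k) * (- eLeg 1 k s) *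
    (- eLeg 1 s i))] at h
  simp only [mul_neg, neg_mul, neg_neg] at h
  rwa [← T_four, ← Tbar_four] at h

theorem isFlip_Tbar1122 : IsFlip V W (Tbar ![0, 0, 1, 1]) (T ![0, 0, 1, 1]) := by
  have h : IsFlip V W (∑ i, ∑ j, ∑ k, ∑ s, eLeg 0 i j * eLeg 0 j k * eLeg 1 k s * eLeg 1 s i)
      (∑ i : Fin 3, ∑ j : Fin 3, ∑ k : Fin 3, ∑ s : Fin 3,
        (- eLeg 0 j.rev i.rev) * (- eLeg 0 k.rev j.rev) * (- eLeg 1 s.rev k.rev) *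
          (- eLeg 1 i.rev s.rev)) :=
    IsFlip.sum fun i _ => IsFlip.sum fun j _ => IsFlip.sum fun k _ => IsFlip.sum fun s _ =>
      (((isFlip_eLeg 0 i j).mul (isFlip_eLeg 0 j k)).mul (isFlip_eLeg 1 k s)).mul
        (isFlip_eLeg 1 s i)
  rw [sum_rev_four (fun i j k s => (- eLeg 0 j i) * (- eLeg 0 k j) * (- eLeg 1 s k) *
    (- eLeg 1 i s))] at h
  simp only [mul_neg, neg_mul, neg_neg] at h
  rwa [← T_four, ← Tbar_four] at h

variable {a b a' b' : ℕ}

/-- The eigenvalue of the cubic Casimir element is antisymmetric under `[a, b] ↦ [b, a]`, and the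
`T^{(1,2)}` corrections of the two cubic traces cancel; hence the overall sign. -/
theorem isFlip_X (hV : IsIrrep V a b) (hW : IsIrrep W a' b') : IsFlip V W X (-X) := by
  have hc : ∀ x y : ℂ, casimirLValue y x = - casimirLValue x y := fun x y => by
    rw [casimirLValue, casimirLValue]; ring
  have h0 : IsFlip V W (leg 0 casimirL) (- leg 0 casimirL) := fun t => by
    rw [act_leg_zero_eq_smul (actU_eq_smul hV.twist eU_commute_casimirL
      fun v hv => actU_casimirL_of_mem hv), map_neg, LinearMap.neg_apply,
      act_leg_zero_eq_smul (actU_eq_smul hV eU_commute_casimirL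
      fun v hv => actU_casimirL_of_mem hv), hc, map_neg, map_smul, neg_smul]
  have h1 : IsFlip V W (leg 1 casimirL) (- leg 1 casimirL) := fun t => by
    rw [act_leg_one_eq_smul (actU_eq_smul hW.twist eU_commute_casimirL
      fun v hv => actU_casimirL_of_mem hv), map_neg, LinearMap.neg_apply,
      act_leg_one_eq_smul (actU_eq_smul hW eU_commute_casimirL
      fun v hv => actU_casimirL_of_mem hv), hc, map_neg, map_smul, neg_smul]
  have h := ((isFlip_T112.sub isFlip_T122).smul (1 / 2)).add ((h0.sub h1).smul (1 / 3))
  have he : - X = (1 / 2 : ℂ) • (-(T ![0, 0, 1] + (3 : ℂ) • T ![0, 1])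
      - -(T ![0, 1, 1] + (3 : ℂ) • T ![0, 1]))
      + (1 / 3 : ℂ) • (- leg 0 casimirL - - leg 1 casimirL) := by
    rw [X]; module
  rw [he]
  exact h

theorem isFlip_Y (hV : IsIrrep V a b) (hW : IsIrrep W a' b') : IsFlip V W Y Y := by
  have hc : ∀ x y : ℂ, casimirValue y x = casimirValue x y := fun x y => by
    rw [casimirValue, casimirValue]; ring
  have h0 : IsFlip V W (T ![0, 0]) (T ![0, 0]) := fun t => by
    rw [T_two_same, act_leg_zero_eq_smul (actU_eq_smul hV.twist eU_commute_casimir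
      fun v hv => actU_casimir_of_mem hv), act_leg_zero_eq_smul (actU_eq_smul hV eU_commute_casimir
      fun v hv => actU_casimir_of_mem hv), hc, map_smul]
  have h1 : IsFlip V W (T ![1, 1]) (T ![1, 1]) := fun t => by
    rw [T_two_same, act_leg_one_eq_smul (actU_eq_smul hW.twist eU_commute_casimir
      fun v hv => actU_casimir_of_mem hv), act_leg_one_eq_smul (actU_eq_smul hW eU_commute_casimir
      fun v hv => actU_casimir_of_mem hv), hc, map_smul]
  have h := (((((isFlip_T1122 (V := V) (W := W)).add isFlip_Tbar1122).smul (1 / 2)).sub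
    ((isFlip_T12.mul isFlip_T12).smul (1 / 12))).sub ((h0.mul h1).smul (5 / 12))).sub
    (isFlip_T12.smul 2)
  rw [add_comm (Tbar _), ← pow_two] at h
  exact h

end FlipTraces
end MissingLabel
end

noncomputable section

namespace MissingLabel

/-! ### Transfer to representations without a given inner product -/

section PlainModules

section Normed

variable {V W : Type*} [NormedAddCommGroup V] [InnerProductSpace ℂ V] [LieRingModule Sl3 V]
  [LieModule ℂ Sl3 V] [NormedAddCommGroup W] [InnerProductSpace ℂ W] [LieRingModule Sl3 W]
  [LieModule ℂ Sl3 W] {p q p' q' : ℕ}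

/-- A non-zero leading component contains some monomial. Its exponents show that `n` and `ℓ - n` are
integers and that the interval of admissible `b` is not empty. -/
theorem Model.exists_exponents (A : Model V p q) (B : Model W p' q')
    (hV : IsIrrep V (p + 1) (q + 1)) (hW : IsIrrep W (p' + 1) (q' + 1)) {r s : ℕ} {u : V ⊗[ℂ] W}
    (hu : u ∈ highestWeightSpace (V ⊗[ℂ] W) r s) (hu0 : u ≠ 0) :
    ∃ N K b : ℤ, 3 * K = r - s + q - p - p' + q' ∧
      3 * N = 2 * p + q + 2 * p' + q' - 2 * r - s + 6 ∧
      (N + K - (q' + 1) ≤ b ∧ N - (p + 1) ≤ b ∧ 0 ≤ b ∧ b < N ∧ b < p' + 1 ∧ b < q + 1 - K) := by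
  have := hV.irreducible
  have := hW.irreducible
  have := hV.finiteDimensional
  have := hW.finiteDimensional
  have h0 : A.lead B u ≠ 0 := fun h =>
    hu0 (A.eq_zero_of_lead B (mem_highestWeightSpace_iff.1 hu).2 h)
  obtain ⟨⟨a, b, c, d, k⟩, h⟩ : ∃ x, (A.lead B u).coeff x ≠ 0 := by
    by_contra! hc
    exact h0 (by ext x; exact hc x)
  obtain ⟨h1, h2⟩ := B.exponent_of_J h
  obtain ⟨h3, h4⟩ := A.exponent_of_lead_weight B hu h
  obtain ⟨h5, h6, h7⟩ := A.exponent_of_lead B hu h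
  exact ⟨b + c + 1, k, b, h3, h4, by omega⟩

/-- An invariant inner product for which `X` and `Y` are symmetric, as a family of linear forms. -/
theorem Model.exists_hermitian (A : Model V p q) (B : Model W p' q')
    (hV : IsIrrep V (p + 1) (q + 1)) (hW : IsIrrep W (p' + 1) (q' + 1)) :
    ∃ φ : V ⊗[ℂ] W →ₗ⋆[ℂ] V ⊗[ℂ] W →ₗ[ℂ] ℂ, (∀ x y, starRingEnd ℂ (φ y x) = φ x y) ∧
      (∀ x, 0 ≤ (φ x x).re) ∧ (∀ x, φ x x = 0 → x = 0) ∧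
      (∀ i j x y, φ ⁅e i j, x⁆ y = φ x ⁅e j i, y⁆) ∧
      (∀ x y, φ (act V W X x) y = φ x (act V W X y)) ∧
      (∀ x y, φ (act V W Y x) y = φ x (act V W Y y)) := by
  refine ⟨innerₛₗ ℂ, fun x y => inner_conj_symm x y, fun x => inner_self_nonneg (𝕜 := ℂ) (x := x),
    fun x hx => inner_self_eq_zero.1 hx, fun i j x y => ?_, A.isAdj_X B hV hW, A.isAdj_Y B hV hW⟩
  have h0 := A.isAdj_eLeg B 0 i j x y
  have h1 := A.isAdj_eLeg B 1 i j x y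
  change inner ℂ ⁅e i j, x⁆ y = inner ℂ x ⁅e j i, y⁆
  rw [lie_eq_act, lie_eq_act, inner_add_left, h0, h1, inner_add_right]

end Normed

variable {V W : Type*} [AddCommGroup V] [Module ℂ V] [LieRingModule Sl3 V] [LieModule ℂ Sl3 V]
  [AddCommGroup W] [Module ℂ W] [LieRingModule Sl3 W] [LieModule ℂ Sl3 W] {p q p' q' : ℕ}

/-- The inner products given by `exists_core` are installed only as local instances. What survives
is a form on the tensor product, with no norm attached to `V` or `W`. -/
theorem exists_hermitian (hV : IsIrrep V (p + 1) (q + 1)) (hW : IsIrrep W (p' + 1) (q' + 1)) :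
    ∃ φ : V ⊗[ℂ] W →ₗ⋆[ℂ] V ⊗[ℂ] W →ₗ[ℂ] ℂ, (∀ x y, starRingEnd ℂ (φ y x) = φ x y) ∧
      (∀ x, 0 ≤ (φ x x).re) ∧ (∀ x, φ x x = 0 → x = 0) ∧
      (∀ i j x y, φ ⁅e i j, x⁆ y = φ x ⁅e j i, y⁆) ∧
      (∀ x y, φ (act V W X x) y = φ x (act V W X y)) ∧
      (∀ x y, φ (act V W Y x) y = φ x (act V W Y y)) := by
  obtain ⟨c, ι, hι, v, hv, hιv⟩ := exists_core hV
  obtain ⟨c', ι', hι', v', hv', hιv'⟩ := exists_core hW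
  let _ := c.toNormedAddCommGroup
  let _ := InnerProductSpace.ofCore c.toCore
  let _ := c'.toNormedAddCommGroup
  let _ := InnerProductSpace.ofCore c'.toCore
  exact Model.exists_hermitian ⟨ι, hι, v, hv, hιv⟩ ⟨ι', hι', v', hv', hιv'⟩ hV hW

theorem exists_hermitian_of_labels {m : Labels} (hV : IsIrrep V m.m₁ m.m₂)
    (hW : IsIrrep W m.m₁' m.m₂') :
    ∃ φ : V ⊗[ℂ] W →ₗ⋆[ℂ] V ⊗[ℂ] W →ₗ[ℂ] ℂ, (∀ x y, starRingEnd ℂ (φ y x) = φ x y) ∧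
      (∀ x, 0 ≤ (φ x x).re) ∧ (∀ x, φ x x = 0 → x = 0) ∧
      (∀ i j x y, φ ⁅e i j, x⁆ y = φ x ⁅e j i, y⁆) ∧
      (∀ x y, φ (act V W X x) y = φ x (act V W X y)) ∧
      (∀ x y, φ (act V W Y x) y = φ x (act V W Y y)) := by
  obtain ⟨p, h₁⟩ := Nat.exists_eq_add_of_lt m.pos_m₁
  obtain ⟨q, h₂⟩ := Nat.exists_eq_add_of_lt m.pos_m₂
  obtain ⟨p', h₁'⟩ := Nat.exists_eq_add_of_lt m.pos_m₁'
  obtain ⟨q', h₂'⟩ := Nat.exists_eq_add_of_lt m.pos_m₂'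
  rw [zero_add] at h₁ h₂ h₁' h₂'
  rw [h₁, h₂] at hV
  rw [h₁', h₂'] at hW
  exact exists_hermitian hV hW

theorem exists_exponents (hV : IsIrrep V (p + 1) (q + 1)) (hW : IsIrrep W (p' + 1) (q' + 1))
    {r s : ℕ} {u : V ⊗[ℂ] W} (hu : u ∈ highestWeightSpace (V ⊗[ℂ] W) r s) (hu0 : u ≠ 0) :
    ∃ N K b : ℤ, 3 * K = r - s + q - p - p' + q' ∧
      3 * N = 2 * p + q + 2 * p' + q' - 2 * r - s + 6 ∧
      (N + K - (q' + 1) ≤ b ∧ N - (p + 1) ≤ b ∧ 0 ≤ b ∧ b < N ∧ b < p' + 1 ∧ b < q + 1 - K) := by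
  obtain ⟨c, ι, hι, v, hv, hιv⟩ := exists_core hV
  obtain ⟨c', ι', hι', v', hv', hιv'⟩ := exists_core hW
  let _ := c.toNormedAddCommGroup
  let _ := InnerProductSpace.ofCore c.toCore
  let _ := c'.toNormedAddCommGroup
  let _ := InnerProductSpace.ofCore c'.toCore
  exact Model.exists_exponents ⟨ι, hι, v, hv, hιv⟩ ⟨ι', hι', v', hv', hιv'⟩ hV hW hu hu0

theorem exists_tridiagonal_basis (hV : IsIrrep V (p + 1) (q + 1))
    (hW : IsIrrep W (p' + 1) (q' + 1)) {r s : ℕ} {N K lo : ℤ} {n : ℕ}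
    (hK : 3 * K = r - s + q - p - p' + q')
    (hN : 3 * N = 2 * p + q + 2 * p' + q' - 2 * r - s + 6) (hK0 : 0 ≤ K)
    (hb : ∀ b : ℤ, lo ≤ b ∧ b < lo + n ↔ N + K - (q' + 1) ≤ b ∧ N - (p + 1) ≤ b ∧ 0 ≤ b ∧
      b < N ∧ b < p' + 1 ∧ b < q + 1 - K)
    (hX : ∀ v ∈ highestWeightSpace (V ⊗[ℂ] W) r s,
      act V W X v ∈ highestWeightSpace (V ⊗[ℂ] W) r s)
    (hY : ∀ v ∈ highestWeightSpace (V ⊗[ℂ] W) r s,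
      act V W Y v ∈ highestWeightSpace (V ⊗[ℂ] W) r s) :
    ∃ γ : Module.Basis (Fin n) ℂ (highestWeightSpace (V ⊗[ℂ] W) r s),
      LinearMap.toMatrix γ γ ((act V W X).restrict hX) =
        triX (coreξ p q p' q' N K) (coreLam p q p' q' N) lo n ∧
      LinearMap.toMatrix γ γ ((act V W Y).restrict hY) =
        triY (coreξ p q p' q' N K) (coreLam p q p' q' N) lo n := by
  have := hV.finiteDimensional
  have := hW.finiteDimensional
  obtain ⟨c, ι, hι, v, hv, hιv⟩ := exists_core hV
  obtain ⟨c', ι', hι', v', hv', hιv'⟩ := exists_core hW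
  let _ := c.toNormedAddCommGroup
  let _ := InnerProductSpace.ofCore c.toCore
  let _ := c'.toNormedAddCommGroup
  let _ := InnerProductSpace.ofCore c'.toCore
  exact Model.exists_tridiagonal_basis ⟨ι, hι, v, hv, hιv⟩ ⟨ι', hι', v', hv', hιv'⟩ hV hW hK hN hK0
    hb hX hY

end PlainModules

end MissingLabel
end

noncomputable section

namespace MissingLabel

/-! ### The matrices in terms of the labels -/

section Matrices

theorem tridiagonal_eq_triX (m : Labels) (d : ℕ) :
    tridiagonal d m.aDiag m.aUp m.aLow = triX (fun i => (m.ξ i : ℂ)) m.Lam m.ξb d := by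
  have hE : ∀ i k : ℕ, (m.E (i + 1) k : ℂ) = powerSum (fun i => (m.ξ i : ℂ)) (m.ξb + i + 1) k :=
    fun i k => by
      rw [Labels.E, powerSum]
      push_cast
      exact Finset.sum_congr rfl fun j _ => by ring
  ext i j
  rw [tridiagonal, triX, Matrix.of_apply, Matrix.of_apply]
  refine ite_congr rfl (fun _ => ?_) fun _ => ite_congr rfl (fun _ => ?_) fun _ =>
    ite_congr rfl (fun _ => ?_) fun _ => rfl
  · rw [Labels.aDiag, diagX, ← hE, ← hE, ← hE]
    push_cast
    ring
  · rw [Labels.aUp, upProd]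
    push_cast
    ring
  · rw [Labels.aLow, lowProd]
    push_cast
    ring

theorem tridiagonal_eq_triY (m : Labels) (d : ℕ) :
    tridiagonal d m.bDiag m.bUp m.bLow = triY (fun i => (m.ξ i : ℂ)) m.Lam m.ξb d := by
  have hE : ∀ i k : ℕ, (m.E (i + 1) k : ℂ) = powerSum (fun i => (m.ξ i : ℂ)) (m.ξb + i + 1) k :=
    fun i k => by
      rw [Labels.E, powerSum]
      push_cast
      exact Finset.sum_congr rfl fun j _ => by ring
  ext i j
  rw [tridiagonal, triY, Matrix.of_apply, Matrix.of_apply]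
  refine ite_congr rfl (fun _ => ?_) fun _ => ite_congr rfl (fun _ => ?_) fun _ =>
    ite_congr rfl (fun _ => ?_) fun _ => rfl
  · rw [Labels.bDiag, diagY, ← hE, ← hE, ← hE, ← hE]
    push_cast
    ring
  · rw [Labels.bUp, Labels.aUp, Labels.lamMinus, upProd]
    push_cast
    ring
  · rw [Labels.bLow, Labels.aLow, Labels.lamPlus, lowProd]
    push_cast
    ring

variable {ξ ξ' : Fin 6 → ℂ} {c : ℂ}

/-- `ξ` and `ξ'` agree up to the exchange of the second and third entries. -/
theorem triX_congr (h0 : ξ 0 = ξ' 0) (h1 : ξ 1 = ξ' 2) (h2 : ξ 2 = ξ' 1) (h3 : ξ 3 = ξ' 3)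
    (h4 : ξ 4 = ξ' 4) (h5 : ξ 5 = ξ' 5) (L B : ℂ) (n : ℕ) : triX ξ L B n = triX ξ' L B n := by
  have hp : powerSum ξ = powerSum ξ' := by
    ext B k
    simp only [powerSum, Fin.sum_univ_six, h0, h1, h2, h3, h4, h5]
    ring
  have hu : upProd ξ = upProd ξ' := by
    ext B
    simp only [upProd, h0, h1, h2]
    ring
  have hl : lowProd ξ = lowProd ξ' := by
    ext B
    simp only [lowProd, h3, h4, h5]
  rw [triX, triX, hp, hu, hl]

theorem triY_congr (h0 : ξ 0 = ξ' 0) (h1 : ξ 1 = ξ' 2) (h2 : ξ 2 = ξ' 1) (h3 : ξ 3 = ξ' 3)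
    (h4 : ξ 4 = ξ' 4) (h5 : ξ 5 = ξ' 5) (L B : ℂ) (n : ℕ) : triY ξ L B n = triY ξ' L B n := by
  have hp : powerSum ξ = powerSum ξ' := by
    ext B k
    simp only [powerSum, Fin.sum_univ_six, h0, h1, h2, h3, h4, h5]
    ring
  have hu : upProd ξ = upProd ξ' := by
    ext B
    simp only [upProd, h0, h1, h2]
    ring
  have hl : lowProd ξ = lowProd ξ' := by
    ext B
    simp only [lowProd, h3, h4, h5]
  have hs : ∑ i, ξ i = ∑ i, ξ' i := by
    simp only [Fin.sum_univ_six, h0, h1, h2, h3, h4, h5]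
    ring
  rw [triY, triY, hp, hu, hl, hs]

/-- The reflection `x ↦ c - x` which exchanges the two triples of parameters. -/
def IsReflection (c : ℂ) (ξ ξ' : Fin 6 → ℂ) : Prop :=
  (ξ' 5 = c - ξ 0 ∧ ξ' 4 = c - ξ 1 ∧ ξ' 3 = c - ξ 2) ∧
    (ξ' 1 = c - ξ 3 ∧ ξ' 2 = c - ξ 4 ∧ ξ' 0 = c - ξ 5)

/-- The shift by `1/2` centres the arguments: the reflection together with `B ↦ c + 1 - B` negates
each of them. Hence `a_{jj}`, odd in these arguments, changes sign and `b_{jj}`, even in them, does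
not. -/
theorem IsReflection.powerSum (h : IsReflection c ξ ξ') (B : ℂ) (k : ℕ) :
    powerSum ξ' (c + 1 - B) k = (-1) ^ k * powerSum ξ B k := by
  obtain ⟨⟨h0, h1, h2⟩, h3, h4, h5⟩ := h
  have hx : ∀ x : ℂ, (c - x - (c + 1 - B) + 1 / 2) ^ k = (-1) ^ k * (x - B + 1 / 2) ^ k :=
    fun x => by rw [← mul_pow]; ring
  simp only [MissingLabel.powerSum, Fin.sum_univ_six, h0, h1, h2, h3, h4, h5, hx]
  ring

theorem IsReflection.lowProd (h : IsReflection c ξ ξ') (B : ℂ) :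
    lowProd ξ' (c - B) = - upProd ξ B := by
  obtain ⟨⟨h0, h1, h2⟩, h3, h4, h5⟩ := h
  rw [MissingLabel.lowProd, upProd, h0, h1, h2]
  ring

theorem IsReflection.upProd (h : IsReflection c ξ ξ') (B : ℂ) :
    upProd ξ' (c - B) = - MissingLabel.lowProd ξ B := by
  obtain ⟨⟨h0, h1, h2⟩, h3, h4, h5⟩ := h
  rw [MissingLabel.lowProd, MissingLabel.upProd, h3, h4, h5]
  ring

theorem IsReflection.sum (h : IsReflection c ξ ξ') : ∑ i, ξ' i = 6 * c - ∑ i, ξ i := by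
  obtain ⟨⟨h0, h1, h2⟩, h3, h4, h5⟩ := h
  simp only [Fin.sum_univ_six, h0, h1, h2, h3, h4, h5]
  ring

theorem cast_rev {n : ℕ} (i : Fin n) : (((Fin.rev i : Fin n) : ℕ) : ℂ) = n - i - 1 := by
  have h : ((Fin.rev i : Fin n) : ℕ) + (i + 1) = n := by rw [Fin.val_rev]; omega
  have h' : (((Fin.rev i : Fin n) : ℕ) : ℂ) + (i + 1) = n := by exact_mod_cast h
  rw [← h']
  ring

/-- Reversing rows and columns exchanges the two off-diagonals, and the reflection exchanges
`upProd` and `lowProd` with a sign. The off-diagonals use `c - B` where the diagonal uses `c + 1 -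
B`, because an off-diagonal entry belongs to a gap between consecutive indices. -/
theorem IsReflection.triX (h : IsReflection c ξ ξ') (L B : ℂ) {n : ℕ} (i j : Fin n) :
    triX ξ' L (c - B - n) n i.rev j.rev = - MissingLabel.triX ξ L B n i j := by
  have hi := cast_rev i
  have hj := cast_rev j
  have hi' : ((Fin.rev i : Fin n) : ℕ) = n - (i + 1) := Fin.val_rev i
  have hj' : ((Fin.rev j : Fin n) : ℕ) = n - (j + 1) := Fin.val_rev j
  rw [MissingLabel.triX, MissingLabel.triX, Matrix.of_apply, Matrix.of_apply]
  rw [apply_ite Neg.neg, apply_ite Neg.neg, apply_ite Neg.neg, neg_zero]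
  by_cases h1 : (i : ℕ) = j
  · rw [if_pos h1, if_pos (by omega)]
    have hB : c - B - n + ((Fin.rev i : Fin n) : ℕ) + 1 = c + 1 - (B + i + 1) := by rw [hi]; ring
    rw [hB, diagX, diagX]
    simp only [h.powerSum]
    ring
  rw [if_neg h1, if_neg (by omega)]
  by_cases h2 : (j : ℕ) = i + 1
  · rw [if_pos h2, if_neg (by omega), if_pos (by omega)]
    have hB : c - B - n + ((Fin.rev j : Fin n) : ℕ) + 1 = c - (B + i + 1) := by
      rw [hj, h2]; push_cast; ring
    rw [hB, h.lowProd]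
  rw [if_neg h2]
  by_cases h3 : (i : ℕ) = j + 1
  · rw [if_pos h3, if_pos (by omega)]
    have hB : c - B - n + ((Fin.rev i : Fin n) : ℕ) + 1 = c - (B + j + 1) := by
      rw [hi, h3]; push_cast; ring
    rw [hB, h.upProd]
  · rw [if_neg h3, if_neg (by omega), if_neg (by omega)]

/-- Each additional linear factor of an off-diagonal entry also changes sign, since the reflection
exchanges the roles of `λ₋` and `λ₊`; this cancels the sign of the cubic product. -/
theorem IsReflection.triY (h : IsReflection c ξ ξ') (L B : ℂ) {n : ℕ} (i j : Fin n) :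
    triY ξ' L (c - B - n) n i.rev j.rev = MissingLabel.triY ξ L B n i j := by
  have hi := cast_rev i
  have hj := cast_rev j
  have hi' : ((Fin.rev i : Fin n) : ℕ) = n - (i + 1) := Fin.val_rev i
  have hj' : ((Fin.rev j : Fin n) : ℕ) = n - (j + 1) := Fin.val_rev j
  rw [MissingLabel.triY, MissingLabel.triY, Matrix.of_apply, Matrix.of_apply, h.sum]
  by_cases h1 : (i : ℕ) = j
  · rw [if_pos h1, if_pos (by omega)]
    have hB : c - B - n + ((Fin.rev i : Fin n) : ℕ) + 1 = c + 1 - (B + i + 1) := by rw [hi]; ring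
    rw [hB, diagY, diagY]
    simp only [h.powerSum]
    ring
  rw [if_neg h1, if_neg (by omega)]
  by_cases h2 : (j : ℕ) = i + 1
  · rw [if_pos h2, if_neg (by omega), if_pos (by omega)]
    have hB : c - B - n + ((Fin.rev j : Fin n) : ℕ) + 1 = c - (B + i + 1) := by
      rw [hj, h2]; push_cast; ring
    rw [hB, h.lowProd]
    ring
  rw [if_neg h2]
  by_cases h3 : (i : ℕ) = j + 1
  · rw [if_pos h3, if_pos (by omega)]
    have hB : c - B - n + ((Fin.rev i : Fin n) : ℕ) + 1 = c - (B + j + 1) := by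
      rw [hi, h3]; push_cast; ring
    rw [hB, h.upProd]
    ring
  · rw [if_neg h3, if_neg (by omega), if_neg (by omega)]

end Matrices

end MissingLabel
end

noncomputable section

namespace MissingLabel

/-! ### The tridiagonal basis -/

section LabelBasis

variable {m : Labels} {p q p' q' : ℕ} {N K : ℤ}

theorem Labels.n_eq (h₁ : m.m₁ = p + 1) (h₂ : m.m₂ = q + 1) (h₁' : m.m₁' = p' + 1)
    (h₂' : m.m₂' = q' + 1)
    (hN : 3 * N = 2 * p + q + 2 * p' + q' - 2 * m.m₁'' - m.m₂'' + 6) : m.n = N := by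
  have h : (3 * N : ℚ) = 2 * p + q + 2 * p' + q' - 2 * m.m₁'' - m.m₂'' + 6 := by exact_mod_cast hN
  rw [Labels.n, h₁, h₂, h₁', h₂']
  push_cast
  linarith

theorem Labels.ell_eq (h₁ : m.m₁ = p + 1) (h₂ : m.m₂ = q + 1) (h₁' : m.m₁' = p' + 1)
    (h₂' : m.m₂' = q' + 1) (hK : 3 * K = m.m₁'' - m.m₂'' + q - p - p' + q')
    (hN : 3 * N = 2 * p + q + 2 * p' + q' - 2 * m.m₁'' - m.m₂'' + 6) : m.ell = N + K := by
  have h : (3 * N : ℚ) = 2 * p + q + 2 * p' + q' - 2 * m.m₁'' - m.m₂'' + 6 := by exact_mod_cast hN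
  have h' : (3 * K : ℚ) = m.m₁'' - m.m₂'' + q - p - p' + q' := by exact_mod_cast hK
  rw [Labels.ell, h₁, h₂, h₁', h₂']
  push_cast
  linarith

theorem Labels.ξb_of_eq {x y : ℤ} (hx : m.ξ 3 = x) (hy : m.ξ 4 = y) (hz : m.ξ 5 = 0) :
    m.ξb = (max x (max y 0) : ℤ) := by
  rw [Labels.ξb, hx, hy, hz]
  push_cast
  rfl

theorem Labels.ξa_of_eq {x y z : ℤ} (hx : m.ξ 0 = x) (hy : m.ξ 1 = y) (hz : m.ξ 2 = z) :
    m.ξa = (min x (min y z) : ℤ) := by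
  rw [Labels.ξa, hx, hy, hz]
  push_cast
  rfl

variable {V W : Type*} [AddCommGroup V] [Module ℂ V] [LieRingModule Sl3 V] [LieModule ℂ Sl3 V]
  [AddCommGroup W] [Module ℂ W] [LieRingModule Sl3 W] [LieModule ℂ Sl3 W]

/-- `X` and `Y` are tridiagonal in a suitable basis of the multiplicity space. -/
def HasTridiagonalBasis (m : Labels) (V W : Type*) [AddCommGroup V] [Module ℂ V]
    [LieRingModule Sl3 V] [LieModule ℂ Sl3 V] [AddCommGroup W] [Module ℂ W] [LieRingModule Sl3 W]
    [LieModule ℂ Sl3 W] (hX : ∀ v ∈ multSpace m V W, act V W X v ∈ multSpace m V W)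
    (hY : ∀ v ∈ multSpace m V W, act V W Y v ∈ multSpace m V W) : Prop :=
  ∃ (n : ℕ) (γ : Module.Basis (Fin n) ℂ (multSpace m V W)), (n : ℚ) = m.ξa - m.ξb ∧
    LinearMap.toMatrix γ γ ((act V W X).restrict hX) =
      triX (fun i => (m.ξ i : ℂ)) m.Lam m.ξb n ∧
    LinearMap.toMatrix γ γ ((act V W Y).restrict hY) =
      triY (fun i => (m.ξ i : ℂ)) m.Lam m.ξb n

theorem mem_Ico_max_min (x y z x' y' b : ℤ) : max x' (max y' 0) ≤ b ∧
      b < max x' (max y' 0) + ((min x (min y z) - max x' (max y' 0)).toNat : ℤ) ↔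
      x' ≤ b ∧ y' ≤ b ∧ 0 ≤ b ∧ b < x ∧ b < y ∧ b < z := by
  omega

theorem hasTridiagonalBasis_of_nonneg (hV : IsIrrep V (p + 1) (q + 1))
    (hW : IsIrrep W (p' + 1) (q' + 1)) (h₁ : m.m₁ = p + 1) (h₂ : m.m₂ = q + 1)
    (h₁' : m.m₁' = p' + 1) (h₂' : m.m₂' = q' + 1)
    (hK : 3 * K = m.m₁'' - m.m₂'' + q - p - p' + q')
    (hN : 3 * N = 2 * p + q + 2 * p' + q' - 2 * m.m₁'' - m.m₂'' + 6) (hK0 : 0 ≤ K) {b₀ : ℤ}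
    (h₀ : N + K - (q' + 1) ≤ b₀ ∧ N - (p + 1) ≤ b₀ ∧ 0 ≤ b₀ ∧ b₀ < N ∧ b₀ < p' + 1 ∧
      b₀ < q + 1 - K)
    (hX : ∀ v ∈ multSpace m V W, act V W X v ∈ multSpace m V W)
    (hY : ∀ v ∈ multSpace m V W, act V W Y v ∈ multSpace m V W) :
    HasTridiagonalBasis m V W hX hY := by
  have hn := Labels.n_eq h₁ h₂ h₁' h₂' hN
  have hl := Labels.ell_eq h₁ h₂ h₁' h₂' hK hN
  have hKQ : (0 : ℚ) ≤ K := by exact_mod_cast hK0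
  obtain ⟨γ, hγX, hγY⟩ := exists_tridiagonal_basis hV hW hK hN hK0 (mem_Ico_max_min _ _ _ _ _) hX hY
  have hξ3 : m.ξ 3 = ((N + K - (q' + 1) : ℤ) : ℚ) := by
    rw [Labels.ξ]; split_ifs <;> simp [hl, h₂']
  have hξ4 : m.ξ 4 = ((N - (p + 1) : ℤ) : ℚ) := by
    rw [Labels.ξ]; split_ifs <;> simp [hn, h₁]
  have hξ5 : m.ξ 5 = 0 := by
    rw [Labels.ξ]; split_ifs <;> simp
  have hξ0 : m.ξ 0 = N := by
    rw [Labels.ξ]; split_ifs with h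
    · rw [hn, hl] at h
      change m.ell = N
      linarith
    · simp [hn]
  have habs : |m.ell - m.n| = K := by rw [hn, hl, add_sub_cancel_left, abs_of_nonneg hKQ]
  -- For `K = 0` the definition of `ξ` takes its other branch, `ℓ ≤ n`, which lists the second and
  -- third parameters in the opposite order. The matrices are symmetric in them.
  have hξ : (m.ξ 1 = ((p' + 1 : ℤ) : ℚ) ∧ m.ξ 2 = ((q + 1 - K : ℤ) : ℚ)) ∨
      (m.ξ 1 = ((q + 1 - K : ℤ) : ℚ) ∧ m.ξ 2 = ((p' + 1 : ℤ) : ℚ)) := by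
    rw [Labels.ξ]; split_ifs with h
    · right
      rw [hn, hl] at h
      have h0 : (K : ℚ) = 0 := by linarith
      simp [hn, hl, h₂, h₁', h0]
    · left
      simp [hn, hl, h₂, h₁']
      ring
  have hb := Labels.ξb_of_eq hξ3 hξ4 hξ5
  have ha : m.ξa = (min N (min (p' + 1) (q + 1 - K)) : ℤ) := by
    rcases hξ with ⟨hξ1, hξ2⟩ | ⟨hξ1, hξ2⟩
    · exact Labels.ξa_of_eq hξ0 hξ1 hξ2
    · rw [Labels.ξa_of_eq hξ0 hξ1 hξ2, min_comm (p' + 1 : ℤ)]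
  have hL : (m.Lam : ℂ) = coreLam p q p' q' N := by
    have : m.Lam = p + q + p' + q' + 4 - N := by
      rw [Labels.Lam, hξ0, hξ3, hξ4, hξ5, habs]
      rcases hξ with ⟨hξ1, hξ2⟩ | ⟨hξ1, hξ2⟩ <;> rw [hξ1, hξ2] <;> push_cast <;> ring
    rw [this, coreLam]
    push_cast
    rfl
  refine ⟨_, γ, ?_, ?_, ?_⟩
  -- The admissible exponent `b₀` shows that the interval is non-empty, so the truncation of `toNat`
  -- plays no role.
  · rw [ha, hb, ← Int.cast_sub, ← Int.cast_natCast, Int.cast_inj]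
    omega
  · rw [hγX, hL, hb, Rat.cast_intCast]
    rcases hξ with ⟨hξ1, hξ2⟩ | ⟨hξ1, hξ2⟩
    · congr 1
      ext i
      fin_cases i <;> simp [coreξ, hξ0, hξ1, hξ2, hξ3, hξ4, hξ5]
    · apply triX_congr <;> simp [coreξ, hξ0, hξ1, hξ2, hξ3, hξ4, hξ5]
  · rw [hγY, hL, hb, Rat.cast_intCast]
    rcases hξ with ⟨hξ1, hξ2⟩ | ⟨hξ1, hξ2⟩
    · congr 1
      ext i
      fin_cases i <;> simp [coreξ, hξ0, hξ1, hξ2, hξ3, hξ4, hξ5]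
    · apply triY_congr <;> simp [coreξ, hξ0, hξ1, hξ2, hξ3, hξ4, hξ5]

/-- The twist identifies the spaces of highest-weight vectors. -/
def highestWeightTwist (V W : Type*) [AddCommGroup V] [Module ℂ V]
    [LieRingModule Sl3 V] [LieModule ℂ Sl3 V] [AddCommGroup W] [Module ℂ W] [LieRingModule Sl3 W]
    [LieModule ℂ Sl3 W] (r s : ℕ) : highestWeightSpace (V ⊗[ℂ] W) r s ≃ₗ[ℂ]
      highestWeightSpace (Twist V ⊗[ℂ] Twist W) s r :=
  (tensorTwist V W).ofSubmodules _ _ (by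
    ext t
    rw [Submodule.mem_map]
    constructor
    · rintro ⟨u, hu, rfl⟩
      exact (mem_highestWeightSpace_flip (tensorTwist V W) lie_tensorTwist).2 hu
    · intro ht
      refine ⟨(tensorTwist V W).symm t, ?_, (tensorTwist V W).apply_symm_apply t⟩
      rw [← mem_highestWeightSpace_flip (tensorTwist V W) lie_tensorTwist,
        LinearEquiv.apply_symm_apply]
      exact ht)

theorem toMatrix_twist {r s n : ℕ} {z z' : U ⊗[ℂ] U} (hz : IsFlip V W z z')
    (h : ∀ v ∈ highestWeightSpace (Twist V ⊗[ℂ] Twist W) s r,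
      act (Twist V) (Twist W) z v ∈ highestWeightSpace (Twist V ⊗[ℂ] Twist W) s r)
    (h' : ∀ v ∈ highestWeightSpace (V ⊗[ℂ] W) r s,
      act V W z' v ∈ highestWeightSpace (V ⊗[ℂ] W) r s)
    (γ : Module.Basis (Fin n) ℂ (highestWeightSpace (Twist V ⊗[ℂ] Twist W) s r)) (i j : Fin n) :
    LinearMap.toMatrix ((γ.map (highestWeightTwist V W r s).symm).reindex Fin.revPerm)
      ((γ.map (highestWeightTwist V W r s).symm).reindex Fin.revPerm)
      ((act V W z').restrict h') i j =
      LinearMap.toMatrix γ γ ((act (Twist V) (Twist W) z).restrict h) i.rev j.rev := by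
  rw [LinearMap.toMatrix_apply, LinearMap.toMatrix_apply, Module.Basis.reindex_apply,
    Module.Basis.repr_reindex_apply, Module.Basis.map_apply, Module.Basis.map_repr,
    LinearEquiv.trans_apply, LinearEquiv.symm_symm]
  congr 2
  apply Subtype.ext
  change tensorTwist V W (act V W z' ((highestWeightTwist V W r s).symm (γ j.rev)).1) =
    act (Twist V) (Twist W) z (γ j.rev).1
  rw [← hz]
  congr 1
  exact congrArg Subtype.val ((highestWeightTwist V W r s).apply_symm_apply (γ j.rev))

/-- The twisted representations have `p, q` and `p', q'` exchanged, with `N + K` and `-K` in place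
of `N` and `K`, so the case already settled applies to them. Carried back along the twist, its basis
is reversed to match the reflected parameters. -/
theorem hasTridiagonalBasis_of_neg (hV : IsIrrep V (p + 1) (q + 1))
    (hW : IsIrrep W (p' + 1) (q' + 1)) (h₁ : m.m₁ = p + 1) (h₂ : m.m₂ = q + 1)
    (h₁' : m.m₁' = p' + 1) (h₂' : m.m₂' = q' + 1)
    (hK : 3 * K = m.m₁'' - m.m₂'' + q - p - p' + q')
    (hN : 3 * N = 2 * p + q + 2 * p' + q' - 2 * m.m₁'' - m.m₂'' + 6) (hK0 : K < 0)
    {u : V ⊗[ℂ] W} (hu : u ∈ multSpace m V W) (hu0 : u ≠ 0)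
    (hX : ∀ v ∈ multSpace m V W, act V W X v ∈ multSpace m V W)
    (hY : ∀ v ∈ multSpace m V W, act V W Y v ∈ multSpace m V W) :
    HasTridiagonalBasis m V W hX hY := by
  have hn := Labels.n_eq h₁ h₂ h₁' h₂' hN
  have hl := Labels.ell_eq h₁ h₂ h₁' h₂' hK hN
  have hKQ : (K : ℚ) < 0 := by exact_mod_cast hK0
  obtain ⟨N', K', b₀, hK', hN', h₀⟩ := exists_exponents hV.twist hW.twist
    ((mem_highestWeightSpace_flip (tensorTwist V W) lie_tensorTwist).2 hu)
    ((LinearEquiv.map_ne_zero_iff _).2 hu0)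
  obtain rfl : K' = -K := by omega
  obtain rfl : N' = N + K := by omega
  have hX' := fun v => act_mem_highestWeightSpace (V := Twist V) (W := Twist W) X_mem_centraliser
    (a := m.m₂'') (b := m.m₁'') (t := v)
  have hY' := fun v => act_mem_highestWeightSpace (V := Twist V) (W := Twist W) Y_mem_centraliser
    (a := m.m₂'') (b := m.m₁'') (t := v)
  obtain ⟨lo, hlo⟩ : ∃ lo, lo = max (N + K + -K - (p' + 1 : ℤ)) (max (N + K - (q + 1 : ℤ)) 0) :=
    ⟨_, rfl⟩
  obtain ⟨n, hdefn⟩ : ∃ n : ℕ, n = (min (N + K) (min (q' + 1 : ℤ) (p + 1 - -K)) - lo).toNat :=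
    ⟨_, rfl⟩
  obtain ⟨γ, hγX, hγY⟩ := exists_tridiagonal_basis (lo := lo) (n := n) hV.twist hW.twist hK' hN'
    (by omega) (by rw [hdefn, hlo]; exact mem_Ico_max_min _ _ _ _ _) hX' hY'
  have hle : m.ell ≤ m.n := by rw [hn, hl]; linarith
  have hξ0 : m.ξ 0 = ((N + K : ℤ) : ℚ) := by rw [Labels.ξ, if_pos hle]; simp [hl]
  have hξ1 : m.ξ 1 = ((q + 1 : ℤ) : ℚ) := by rw [Labels.ξ, if_pos hle]; simp [h₂]
  have hξ2 : m.ξ 2 = ((p' + 1 + K : ℤ) : ℚ) := by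
    rw [Labels.ξ, if_pos hle]; simp [h₁', hl, hn]; ring
  have hξ3 : m.ξ 3 = ((N + K - (q' + 1) : ℤ) : ℚ) := by
    rw [Labels.ξ, if_pos hle]; simp [hl, h₂']
  have hξ4 : m.ξ 4 = ((N - (p + 1) : ℤ) : ℚ) := by rw [Labels.ξ, if_pos hle]; simp [hn, h₁]
  have hξ5 : m.ξ 5 = 0 := by rw [Labels.ξ, if_pos hle]; simp
  have habs : |m.ell - m.n| = -K := by rw [hn, hl, add_sub_cancel_left, abs_of_neg hKQ]
  have hb := Labels.ξb_of_eq hξ3 hξ4 hξ5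
  have ha := Labels.ξa_of_eq hξ0 hξ1 hξ2
  have hL : (m.Lam : ℂ) = coreLam q p q' p' (N + K) := by
    have : m.Lam = q + p + q' + p' + 4 - (N + K) := by
      rw [Labels.Lam, hξ0, hξ1, hξ2, hξ3, hξ4, hξ5, habs]
      push_cast
      ring
    rw [this, coreLam]
    push_cast
    rfl
  -- The centre of the reflection is determined by `c = N + K = ℓ`, so that `ξ₁ = ℓ` and `ξ₆ = 0`
  -- are exchanged.
  have href : IsReflection (N + K) (fun i => (m.ξ i : ℂ)) (coreξ q p q' p' (N + K) (-K)) := by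
    simp only [IsReflection, hξ0, hξ1, hξ2, hξ3, hξ4, hξ5, coreξ]
    simp
    ring
  have hmax : min (N + K) (min (q' + 1 : ℤ) (p + 1 - -K)) =
      N + K - max (N + K - (q' + 1 : ℤ)) (max (N - (p + 1 : ℤ)) 0) := by omega
  have hmin : min (N + K) (min (q + 1 : ℤ) (p' + 1 + K)) = N + K - lo := by omega
  have hlon : lo < min (N + K) (min (q' + 1 : ℤ) (p + 1 - -K)) :=
    lt_of_le_of_lt (hlo.trans_le (max_le h₀.1 (max_le h₀.2.1 h₀.2.2.1)))
      (lt_min h₀.2.2.2.1 (lt_min h₀.2.2.2.2.1 h₀.2.2.2.2.2))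
  rw [hmax] at hdefn hlon
  rw [hmin] at ha
  generalize max (N + K - (q' + 1 : ℤ)) (max (N - (p + 1 : ℤ)) 0) = B at hb hdefn hlon
  -- The lower end of the twisted interval is the reflection of the upper end `ξ_a = ξ_b + n` of the
  -- original one.
  have hlo' : (lo : ℂ) = N + K - m.ξb - n := by
    have : lo = N + K - B - n := by omega
    rw [hb, Rat.cast_intCast]
    exact_mod_cast this
  refine ⟨n, (γ.map (highestWeightTwist V W _ _).symm).reindex Fin.revPerm, ?_, ?_, ?_⟩
  · rw [ha, hb, ← Int.cast_sub, ← Int.cast_natCast, Int.cast_inj]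
    omega
  · ext i j
    have hnX : ∀ v ∈ multSpace m V W, act V W (-X) v ∈ multSpace m V W := fun v hv => by
      rw [map_neg, LinearMap.neg_apply]
      exact Submodule.neg_mem _ (hX v hv)
    have h := toMatrix_twist (isFlip_X hV hW) hX' hnX γ i j
    have h2 : (act V W (-X)).restrict hnX = - (act V W X).restrict hX := by
      ext v
      change act V W (-X) v.1 = - act V W X v.1
      rw [map_neg, LinearMap.neg_apply]
    have h3 := congrFun (congrFun (map_neg (LinearMap.toMatrix
      ((γ.map (highestWeightTwist V W _ _).symm).reindex Fin.revPerm)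
      ((γ.map (highestWeightTwist V W _ _).symm).reindex Fin.revPerm))
      ((act V W X).restrict hX)) i) j
    -- Two signs meet here, one from `X ↦ -X` under the twist and one from the reflection of the
    -- matrix.
    rw [hγX, hlo', ← hL, href.triX, h2] at h
    exact neg_injective (h3.symm.trans h)
  · ext i j
    rw [toMatrix_twist (isFlip_Y hV hW) hY' hY, hγY, hlo', ← hL, href.triY]

theorem hasTridiagonalBasis (hV : IsIrrep V m.m₁ m.m₂) (hW : IsIrrep W m.m₁' m.m₂')
    {u : V ⊗[ℂ] W} (hu : u ∈ multSpace m V W) (hu0 : u ≠ 0)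
    (hX : ∀ v ∈ multSpace m V W, act V W X v ∈ multSpace m V W)
    (hY : ∀ v ∈ multSpace m V W, act V W Y v ∈ multSpace m V W) :
    HasTridiagonalBasis m V W hX hY := by
  obtain ⟨p, h₁⟩ := Nat.exists_eq_add_of_lt m.pos_m₁
  obtain ⟨q, h₂⟩ := Nat.exists_eq_add_of_lt m.pos_m₂
  obtain ⟨p', h₁'⟩ := Nat.exists_eq_add_of_lt m.pos_m₁'
  obtain ⟨q', h₂'⟩ := Nat.exists_eq_add_of_lt m.pos_m₂'
  rw [zero_add] at h₁ h₂ h₁' h₂'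
  rw [h₁, h₂] at hV
  rw [h₁', h₂'] at hW
  obtain ⟨N, K, b₀, hK, hN, h₀⟩ := exists_exponents hV hW hu hu0
  rcases le_or_gt 0 K with hK0 | hK0
  · exact hasTridiagonalBasis_of_nonneg hV hW h₁ h₂ h₁' h₂' hK hN hK0 h₀ hX hY
  · exact hasTridiagonalBasis_of_neg hV hW h₁ h₂ h₁' h₂' hK hN hK0 hu hu0 hX hY

end LabelBasis

end MissingLabel
end

noncomputable section

namespace MissingLabel

/-! ### The off-diagonal entries -/

/-- For `1 ≤ j < d` one has `ξ_b < j + ξ_b < ξ_a`, which settles the cubic products. The definition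
of `Λ` and `|ℓ - n| ≥ 0` give `λ₋ ≤ 2ξ_b - ξ_a` and `λ₊ ≥ 2ξ_a - ξ_b`, so `j + ξ_b` lies strictly
between `λ₋` and `λ₊` as well. -/
theorem Labels.offDiag_ne_zero {m : Labels} {d j : ℕ} (hd : (d : ℚ) = m.ξa - m.ξb) (hj : 1 ≤ j)
    (hjd : j < d) : m.aUp j ≠ 0 ∧ m.aLow j ≠ 0 ∧ m.bUp j ≠ 0 ∧ m.bLow j ≠ 0 := by
  have hj' : (1 : ℚ) ≤ j := by exact_mod_cast hj
  have hjd' : (j : ℚ) < d := by exact_mod_cast hjd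
  have a0 : m.ξa ≤ m.ξ 0 := min_le_left _ _
  have a1 : m.ξa ≤ m.ξ 1 := (min_le_right _ _).trans (min_le_left _ _)
  have a2 : m.ξa ≤ m.ξ 2 := (min_le_right _ _).trans (min_le_right _ _)
  have b3 : m.ξ 3 ≤ m.ξb := le_max_left _ _
  have b4 : m.ξ 4 ≤ m.ξb := (le_max_left _ _).trans (le_max_right _ _)
  have b5 : m.ξ 5 ≤ m.ξb := (le_max_right _ _).trans (le_max_right _ _)
  have habs := abs_nonneg (m.ell - m.n)
  have hU : m.aUp j ≠ 0 := mul_ne_zero (mul_ne_zero (by linarith) (by linarith)) (by linarith)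
  have hL : m.aLow j ≠ 0 := mul_ne_zero (mul_ne_zero (by linarith) (by linarith)) (by linarith)
  refine ⟨hU, hL, mul_ne_zero hU ?_, mul_ne_zero hL ?_⟩
  · apply ne_of_gt
    rw [Labels.lamMinus, Labels.Lam, Fin.sum_univ_six]
    linarith
  · apply ne_of_lt
    rw [Labels.lamPlus, Labels.Lam, Fin.sum_univ_six]
    linarith

theorem tridiagonal_apply_succ {d : ℕ} {f u l : ℕ → ℚ} (hu : ∀ j, 1 ≤ j → j < d → u j ≠ 0) {i : ℕ}
    (hi : i + 1 < d) : tridiagonal d f u l ⟨i, by omega⟩ ⟨i + 1, hi⟩ ≠ 0 := by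
  rw [tridiagonal, Matrix.of_apply, if_neg (by simp), if_pos rfl]
  exact_mod_cast hu (i + 1) (by omega) hi

theorem tridiagonal_apply_of_lt {d : ℕ} {f u l : ℕ → ℚ} {i j : Fin d} (h : (i : ℕ) + 1 < j) :
    tridiagonal d f u l i j = 0 := by
  rw [tridiagonal, Matrix.of_apply, if_neg (by omega), if_neg (by omega), if_neg (by omega)]

/-! ### Simple spectrum -/

section Spectrum

/-- An eigenvector of an unreduced lower Hessenberg matrix has non-zero first coordinate. -/
theorem eq_zero_of_hessenberg {d : ℕ} {A : Matrix (Fin d) (Fin d) ℂ}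
    (h1 : ∀ i (hi : i + 1 < d), A ⟨i, by omega⟩ ⟨i + 1, hi⟩ ≠ 0)
    (h2 : ∀ i j : Fin d, (i : ℕ) + 1 < j → A i j = 0) {x : Fin d → ℂ} {μ : ℂ}
    (hx : A.mulVec x = μ • x) (hd : 0 < d) (h0 : x ⟨0, hd⟩ = 0) : x = 0 := by
  have h : ∀ k, ∀ i : Fin d, (i : ℕ) ≤ k → x i = 0 := by
    intro k
    induction k with
    | zero =>
      intro i hi
      rw [← h0]
      congr 1
      exact Fin.ext (by simpa using hi)
    | succ k ih =>
      intro i hi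
      rcases Nat.lt_or_ge (i : ℕ) (k + 1) with hk | hk
      · exact ih i (by omega)
      have hik : (i : ℕ) = k + 1 := by omega
      have hkd : k + 1 < d := by omega
      obtain rfl : i = ⟨k + 1, hkd⟩ := Fin.ext hik
      have h3 := congrFun hx ⟨k, by omega⟩
      rw [Pi.smul_apply, ih ⟨k, by omega⟩ le_rfl, smul_zero, Matrix.mulVec, dotProduct,
        Finset.sum_eq_single ⟨k + 1, hkd⟩] at h3
      · exact (mul_eq_zero.1 h3).resolve_left (h1 k hkd)
      · intro j _ hj
        rcases Nat.lt_or_ge (j : ℕ) (k + 1) with hjk | hjk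
        · rw [ih j (by omega), mul_zero]
        · have : (j : ℕ) ≠ k + 1 := fun h => hj (Fin.ext h)
          rw [h2 _ _ (show k + 1 < (j : ℕ) by omega), zero_mul]
      · simp
  exact funext fun i => h i i le_rfl

variable {E : Type*} [AddCommGroup E] [Module ℂ E]

/-- Two independent eigenvectors with the same eigenvalue would have a non-zero combination with
vanishing first coordinate, which the Hessenberg shape forbids. -/
theorem eigenvalues_injective {d : ℕ} {f : E →ₗ[ℂ] E} (γ c : Module.Basis (Fin d) ℂ E)
    {μ : Fin d → ℂ} (hc : ∀ i, f (c i) = μ i • c i)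
    (h1 : ∀ i (hi : i + 1 < d), LinearMap.toMatrix γ γ f ⟨i, by omega⟩ ⟨i + 1, hi⟩ ≠ 0)
    (h2 : ∀ i j : Fin d, (i : ℕ) + 1 < j → LinearMap.toMatrix γ γ f i j = 0) :
    Function.Injective μ := by
  intro i k hik
  by_contra hne
  have hd : 0 < d := i.pos
  have key : ∀ x : E, f x = μ i • x → γ.repr x ⟨0, hd⟩ = 0 → x = 0 := by
    intro x hx h0
    have h3 : (LinearMap.toMatrix γ γ f).mulVec (γ.repr x) = μ i • (γ.repr x : Fin d → ℂ) := by
      rw [LinearMap.toMatrix_mulVec_repr, hx, map_smul, Finsupp.coe_smul]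
    have h4 := eq_zero_of_hessenberg h1 h2 h3 hd h0
    exact γ.repr.map_eq_zero_iff.1 (Finsupp.ext fun j => congrFun h4 j)
  have h3 : γ.repr (c k) ⟨0, hd⟩ • c i - γ.repr (c i) ⟨0, hd⟩ • c k = 0 := by
    apply key
    · rw [map_sub, map_smul, map_smul, hc, hc, ← hik, smul_sub, smul_comm (μ i), smul_comm (μ i)]
    · rw [map_sub, map_smul, map_smul, Finsupp.sub_apply, Finsupp.smul_apply, Finsupp.smul_apply,
        smul_eq_mul, smul_eq_mul, mul_comm, sub_self]
  have h4 := congrArg (fun x => c.repr x i) h3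
  simp only [map_sub, map_smul, c.repr_self, Finsupp.sub_apply, Finsupp.smul_apply, map_zero,
    Finsupp.single_eq_same, Finsupp.single_eq_of_ne hne, smul_eq_mul, mul_one, mul_zero,
    sub_zero, Finsupp.zero_apply] at h4
  exact c.ne_zero k (key _ (by rw [hc, hik]) h4)

/-- The spectral theorem for a positive definite Hermitian form. -/
theorem exists_eigenbasis [FiniteDimensional ℂ E] {φ : E →ₗ⋆[ℂ] E →ₗ[ℂ] ℂ}
    (hφ : ∀ x y, starRingEnd ℂ (φ y x) = φ x y) (hpos : ∀ x, 0 ≤ (φ x x).re)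
    (hdef : ∀ x, φ x x = 0 → x = 0) {f : E →ₗ[ℂ] E} (hf : ∀ x y, φ (f x) y = φ x (f y)) {d : ℕ}
    (hd : Module.finrank ℂ E = d) :
    ∃ (μ : Fin d → ℂ) (c : Module.Basis (Fin d) ℂ E), ∀ i, f (c i) = μ i • c i := by
  let core : InnerProductSpace.Core ℂ E :=
    { inner := fun x y => φ x y
      conj_inner_symm := fun x y => hφ x y
      re_inner_nonneg := hpos
      add_left := fun x y z => by rw [map_add, LinearMap.add_apply]
      smul_left := fun x y r => by rw [LinearMap.map_smulₛₗ, LinearMap.smul_apply, smul_eq_mul]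
      definite := hdef }
  let _ := core.toNormedAddCommGroup
  let _ := InnerProductSpace.ofCore core.toCore
  have hs : f.IsSymmetric := hf
  exact ⟨fun i => hs.eigenvalues hd i, (hs.eigenvectorBasis hd).toBasis, fun i => by
    rw [OrthonormalBasis.coe_toBasis]
    exact hs.apply_eigenvectorBasis hd i⟩

end Spectrum

/-! ### Subrepresentations generated by highest-weight vectors -/

section Copies

variable {M : Type*} [AddCommGroup M] [Module ℂ M] [LieRingModule Sl3 M] [LieModule ℂ Sl3 M]
  {a b : ℕ}

/-- A vector killed by raising operators is orthogonal to the image of the lowering operators.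
Modulo the line through `u` the generated subrepresentation lies in that image, so the remainder of
`w` is orthogonal to itself. -/
theorem mem_span_of_raising_eq_zero {φ : M →ₗ⋆[ℂ] M →ₗ[ℂ] ℂ} (hdef : ∀ x, φ x x = 0 → x = 0)
    (hinv : ∀ i j x y, φ ⁅e i j, x⁆ y = φ x ⁅e j i, y⁆) {u w : M}
    (hu : u ∈ highestWeightSpace M a b) (hw : w ∈ LieSubmodule.lieSpan ℂ Sl3 {u})
    (hr : ∀ i j : Fin 3, i < j → ⁅e i j, w⁆ = 0) : w ∈ Submodule.span ℂ {u} := by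
  let R : Submodule ℂ M := Submodule.span ℂ {x | ∃ i j : Fin 3, j < i ∧ ∃ y, x = ⁅e i j, y⁆}
  have hR : ∀ v : M, (∀ i j : Fin 3, i < j → ⁅e i j, v⁆ = 0) → ∀ x ∈ R, φ x v = 0 := by
    intro v hv x hx
    induction hx using Submodule.span_induction with
    | mem x hx =>
      obtain ⟨i, j, hij, y, rfl⟩ := hx
      rw [hinv, hv j i hij, map_zero]
    | zero => rw [map_zero, LinearMap.zero_apply]
    | add x y _ _ hx hy => rw [map_add, LinearMap.add_apply, hx, hy, add_zero]
    | smul r x _ hx => rw [LinearMap.map_smulₛₗ, LinearMap.smul_apply, hx, smul_zero]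
  have hu' := mem_highestWeightSpace_iff.1 hu
  have hS := lieSpan_le_of_lowering hu'.1 hu'.2 (S := Submodule.span ℂ {u} ⊔ R)
    (Submodule.mem_sup_left (Submodule.mem_span_singleton_self u))
    (fun i j hij x _ => Submodule.mem_sup_right (Submodule.subset_span ⟨i, j, hij, x, rfl⟩))
  obtain ⟨y, hy, x, hx, rfl⟩ := Submodule.mem_sup.1 (hS hw)
  obtain ⟨r, rfl⟩ := Submodule.mem_span_singleton.1 hy
  have h1 := hR _ hr x hx
  rw [map_add, map_smul, hR u hu'.2 x hx, smul_zero, zero_add] at h1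
  rw [hdef x h1, add_zero]
  exact hy

/-- A non-zero subrepresentation contains a non-zero vector killed by the raising operators. That
vector is a multiple of `u`, and `u` generates everything. -/
theorem isIrrep_lieSpan [FiniteDimensional ℂ M] {φ : M →ₗ⋆[ℂ] M →ₗ[ℂ] ℂ}
    (hdef : ∀ x, φ x x = 0 → x = 0) (hinv : ∀ i j x y, φ ⁅e i j, x⁆ y = φ x ⁅e j i, y⁆) {u : M}
    (hu : u ∈ highestWeightSpace M a b) (hu0 : u ≠ 0) :
    IsIrrep (LieSubmodule.lieSpan ℂ Sl3 {u}) a b := by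
  have hmem : u ∈ LieSubmodule.lieSpan ℂ Sl3 {u} :=
    LieSubmodule.subset_lieSpan (R := ℂ) (L := Sl3) (Set.mem_singleton u)
  have hnt : Nontrivial (LieSubmodule.lieSpan ℂ Sl3 {u}) :=
    ⟨⟨u, hmem⟩, 0, fun h => hu0 (congrArg Subtype.val h)⟩
  have hnt' : Nontrivial (LieSubmodule ℂ Sl3 (LieSubmodule.lieSpan ℂ Sl3 {u})) :=
    (LieSubmodule.nontrivial_iff ℂ Sl3 _).2 hnt
  refine ⟨inferInstanceAs (FiniteDimensional ℂ
    (LieSubmodule.lieSpan ℂ Sl3 {u} : Submodule ℂ M)), ⟨fun N => ?_⟩, ⟨u, hmem⟩, ?_, ?_⟩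
  · by_cases hN : N = ⊥
    · exact Or.inl hN
    right
    have : Nontrivial N := (LieSubmodule.nontrivial_iff_ne_bot ℂ Sl3 _).2 hN
    have : FiniteDimensional ℂ (LieSubmodule.lieSpan ℂ Sl3 {u}) := inferInstanceAs
      (FiniteDimensional ℂ (LieSubmodule.lieSpan ℂ Sl3 {u} : Submodule ℂ M))
    have : FiniteDimensional ℂ N := inferInstanceAs (FiniteDimensional ℂ N.toSubmodule)
    obtain ⟨w, hw0, hw⟩ := exists_raising_eq_zero N
    have h1 := mem_span_of_raising_eq_zero hdef hinv hu w.1.2 fun i j hij =>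
      congrArg (fun x : N => x.1.1) (hw i j hij)
    obtain ⟨r, hr⟩ := Submodule.mem_span_singleton.1 h1
    have hr0 : r ≠ 0 := by
      rintro rfl
      rw [zero_smul] at hr
      exact hw0 (Subtype.ext (Subtype.ext hr.symm))
    have huN : (⟨u, hmem⟩ : LieSubmodule.lieSpan ℂ Sl3 {u}) ∈ N := by
      have h2 : (⟨u, hmem⟩ : LieSubmodule.lieSpan ℂ Sl3 {u}) = r⁻¹ • w.1 := by
        apply Subtype.ext
        change u = r⁻¹ • w.1.1
        rw [← hr, smul_smul, inv_mul_cancel₀ hr0, one_smul]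
      rw [h2]
      exact N.smul_mem _ w.2
    rw [eq_top_iff]
    rintro x -
    have h3 : LieSubmodule.lieSpan ℂ Sl3 {u} ≤ N.map (LieSubmodule.lieSpan ℂ Sl3 {u}).incl := by
      rw [LieSubmodule.lieSpan_le, Set.singleton_subset_iff]
      exact (LieSubmodule.mem_map _).2 ⟨_, huN, rfl⟩
    obtain ⟨y, hy, hyx⟩ := (LieSubmodule.mem_map _).1 (h3 x.2)
    rwa [← Subtype.ext hyx]
  · exact ⟨Subtype.ext hu.1, Subtype.ext hu.2.1, fun i j hij => Subtype.ext (hu.2.2 i j hij)⟩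
  · exact fun h => hu0 (congrArg Subtype.val h)

theorem IsIrrep.exists_eq_lieSpan {N : LieSubmodule ℂ Sl3 M} (hN : IsIrrep N a b) :
    ∃ v ∈ highestWeightSpace M a b, v ≠ 0 ∧ v ∈ N ∧ N = LieSubmodule.lieSpan ℂ Sl3 {v} := by
  obtain ⟨v, hv, hv0⟩ := hN.exists_highestWeight
  have := hN.irreducible
  refine ⟨v.1, ⟨congrArg Subtype.val hv.1, congrArg Subtype.val hv.2.1, fun i j hij =>
    congrArg Subtype.val (hv.2.2 i j hij)⟩, fun h => hv0 (Subtype.ext h), v.2, le_antisymm ?_ ?_⟩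
  · intro x hx
    have h1 : LieSubmodule.lieSpan ℂ Sl3 {v} ≤
        (LieSubmodule.lieSpan ℂ Sl3 {v.1}).comap N.incl := by
      rw [LieSubmodule.lieSpan_le, Set.singleton_subset_iff]
      exact LieSubmodule.subset_lieSpan (R := ℂ) (L := Sl3) (Set.mem_singleton v.1)
    rw [lieSpan_eq_top hv0] at h1
    exact h1 (LieSubmodule.mem_top (⟨x, hx⟩ : N))
  · rw [LieSubmodule.lieSpan_le, Set.singleton_subset_iff]
    exact v.2

end Copies

/-! ### Simple eigenvalues as missing labels -/

section MissingLabels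

variable {m : Labels} {V W : Type*} [AddCommGroup V] [Module ℂ V] [LieRingModule Sl3 V]
  [LieModule ℂ Sl3 V] [AddCommGroup W] [Module ℂ W] [LieRingModule Sl3 W] [LieModule ℂ Sl3 W]

/-- The eigenspaces of the action of an element of the centraliser are subrepresentations. -/
def eigenLieSubmodule (V W : Type*) [AddCommGroup V] [Module ℂ V] [LieRingModule Sl3 V]
    [LieModule ℂ Sl3 V] [AddCommGroup W] [Module ℂ W] [LieRingModule Sl3 W] [LieModule ℂ Sl3 W]
    {Z : U ⊗[ℂ] U} (hZ : Z ∈ centraliser) (μ : ℂ) : LieSubmodule ℂ Sl3 (V ⊗[ℂ] W) :=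
  { (act V W Z).eigenspace μ with
    lie_mem := fun {y x} hx => lie_mem_of_forall_e (fun i j => by
      have hx' : act V W Z x = μ • x := Module.End.mem_eigenspace_iff.1 hx
      rw [Module.End.mem_eigenspace_iff, ← lie_act_of_mem hZ, hx', lie_smul]) y }

/-- `Z` commutes with the Lie algebra, so its eigenspaces on `V ⊗ W` are subrepresentations, and
each generated copy lies in one of them; distinct eigenvalues make the copies independent. Any copy
is generated by a highest-weight vector, that is, by a combination of the eigenvectors. -/
theorem isMissingLabel [FiniteDimensional ℂ (V ⊗[ℂ] W)]
    {φ : V ⊗[ℂ] W →ₗ⋆[ℂ] V ⊗[ℂ] W →ₗ[ℂ] ℂ} (hdef : ∀ x, φ x x = 0 → x = 0)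
    (hinv : ∀ i j x y, φ ⁅e i j, x⁆ y = φ x ⁅e j i, y⁆) {Z : U ⊗[ℂ] U} (hZ : Z ∈ centraliser)
    {μ : Fin (mult m V W) → ℂ} {c : Module.Basis (Fin (mult m V W)) ℂ (multSpace m V W)}
    (hμ : Function.Injective μ)
    (hc : ∀ i, act V W Z (c i : V ⊗[ℂ] W) = μ i • (c i : V ⊗[ℂ] W)) :
    IsMissingLabel m V W Z := by
  have hle : ∀ i, LieSubmodule.lieSpan ℂ Sl3 {(c i : V ⊗[ℂ] W)} ≤
      eigenLieSubmodule V W hZ (μ i) := fun i => by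
    rw [LieSubmodule.lieSpan_le, Set.singleton_subset_iff]
    exact Module.End.mem_eigenspace_iff.2 (hc i)
  have hmem : ∀ i, (c i : V ⊗[ℂ] W) ∈ LieSubmodule.lieSpan ℂ Sl3 {(c i : V ⊗[ℂ] W)} := fun i =>
    LieSubmodule.subset_lieSpan (R := ℂ) (L := Sl3) (Set.mem_singleton _)
  have hsum : ∀ v ∈ multSpace m V W, ∃ g : Fin (mult m V W) → ℂ,
      v = ∑ i, g i • (c i : V ⊗[ℂ] W) := fun v hv => by
    refine ⟨c.repr ⟨v, hv⟩, ?_⟩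
    have h := congrArg Subtype.val (c.sum_repr ⟨v, hv⟩)
    rw [Submodule.coe_sum] at h
    exact h.symm
  refine ⟨μ, c, fun i => LieSubmodule.lieSpan ℂ Sl3 {(c i : V ⊗[ℂ] W)}, hμ, hc, fun i => rfl,
    fun i => isIrrep_lieSpan hdef hinv (c i).2 fun h => c.ne_zero i (Subtype.ext h),
    fun i x hx => Module.End.mem_eigenspace_iff.1 (hle i hx), ?_, fun N hN => ?_,
    fun N hN z hz => ?_⟩
  · rw [← LieSubmodule.iSupIndep_toSubmodule]
    exact ((act V W Z).eigenspaces_iSupIndep.comp hμ).mono hle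
  · obtain ⟨v, hv, hv0, hvN, hNv⟩ := hN.exists_eq_lieSpan
    obtain ⟨g, rfl⟩ := hsum v hv
    rw [hNv, LieSubmodule.lieSpan_le, Set.singleton_subset_iff]
    exact sum_mem fun i _ => SMulMemClass.smul_mem _ (LieSubmodule.mem_iSup_of_mem i (hmem i))
  · obtain ⟨v, hv, hv0, hvN, hNv⟩ := hN.exists_eq_lieSpan
    obtain ⟨g, hg⟩ := hsum v hv
    -- Comparison of coefficients in `Z v = z v`. As the `μ i` are distinct, exactly one coefficient
    -- of `v` survives, so `v` spans the line of a single eigenvector.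
    have hzero : ∀ i, g i * (μ i - z) = 0 := by
      have h1 : ∑ i, (g i * (μ i - z)) • c i = 0 := by
        apply Subtype.ext
        rw [Submodule.coe_sum]
        have h2 : act V W Z v = z • v := hz v hvN
        rw [hg, map_sum, Finset.smul_sum, ← sub_eq_zero, ← Finset.sum_sub_distrib] at h2
        rw [Submodule.coe_zero, ← h2]
        refine Finset.sum_congr rfl fun i _ => ?_
        rw [map_smul, hc, Submodule.coe_smul]
        module
      exact Fintype.linearIndependent_iff.1 c.linearIndependent _ h1
    obtain ⟨i, hi⟩ : ∃ i, g i ≠ 0 := by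
      by_contra! h
      exact hv0 (by rw [hg]; exact Finset.sum_eq_zero fun i _ => by rw [h, zero_smul])
    have hiz : z = μ i := (sub_eq_zero.1 ((mul_eq_zero.1 (hzero i)).resolve_left hi)).symm
    have hvi : v = g i • (c i : V ⊗[ℂ] W) := by
      rw [hg]
      refine Finset.sum_eq_single i (fun j _ hj => ?_) (by simp)
      rw [(mul_eq_zero.1 (hzero j)).resolve_right, zero_smul]
      rw [hiz, sub_eq_zero]
      exact fun h => hj (hμ h)
    refine ⟨i, hiz, le_antisymm ?_ ?_⟩
    · rw [hNv, LieSubmodule.lieSpan_le, Set.singleton_subset_iff, hvi]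
      exact SMulMemClass.smul_mem _ (hmem i)
    · rw [LieSubmodule.lieSpan_le, Set.singleton_subset_iff]
      have h3 : (c i : V ⊗[ℂ] W) = (g i)⁻¹ • v := by
        rw [hvi, smul_smul, inv_mul_cancel₀ hi, one_smul]
      rw [h3]
      exact N.smul_mem _ hvN

/-- An element of the centraliser which is symmetric and tridiagonal provides missing labels. -/
theorem isMissingLabel_of_tridiagonal [FiniteDimensional ℂ (V ⊗[ℂ] W)]
    {φ : V ⊗[ℂ] W →ₗ⋆[ℂ] V ⊗[ℂ] W →ₗ[ℂ] ℂ} (hφ : ∀ x y, starRingEnd ℂ (φ y x) = φ x y)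
    (hpos : ∀ x, 0 ≤ (φ x x).re) (hdef : ∀ x, φ x x = 0 → x = 0)
    (hinv : ∀ i j x y, φ ⁅e i j, x⁆ y = φ x ⁅e j i, y⁆) {Z : U ⊗[ℂ] U} (hZ : Z ∈ centraliser)
    (hsymm : ∀ x y, φ (act V W Z x) y = φ x (act V W Z y))
    (hZM : ∀ v ∈ multSpace m V W, act V W Z v ∈ multSpace m V W)
    (γ : Module.Basis (Fin (mult m V W)) ℂ (multSpace m V W)) {f u l : ℕ → ℚ}
    (hγ : LinearMap.toMatrix γ γ ((act V W Z).restrict hZM) = tridiagonal (mult m V W) f u l)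
    (hu : ∀ j, 1 ≤ j → j < mult m V W → u j ≠ 0) : IsMissingLabel m V W Z := by
  obtain ⟨μ, c, hc⟩ := exists_eigenbasis (E := multSpace m V W)
    (φ := (φ.compl₂ (multSpace m V W).subtype).comp (multSpace m V W).subtype)
    (f := (act V W Z).restrict hZM) (fun x y => hφ x.1 y.1)
    (fun x => hpos x.1) (fun x hx => Subtype.ext (hdef x.1 hx)) (fun x y => hsymm x.1 y.1) rfl
  refine isMissingLabel hdef hinv hZ (μ := μ) (c := c) (eigenvalues_injective γ c hc ?_ ?_)
    fun i => congrArg Subtype.val (hc i)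
  · intro i hi
    rw [hγ]
    exact tridiagonal_apply_succ hu hi
  · intro i j hij
    rw [hγ]
    exact tridiagonal_apply_of_lt hij

end MissingLabels

end MissingLabel
end

/-! ### Assembly of the theorem -/

theorem mainTheorem1 (m : MissingLabel.Labels)
    (V W : Type*) [AddCommGroup V] [Module ℂ V]
    [LieRingModule MissingLabel.Sl3 V] [LieModule ℂ MissingLabel.Sl3 V]
    [AddCommGroup W] [Module ℂ W]
    [LieRingModule MissingLabel.Sl3 W] [LieModule ℂ MissingLabel.Sl3 W]
    (hV : MissingLabel.IsIrrep V m.m₁ m.m₂) (hW : MissingLabel.IsIrrep W m.m₁' m.m₂')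
    (hd : 0 < MissingLabel.mult m V W) :
    MissingLabel.X ∈ MissingLabel.centraliser ∧
    MissingLabel.Y ∈ MissingLabel.centraliser ∧
    (MissingLabel.mult m V W : ℚ) = m.ξa - m.ξb ∧
    (∃ (hX : ∀ v ∈ MissingLabel.multSpace m V W,
          MissingLabel.act V W MissingLabel.X v ∈ MissingLabel.multSpace m V W)
        (hY : ∀ v ∈ MissingLabel.multSpace m V W,
          MissingLabel.act V W MissingLabel.Y v ∈ MissingLabel.multSpace m V W)
        (b : Module.Basis (Fin (MissingLabel.mult m V W)) ℂ (MissingLabel.multSpace m V W)),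
      LinearMap.toMatrix b b ((MissingLabel.act V W MissingLabel.X).restrict hX) =
        MissingLabel.tridiagonal (MissingLabel.mult m V W) m.aDiag m.aUp m.aLow ∧
      LinearMap.toMatrix b b ((MissingLabel.act V W MissingLabel.Y).restrict hY) =
        MissingLabel.tridiagonal (MissingLabel.mult m V W) m.bDiag m.bUp m.bLow) ∧
    (∀ j : ℕ, 1 ≤ j → j < MissingLabel.mult m V W →
      m.aUp j ≠ 0 ∧ m.aLow j ≠ 0 ∧ m.bUp j ≠ 0 ∧ m.bLow j ≠ 0) ∧
    MissingLabel.IsMissingLabel m V W MissingLabel.X ∧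
    MissingLabel.IsMissingLabel m V W MissingLabel.Y := by
  have hX : ∀ v ∈ MissingLabel.multSpace m V W,
      MissingLabel.act V W MissingLabel.X v ∈ MissingLabel.multSpace m V W := fun v hv =>
    MissingLabel.act_mem_highestWeightSpace MissingLabel.X_mem_centraliser hv
  have hY : ∀ v ∈ MissingLabel.multSpace m V W,
      MissingLabel.act V W MissingLabel.Y v ∈ MissingLabel.multSpace m V W := fun v hv =>
    MissingLabel.act_mem_highestWeightSpace MissingLabel.Y_mem_centraliser hv
  have : FiniteDimensional ℂ V := hV.finiteDimensional
  have : FiniteDimensional ℂ W := hW.finiteDimensional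
  have hnt : Nontrivial (MissingLabel.multSpace m V W) := Module.nontrivial_of_finrank_pos hd
  -- Positivity of `d` enters only here: a non-zero highest-weight vector guarantees integrality of
  -- `ℓ` and `n` and a non-empty range of exponents.
  obtain ⟨u, hu0⟩ := exists_ne (0 : MissingLabel.multSpace m V W)
  obtain ⟨n, γ, hn, hγX, hγY⟩ := MissingLabel.hasTridiagonalBasis hV hW u.2
    (fun h => hu0 (Subtype.ext h)) hX hY
  have hmult : n = MissingLabel.mult m V W := by
    rw [MissingLabel.mult, Module.finrank_eq_card_basis γ, Fintype.card_fin]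
  subst hmult
  replace hγX := hγX.trans (MissingLabel.tridiagonal_eq_triX m _).symm
  replace hγY := hγY.trans (MissingLabel.tridiagonal_eq_triY m _).symm
  have hne := fun j hj hjd => MissingLabel.Labels.offDiag_ne_zero (j := j) hn hj hjd
  obtain ⟨φ, hφ, hpos, hdef, hinv, hφX, hφY⟩ := MissingLabel.exists_hermitian_of_labels hV hW
  exact ⟨MissingLabel.X_mem_centraliser, MissingLabel.Y_mem_centraliser, hn,
    ⟨hX, hY, γ, hγX, hγY⟩, hne,
    MissingLabel.isMissingLabel_of_tridiagonal hφ hpos hdef hinv MissingLabel.X_mem_centraliser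
      hφX hX γ hγX fun j hj hjd => (hne j hj hjd).1,
    MissingLabel.isMissingLabel_of_tridiagonal hφ hpos hdef hinv MissingLabel.Y_mem_centraliser
      hφY hY γ hγY fun j hj hjd => (hne j hj hjd).2.2.1⟩
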